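/- **Definitions.** An *arrowed binary sequence* (ABS) is a finite totally ordered set $\tilde S$ with a map $\delta:\tilde S\to\{0,1\}$ and a bijection $\pi:\tilde S\to\tilde S$. The *binary expansion* of $t\in\tilde S$ is $b(t)=0.b_1b_2\cdots$ with $b_r=\delta(\pi^{-r}(t))$, and the *length* is $\ell(S)=\#\{(t',t): t'<t,\ \delta(t')=0,\ \delta(t)=1\}$. Over a perfect field $K$ of characteristic $p>0$, a $\mathrm{DM}_1$ is a finite-dimensional $K$-vector space with a Frobenius-linear map $F$ and an inverse-Frobenius-linear map $V$ satisfying $\ker F=\operatorname{im}V$ and $\ker V=\operatorname{im}F$. To an ABS corresponds the $\mathrm{DM}_1$ with basis $(e_t)_{t\in\tilde S}$, in which $Fe_t=e_{\pi(t)}$ if $\delta(t)=0$ and $Fe_t=0$ otherwise, and $Ve_{\pi(t)}=e_t$ if $\delta(t)=1$ and $Ve_{\pi(t)}=0$ otherwise. For coprime $m,n\ge 0$ with $h=m+n$, the $\mathrm{DM}_1$ $N_{m,n}$ is the one of the ABS $t_1<\dots<t_h$ with $\delta(t_i)=1$ iff $i\le m$, and $\pi(t_i)=t_{i-m \bmod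 h}$. The direct sum of two ABS's is the disjoint union with the given $\delta$ and $\pi$, ordered by binary expansion (elements of one summand with the same expansion keep their order, and those of the first summand precede those of the second); it corresponds to the direct sum of $\mathrm{DM}_1$'s. A Newton polygon $\xi=(m_1,n_1)+(m_2,n_2)$ of two segments consists of coprime pairs of non-negative integers, with slopes $\lambda_r=n_r/(m_r+n_r)$; $S_\xi=A\oplus B$ is the direct sum of the ABS's of $N_{m_1,n_1}$ and $N_{m_2,n_2}$, and $N_\xi=N_{m_1,n_1}\oplus N_{m_2,n_2}$. The $i$-th element of $A$ (of $B$) is written $\tau^A_i$ ($\tau^B_i$), where $\tau$ is its value under $\delta$. Let $S$ be an ABS with elements $t<t'$ satisfying $\delta(t)=0$, $\delta(t')=1$. The ABS $S'$ is *obtained from $S$ by exchanging $t$ and $t'$* if it has the same underlying set and the same $\delta$, its bijection is that of $S$ except that the images $t$ and $t'$ are switched, and its order $<'$ is such that $u<'v$ implies $b(u)\le b(v)$ (expansions in $S'$) and, for $\delta(u)=\delta(v)$, $u<'v$ holds iff the images of $u,v$ under the new bijection are in the same order. The exchange is *good* if $\ell(S')=\ell(S)-1$; then $S'$ and its $\mathrm{DM}_1$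 are *generic specializations* of $S$ and of its $\mathrm{DM}_1$. All labels $\tau^A_i,\tau^B_j$ are kept. **Proposition.** Let $\xi=(m_1,n_1)+(m_2,n_2)$ be a Newton polygon of two segments with $0<\lambda_2<1/2<\lambda_1<1$, and let $h_1=m_1+n_1$. Consider the generic specializations $N^-_\xi$ of $N_\xi$ whose ABS $S^-$ is obtained from $S_\xi$ by a good exchange of some $0^A_i$ and $1^B_j$ with $m_1<i\le n_1$ and $1\le j\le n_2$. (I) Suppose $n_1>m_1+1$. There is $\rho=(f,g)$, depending only on $\xi$, with $0\le f\le m_1$, $0\le g\le n_1$ and $fn_1-gm_1=1$ such that, for every such $N_\xi^-$, at least one of the following exchanges is possible in $S^-$, is good, and yields an ABS $S^{--}$ whose $\mathrm{DM}_1$ $N_\xi^{--}$ satisfies $$N^{--}_\xi\cong N^-_{\xi'}\oplus N_\rho\qquad(*)$$ for some generic specialization $N^-_{\xi'}$ of $N_{\xi'}$, where $\xi'=(m_1-f,n_1-g)+(m_2,n_2)$: (a) the exchange of $0^A_{m_1+1}$ and $1^A_{m_1}$; (b) the exchange of $0^A_{i-1}$ and $1^B_j$. (II) Suppose $n_1=m_1+1$.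 There is $\rho=(f,g)$ with $f,g\ge0$, depending only on $\xi$, such that, for every such $N_\xi^-$, at least one of the following exchanges is possible in $S^-$, is good, and yields an $N_\xi^{--}$ with $(*)$ for some generic specialization $N^-_{\xi'}$ of $N_{\xi'}$: (c) the exchange of $0^B_{m_2+1}$ and $1^B_{m_2}$, with $f\le m_2$, $g\le n_2$, $gm_2-fn_2=1$ and $\xi'=(m_1,n_1)+(m_2-f,n_2-g)$; (d) the exchange of $0^A_i$ and $1^B_{j+1}$, with $f\le m_2$, $g\le n_2$, $gm_2-fn_2=1$ and $\xi'=(m_1,n_1)+(m_2-f,n_2-g)$; (e) the exchange of $0^A_{h_1}$ and $1^B_{n_2+1}$, with $\rho=(1,1)$ and $\xi'=(m_1-1,n_1-1)+(m_2,n_2)$. In all cases $\rho$ is a coprime pair, $\xi'$ is a Newton polygon of two segments whose slopes satisfy $\lambda_2'<1/2<\lambda_1'$, and $(*)$ also holds for the corresponding ABS's, i.e. $S^{--}\cong S^-_{\xi'}\oplus S_\rho$, where $S_\rho$ is the ABS of $N_\rho$. -/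

import Mathlib

/-- An arrowed binary sequence on the set `T` of its elements: a total order on `T`, a map
`δ : T → {0, 1}` and a bijection `π : T → T`. (Everywhere below `T` is finite.) -/
structure ABS (T : Type*) where
  ord : LinearOrder T
  δ : T → Fin 2
  π : Equiv.Perm T

namespace ABS

/-- The strict order of an arrowed binary sequence. -/
def lt {T : Type*} (S : ABS T) (s t : T) : Prop := S.ord.lt s t

/-- The binary expansion `b(t) = 0.b₁b₂b₃…` with `bᵢ = δ(π⁻ⁱ(t))`, recorded as its sequence of
digits (the entry `k` is `b_{k+1}`) and compared lexicographically. The expansions are purely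
periodic, so this is the comparison of the real numbers with these digits. -/
def bin {T : Type*} (S : ABS T) (t : T) : Lex (ℕ → Fin 2) :=
  toLex fun k => S.δ ((S.π⁻¹ ^ (k + 1)) t)

/-- The length: the number of pairs `t' < t` with `δ(t') = 0` and `δ(t) = 1`. -/
noncomputable def length {T : Type*} (S : ABS T) : ℕ :=
  {q : T × T | S.δ q.1 = 0 ∧ S.δ q.2 = 1 ∧ S.lt q.1 q.2}.ncard

/-- Isomorphisms of arrowed binary sequences. -/
structure Iso {T T' : Type*} (S : ABS T) (S' : ABS T') where
  toEquiv : T ≃ T'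
  map_lt : ∀ s t, S'.lt (toEquiv s) (toEquiv t) ↔ S.lt s t
  map_δ : ∀ t, S'.δ (toEquiv t) = S.δ t
  map_π : ∀ t, S'.π (toEquiv t) = toEquiv (S.π t)

/-- The arrowed binary sequence of the simple `DM₁` `N_{m,n}`: with `h = m + n` and elements
`t₁ < ⋯ < t_h`, one has `δ(tᵢ) = 1` if and only if `i ≤ m`, and `π(tᵢ) = t_{i - m mod h}`.
The element `tᵢ` is `i - 1 : Fin (m + n)`. -/
def simple (m n : ℕ) : ABS (Fin (m + n)) where
  ord := inferInstance
  δ := fun t => if t.val < m then 1 else 0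
  π :=
    { toFun := fun t => ⟨(t.val + n) % (m + n), Nat.mod_lt _ t.pos⟩
      invFun := fun t => ⟨(t.val + m) % (m + n), Nat.mod_lt _ t.pos⟩
      left_inv := by
        intro t
        apply Fin.ext
        simp only [Nat.mod_add_mod]
        rw [show t.val + n + m = t.val + (m + n) by omega, Nat.add_mod_right,
          Nat.mod_eq_of_lt t.isLt]
      right_inv := by
        intro t
        apply Fin.ext
        simp only [Nat.mod_add_mod]
        rw [show t.val + m + n = t.val + (m + n) by omega, Nat.add_mod_right,
          Nat.mod_eq_of_lt t.isLt] }

/-- The binary expansion of an element of a disjoint union `A ⊔ B`. -/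
def sumBin {α β : Type*} (A : ABS α) (B : ABS β) : α ⊕ β → Lex (ℕ → Fin 2) :=
  Sum.elim A.bin B.bin

/-- The order on the disjoint union by binary expansions. Among elements with the same expansion,
those of the same summand keep their order and those of `A` come before those of `B`. -/
@[reducible] noncomputable def sumOrd {α β : Type*} (A : ABS α) (B : ABS β) : LinearOrder (α ⊕ β) :=
  letI := A.ord
  letI := B.ord
  LinearOrder.lift' (fun t : α ⊕ β => toLex (sumBin A B t, toLex t))
    (fun _ _ h => (Prod.ext_iff.1 h).2)

/-- The direct sum `A ⊕ B` of (admissible) arrowed binary sequences. -/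
noncomputable def sum {α β : Type*} (A : ABS α) (B : ABS β) : ABS (α ⊕ β) where
  ord := sumOrd A B
  δ := Sum.elim A.δ B.δ
  π := Equiv.sumCongr A.π B.π

/-- `S'` is the specialization of `S` obtained by exchanging `t` and `t'`: here `δ(t) = 0`,
`δ(t') = 1` and `t < t'` in `S`, the bijection of `S'` is the small modification of that of `S`
by `t` and `t'`, and the order of `S'` satisfies: `s < u` implies `b(s) ≤ b(u)`, and for
`δ(s) = δ(u)`, `s < u` if and only if the images under the new bijection are in this order. -/
structure IsExchange {T : Type*} (S : ABS T) (t t' : T) (S' : ABS T) : Prop where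
  zero : S.δ t = 0
  one : S.δ t' = 1
  lt : S.lt t t'
  δ_eq : S'.δ = S.δ
  small_fst : S'.π (S.π.symm t) = t'
  small_snd : S'.π (S.π.symm t') = t
  small_other : ∀ s, s ≠ S.π.symm t → s ≠ S.π.symm t' → S'.π s = S.π s
  bin_le : ∀ s u, S'.lt s u → S'.bin s ≤ S'.bin u
  lt_iff : ∀ s u, S'.δ s = S'.δ u → (S'.lt s u ↔ S'.lt (S'.π s) (S'.π u))

/-- The exchange of `t` and `t'` in `S` is good, and `S'` is its result. -/
def IsGoodExchange {T : Type*} (S : ABS T) (t t' : T) (S' : ABS T) : Prop :=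
  IsExchange S t t' S' ∧ S'.length + 1 = S.length

/-- `S'` is a generic specialization of `S`. -/
def IsGenericSpecialization {T : Type*} (S S' : ABS T) : Prop :=
  ∃ t t', IsGoodExchange S t t' S'

end ABS

/-- The slope `λ = n / (m + n)` of the segment `(m, n)`. -/
def segSlope (m n : ℕ) : ℚ := (n : ℚ) / ((m : ℚ) + (n : ℚ))

/-- `(m₁, n₁) + (m₂, n₂)` is a Newton polygon of two segments with `λ₂ < 1/2 < λ₁`. -/
structure IsTwoSegment (m₁ n₁ m₂ n₂ : ℕ) : Prop where
  coprime₁ : Nat.Coprime m₁ n₁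
  coprime₂ : Nat.Coprime m₂ n₂
  slope₂ : segSlope m₂ n₂ < 1 / 2
  slope₁ : 1 / 2 < segSlope m₁ n₁

/-- The elements of the arrowed binary sequence of `N_{(m₁,n₁)+(m₂,n₂)}`. -/
abbrev Elt (m₁ n₁ m₂ n₂ : ℕ) : Type := Fin (m₁ + n₁) ⊕ Fin (m₂ + n₂)

/-- The arrowed binary sequence `S = A ⊕ B` of the minimal `DM₁` `N_ξ`, `ξ = (m₁,n₁)+(m₂,n₂)`. -/
noncomputable def minimalABS (m₁ n₁ m₂ n₂ : ℕ) : ABS (Elt m₁ n₁ m₂ n₂) :=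
  (ABS.simple m₁ n₁).sum (ABS.simple m₂ n₂)

/-- The name of an element: `Sum.inl i` for the `i`-th element `τᴬᵢ` of `A`, and `Sum.inr j` for
the `j`-th element `τᴮⱼ` of `B`, with indices starting at `1`. -/
def eltName {m₁ n₁ m₂ n₂ : ℕ} : Elt m₁ n₁ m₂ n₂ → ℕ ⊕ ℕ :=
  Sum.map (fun x => x.val + 1) (fun x => x.val + 1)

section DieudonneModules

/-- A truncated Dieudonné module of level one over a perfect field `K` of characteristic `p`, with
underlying vector space `N`. -/
structure DM1 (p : ℕ) [Fact p.Prime] (K : Type*) [Field K] [CharP K p] [PerfectRing K p]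
    (N : Type*) [AddCommGroup N] [Module K N] where
  F : N →ₛₗ[frobenius K p] N
  V : N →ₛₗ[((frobeniusEquiv K p).symm : K →+* K)] N
  finite : Module.Finite K N
  ker_F : ∀ x, F x = 0 ↔ ∃ y, V y = x
  ker_V : ∀ x, V x = 0 ↔ ∃ y, F y = x

/-- Isomorphisms of `DM₁`'s. -/
structure DM1.Iso {p : ℕ} [Fact p.Prime] {K : Type*} [Field K] [CharP K p] [PerfectRing K p]
    {N N' : Type*} [AddCommGroup N] [Module K N] [AddCommGroup N'] [Module K N']
    (D : DM1 p K N) (D' : DM1 p K N') where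
  toEquiv : N ≃ₗ[K] N'
  map_F : ∀ x, D'.F (toEquiv x) = toEquiv (D.F x)
  map_V : ∀ x, D'.V (toEquiv x) = toEquiv (D.V x)

/-- The direct sum of two `DM₁`'s. -/
noncomputable def DM1.prod {p : ℕ} [Fact p.Prime] {K : Type*} [Field K] [CharP K p] [PerfectRing K p]
    {N N' : Type*} [AddCommGroup N] [Module K N] [AddCommGroup N'] [Module K N']
    (D : DM1 p K N) (D' : DM1 p K N') : DM1 p K (N × N') where
  F :=
    { toFun := fun x => (D.F x.1, D'.F x.2)
      map_add' := fun x y => by simp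
      map_smul' := fun c x => by simp [LinearMap.map_smulₛₗ] }
  V :=
    { toFun := fun x => (D.V x.1, D'.V x.2)
      map_add' := fun x y => by simp
      map_smul' := fun c x => by simp [LinearMap.map_smulₛₗ] }
  finite := by
    have := D.finite
    have := D'.finite
    infer_instance
  ker_F := fun x => by
    change (D.F x.1, D'.F x.2) = 0 ↔ ∃ y : N × N', (D.V y.1, D'.V y.2) = x
    rw [Prod.mk_eq_zero, D.ker_F, D'.ker_F]
    constructor
    · rintro ⟨⟨a, ha⟩, ⟨b, hb⟩⟩
      exact ⟨(a, b), Prod.ext ha hb⟩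
    · rintro ⟨y, rfl⟩
      exact ⟨⟨y.1, rfl⟩, ⟨y.2, rfl⟩⟩
  ker_V := fun x => by
    change (D.V x.1, D'.V x.2) = 0 ↔ ∃ y : N × N', (D.F y.1, D'.F y.2) = x
    rw [Prod.mk_eq_zero, D.ker_V, D'.ker_V]
    constructor
    · rintro ⟨⟨a, ha⟩, ⟨b, hb⟩⟩
      exact ⟨(a, b), Prod.ext ha hb⟩
    · rintro ⟨y, rfl⟩
      exact ⟨⟨y.1, rfl⟩, ⟨y.2, rfl⟩⟩

/-- The `DM₁` corresponding to an arrowed binary sequence: on the vector space with standard basis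
`e_t`, `t ∈ T`, one has `F e_t = e_{π t}` if `δ t = 0` and `F e_t = 0` otherwise, while
`V e_{π t} = e_t` if `δ t = 1` and `V e_{π t} = 0` otherwise. -/
noncomputable def ABS.dm1 (p : ℕ) [Fact p.Prime] (K : Type*) [Field K] [CharP K p] [PerfectRing K p]
    {T : Type*} [Finite T] (S : ABS T) : DM1 p K (T → K) where
  F :=
    { toFun := fun x s => if S.δ (S.π.symm s) = 0 then frobenius K p (x (S.π.symm s)) else 0
      map_add' := fun x y => by
        funext s
        by_cases h : S.δ (S.π.symm s) = 0 <;> simp [h]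
      map_smul' := fun c x => by
        funext s
        by_cases h : S.δ (S.π.symm s) = 0 <;> simp [h] }
  V :=
    { toFun := fun x t => if S.δ t = 1 then (frobeniusEquiv K p).symm (x (S.π t)) else 0
      map_add' := fun x y => by
        funext t
        by_cases h : S.δ t = 1 <;> simp [h]
      map_smul' := fun c x => by
        funext t
        by_cases h : S.δ t = 1 <;> simp [h] }
  finite := inferInstance
  ker_F := by
    intro x
    constructor
    · intro hx
      refine ⟨fun s => frobenius K p (x (S.π.symm s)), ?_⟩
      funext t
      by_cases h : S.δ t = 1
      · simp only [LinearMap.coe_mk, AddHom.coe_mk, h, if_true, Equiv.symm_apply_apply]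
        exact frobeniusEquiv_symm_apply_frobenius K p (x t)
      · have h0 : S.δ t = 0 := by omega
        have := congrFun hx (S.π t)
        simp [h0] at this
        simp [h0, this]
    · rintro ⟨y, rfl⟩
      funext s
      by_cases h : S.δ (S.π.symm s) = 0 <;> simp [h]
  ker_V := by
    intro x
    constructor
    · intro hx
      refine ⟨fun t => (frobeniusEquiv K p).symm (x (S.π t)), ?_⟩
      funext s
      by_cases h : S.δ (S.π.symm s) = 0
      · simp [h]
      · have h1 : S.δ (S.π.symm s) = 1 := by omega
        have := congrFun hx (S.π.symm s)
        simp [h1] at this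
        simp [h1, this]
    · rintro ⟨y, rfl⟩
      funext t
      by_cases h : S.δ t = 1 <;> simp [h]

end DieudonneModules

/-- The equality `N = N⁻_{ξ'} ⊕ N_ρ` for the `DM₁` `N` corresponding to `S`, where
`ξ' = (m₁', n₁') + (m₂', n₂')` and `ρ = (f, g)`: there is a generic specialization `N⁻_{ξ'}`
of `N_{ξ'}`, with arrowed binary sequence `Ψ`, for which it holds, both for the `DM₁`'s over `K`
and for the corresponding arrowed binary sequences. -/
def SplitsAs (p : ℕ) [Fact p.Prime] (K : Type*) [Field K] [CharP K p] [PerfectRing K p]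
    {T : Type*} [Finite T] (S : ABS T) (m₁' n₁' m₂' n₂' f g : ℕ) : Prop :=
  IsTwoSegment m₁' n₁' m₂' n₂' ∧ Nat.Coprime f g ∧
    ∃ Ψ : ABS (Elt m₁' n₁' m₂' n₂'),
      (minimalABS m₁' n₁' m₂' n₂').IsGenericSpecialization Ψ ∧
      Nonempty (S.Iso (Ψ.sum (ABS.simple f g))) ∧
      Nonempty ((S.dm1 p K).Iso ((Ψ.dm1 p K).prod ((ABS.simple f g).dm1 p K)))

/-- The elements of `S⁻` named `u` and `v` can be exchanged in `S⁻`, this exchange is good, and the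
resulting `S⁻⁻` satisfies `N⁻⁻ = N⁻_{ξ'} ⊕ N_ρ`, for `ξ' = (m₁', n₁') + (m₂', n₂')`
and `ρ = (f, g)`. -/
def SecondExchange (p : ℕ) [Fact p.Prime] (K : Type*) [Field K] [CharP K p] [PerfectRing K p]
    {m₁ n₁ m₂ n₂ : ℕ} (Sm : ABS (Elt m₁ n₁ m₂ n₂)) (u v : ℕ ⊕ ℕ)
    (m₁' n₁' m₂' n₂' f g : ℕ) : Prop :=
  ∃ (s t : Elt m₁ n₁ m₂ n₂) (Smm : ABS (Elt m₁ n₁ m₂ n₂)),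
    eltName s = u ∧ eltName t = v ∧ Sm.IsGoodExchange s t Smm ∧
      SplitsAs p K Smm m₁' n₁' m₂' n₂' f g

/-! The bijection of S⁻ is (i j)∘(π_A ⊔ π_B). Let p and q = p + 1 be neighbours in A. The
permutation (p q)∘π_A breaks the cycle π_A into two, one through p and one through q. Neither cycle
contains both neighbours, so the switch does not affect comparisons within it, and a regular
sequence in which the ones precede the zeros is that of some N_{f,g} (`Regular.exists_iso_simple`).
Summing the displacements π(x) - x over the cycle of p gives f n₁ - g m₁ = 1, which fixes ρ = (f,
g); the other cycle is N_{m₁-f,n₁-g}. Now (s t)(i j) = (i j)(p q) holds when {s, t} = {p, q} is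
disjoint from {i, j}, and also when q = i, s = p, t = j. These are the exchanges (a) and (b): if i
is not in the cycle of p, they turn S⁻ into the result of exchanging i and j in S_{ξ'}, plus S_ρ.
For (c) and (d) the summand B is cut instead, by the symmetry that reverses orders and interchanges
0 and 1. In (e) an explicit relabelling does the work.

The second exchange is good by a count of lengths. Every exchange lowers the length by 1 plus twice
the number of certain defects (`IsExchange.length_add`), so a lower bound for the length of S⁻⁻ is
enough; it follows from `length_sum` and the determinant identity `cross_add`.

The main difficulty is that exchanging i and j in S_{ξ'} must again be good. In S_ξ goodness means
that the orbit of i in A and that of any k > i lying before j keep their order and have equal types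
until the types become (1, 0), without meeting i, and similarly in B below j (`resolves_up`,
`resolves_down`, `exists_isGoodExchange`). On A the bijection is translation by n modulo m + n, and
the two orbits stay at distance d = k - i until the boundary m separates them. By
`Separation.dichotomy`, either no such orbit meets i - 1 in time, and switching i - 1 and i is
harmless, or every k for which the switch at the boundary m would be harmful lies in the cycle that
is split off (`exists_resolving_switch`). -/

namespace ABS

/-! ### Binary expansions and regular orders -/

section Basics

variable {T T' : Type*}

theorem lt_irrefl (S : ABS T) (x : T) : ¬ S.lt x x :=
  letI := S.ord; _root_.lt_irrefl x

theorem lt_asymm (S : ABS T) {x y : T} (h : S.lt x y) : ¬ S.lt y x :=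
  letI := S.ord; _root_.lt_asymm (a := x) h

theorem lt_trichotomy (S : ABS T) (x y : T) : S.lt x y ∨ x = y ∨ S.lt y x :=
  letI := S.ord; _root_.lt_trichotomy x y

theorem δ_eq_zero_or_one (S : ABS T) (x : T) : S.δ x = 0 ∨ S.δ x = 1 := by
  have := (S.δ x).isLt
  omega

theorem δ_eq_one_of_ne_zero (S : ABS T) {x : T} (h : S.δ x ≠ 0) : S.δ x = 1 :=
  (S.δ_eq_zero_or_one x).resolve_left h

theorem bin_π_zero (S : ABS T) (x : T) : ofLex (S.bin (S.π x)) 0 = S.δ x := by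
  simp [bin]

theorem bin_π_succ (S : ABS T) (x : T) (k : ℕ) :
    ofLex (S.bin (S.π x)) (k + 1) = ofLex (S.bin x) k := by
  change S.δ ((S.π⁻¹ ^ (k + 1 + 1)) (S.π x)) = S.δ ((S.π⁻¹ ^ (k + 1)) x)
  rw [pow_succ _ (k + 1), Equiv.Perm.mul_apply, show S.π⁻¹ (S.π x) = x from S.π.symm_apply_apply x]

theorem bin_lt_iff_exists {a b : Lex (ℕ → Fin 2)} :
    a < b ↔ ∃ k, (∀ l < k, ofLex a l = ofLex b l) ∧ ofLex a k < ofLex b k := Iff.rfl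

theorem bin_le_iff {a b : Lex (ℕ → Fin 2)} : a ≤ b ↔ a < b ∨ a = b := le_iff_lt_or_eq

theorem bin_le_iff_not_lt {a b : Lex (ℕ → Fin 2)} : a ≤ b ↔ ¬ b < a := not_lt.symm

theorem bin_π_eq_iff (S : ABS T) (S' : ABS T') (x : T) (y : T') :
    S.bin (S.π x) = S'.bin (S'.π y) ↔ S.δ x = S'.δ y ∧ S.bin x = S'.bin y := by
  constructor
  · intro h
    refine ⟨by rw [← bin_π_zero, h, bin_π_zero], ?_⟩
    apply ofLex.injective
    funext k
    rw [← bin_π_succ, h, bin_π_succ]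
  · rintro ⟨h, h'⟩
    apply ofLex.injective
    funext k
    cases k with
    | zero => rw [bin_π_zero, bin_π_zero, h]
    | succ k => rw [bin_π_succ, bin_π_succ, h']

theorem bin_π_lt_iff (S : ABS T) (S' : ABS T') (x : T) (y : T') :
    S.bin (S.π x) < S'.bin (S'.π y) ↔
      S.δ x < S'.δ y ∨ S.δ x = S'.δ y ∧ S.bin x < S'.bin y := by
  simp only [bin_lt_iff_exists]
  constructor
  · rintro ⟨k, hk, hlt⟩
    cases k with
    | zero => rw [bin_π_zero, bin_π_zero] at hlt; exact Or.inl hlt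
    | succ k =>
      refine Or.inr ⟨?_, k, fun l hl => ?_, ?_⟩
      · have := hk 0 (by omega)
        rwa [bin_π_zero, bin_π_zero] at this
      · have := hk (l + 1) (by omega)
        rwa [bin_π_succ, bin_π_succ] at this
      · rwa [bin_π_succ, bin_π_succ] at hlt
  · rintro (h | ⟨h, k, hk, hlt⟩)
    · exact ⟨0, by simp, by rwa [bin_π_zero, bin_π_zero]⟩
    · refine ⟨k + 1, fun l hl => ?_, by rwa [bin_π_succ, bin_π_succ]⟩
      cases l with
      | zero => rw [bin_π_zero, bin_π_zero, h]
      | succ l => rw [bin_π_succ, bin_π_succ]; exact hk l (by omega)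

/-- Expansions are purely periodic, so δ(x) is itself a digit, at every position divisible by the
order of the bijection; a common multiple of the two orders reads it off in both sequences. -/
theorem δ_eq_of_bin_eq [Finite T] [Finite T'] (S : ABS T) (S' : ABS T') {x : T} {y : T'}
    (h : S.bin x = S'.bin y) : S.δ x = S'.δ y := by
  have h1 : 0 < orderOf S.π⁻¹ := orderOf_pos _
  have h2 : 0 < orderOf S'.π⁻¹ := orderOf_pos _
  obtain ⟨k, hk⟩ : ∃ k, orderOf S.π⁻¹ * orderOf S'.π⁻¹ = k + 1 :=
    ⟨_, (Nat.succ_pred_eq_of_pos (Nat.mul_pos h1 h2)).symm⟩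
  have e1 : S.π⁻¹ ^ (k + 1) = 1 := by rw [← hk, pow_mul, pow_orderOf_eq_one, one_pow]
  have e2 : S'.π⁻¹ ^ (k + 1) = 1 := by
    rw [← hk, mul_comm, pow_mul, pow_orderOf_eq_one, one_pow]
  have := congrArg (fun b : Lex (ℕ → Fin 2) => ofLex b k) h
  simpa only [bin, ofLex_toLex, e1, e2, Equiv.Perm.one_apply] using this

theorem bin_π_eq_of_bin_eq [Finite T] [Finite T'] (S : ABS T) (S' : ABS T') {x : T} {y : T'}
    (h : S.bin x = S'.bin y) : S.bin (S.π x) = S'.bin (S'.π y) :=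
  (bin_π_eq_iff _ _ _ _).2 ⟨δ_eq_of_bin_eq S S' h, h⟩

theorem bin_pow_eq_of_bin_eq [Finite T] [Finite T'] (S : ABS T) (S' : ABS T') {x : T} {y : T'}
    (h : S.bin x = S'.bin y) (k : ℕ) : S.bin ((S.π ^ k) x) = S'.bin ((S'.π ^ k) y) := by
  induction k with
  | zero => simpa using h
  | succ k ih =>
    rw [pow_succ', pow_succ', Equiv.Perm.mul_apply, Equiv.Perm.mul_apply]
    exact bin_π_eq_of_bin_eq _ _ ih

/-- The order is compatible with the bijection, in one step. -/
structure Regular (S : ABS T) : Prop where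
  lt_iff : ∀ x y, S.δ x = S.δ y → (S.lt x y ↔ S.lt (S.π x) (S.π y))
  lt_of : ∀ x y, S.δ x = 0 → S.δ y = 1 → S.lt (S.π x) (S.π y)

/-- Pulling both elements back along the bijection moves the first disagreement of the expansions to
the first digit, where `lt_of` decides. -/
theorem Regular.bin_le {S : ABS T} (hS : S.Regular) {x y : T} (h : S.lt x y) :
    S.bin x ≤ S.bin y := by
  by_contra hlt
  rw [not_le] at hlt
  obtain ⟨k, hk, hlt⟩ := hlt
  change ∀ j < k, ofLex (S.bin y) j = ofLex (S.bin x) j at hk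
  change ofLex (S.bin y) k < ofLex (S.bin x) k at hlt
  induction k generalizing x y with
  | zero =>
    obtain ⟨x, rfl⟩ := S.π.surjective x
    obtain ⟨y, rfl⟩ := S.π.surjective y
    rw [bin_π_zero, bin_π_zero] at hlt
    exact S.lt_asymm h (hS.lt_of y x (by omega) (by omega))
  | succ k ih =>
    obtain ⟨x, rfl⟩ := S.π.surjective x
    obtain ⟨y, rfl⟩ := S.π.surjective y
    have h0 := hk 0 (by omega)
    rw [bin_π_zero, bin_π_zero] at h0
    rw [bin_π_succ, bin_π_succ] at hlt
    refine ih ((hS.lt_iff x y h0.symm).2 h) (fun j hj => ?_) hlt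
    have := hk (j + 1) (by omega)
    rwa [bin_π_succ, bin_π_succ] at this

/-- The two conditions on the order in the definition of an exchange amount to regularity;
`Regular.bin_le` is the converse direction. -/
theorem Regular.of_bin_le {S : ABS T} (h1 : ∀ x y, S.lt x y → S.bin x ≤ S.bin y)
    (h2 : ∀ x y, S.δ x = S.δ y → (S.lt x y ↔ S.lt (S.π x) (S.π y))) : S.Regular where
  lt_iff := h2
  lt_of x y hx hy := by
    have hb : S.bin (S.π x) < S.bin (S.π y) := by
      rw [bin_π_lt_iff, hx, hy]; exact Or.inl (by decide)
    rcases S.lt_trichotomy (S.π x) (S.π y) with h | h | h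
    · exact h
    · rw [h] at hb; exact absurd hb (_root_.lt_irrefl _)
    · exact absurd (h1 _ _ h) (not_le.2 hb)

theorem IsExchange.regular {S S' : ABS T} {t t' : T} (h : IsExchange S t t' S') : S'.Regular :=
  Regular.of_bin_le h.bin_le h.lt_iff

theorem Regular.lt_of_bin_lt {S : ABS T} (hS : S.Regular) {x y : T} (h : S.bin x < S.bin y) :
    S.lt x y := by
  rcases S.lt_trichotomy x y with h' | h' | h'
  · exact h'
  · rw [h'] at h; exact absurd h (_root_.lt_irrefl _)
  · exact absurd (hS.bin_le h') (not_le.2 h)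

theorem IsExchange.π_eq [DecidableEq T] {S S' : ABS T} {t t' : T} (h : IsExchange S t t' S') :
    S'.π = Equiv.swap t t' * S.π := by
  ext x
  rw [Equiv.Perm.mul_apply, Equiv.swap_apply_def]
  split_ifs with h1 h2
  · rw [← h.small_fst, ← h1]; simp
  · rw [← h.small_snd, ← h2]; simp
  · exact h.small_other x (fun e => h1 (by simp [e])) (fun e => h2 (by simp [e]))

theorem isExchange_of_π_eq [DecidableEq T] {S S' : ABS T} {t t' : T} (h0 : S.δ t = 0)
    (h1 : S.δ t' = 1) (hlt : S.lt t t') (hδ : S'.δ = S.δ)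
    (hπ : S'.π = Equiv.swap t t' * S.π) (hS' : S'.Regular) : IsExchange S t t' S' where
  zero := h0
  one := h1
  lt := hlt
  δ_eq := hδ
  small_fst := by simp [hπ]
  small_snd := by simp [hπ]
  small_other s h h' := by
    rw [hπ, Equiv.Perm.mul_apply, Equiv.swap_apply_of_ne_of_ne]
    · rintro rfl; exact h (by simp)
    · rintro rfl; exact h' (by simp)
  bin_le _ _ := hS'.bin_le
  lt_iff := hS'.lt_iff

theorem exists_rank [Finite T] (S : ABS T) :
    ∃ φ : T → ℕ, Function.Injective φ ∧ ∀ x y, S.lt x y ↔ φ x < φ y := by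
  classical
  let := S.ord
  have := Fintype.ofFinite T
  let e := (Fintype.orderIsoFinOfCardEq T rfl)
  refine ⟨fun x => (e.symm x).val, fun x y h => e.symm.injective (Fin.ext h), fun x y => ?_⟩
  exact (e.symm.lt_iff_lt (x := x) (y := y)).symm

end Basics

/-! ### Direct sums -/

section Sum

variable {α β : Type*} (A : ABS α) (B : ABS β)

@[simp] theorem sum_δ_inl (a : α) : (A.sum B).δ (Sum.inl a) = A.δ a := rfl
@[simp] theorem sum_δ_inr (b : β) : (A.sum B).δ (Sum.inr b) = B.δ b := rfl
@[simp] theorem sum_π_inl (a : α) : (A.sum B).π (Sum.inl a) = Sum.inl (A.π a) := rfl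
@[simp] theorem sum_π_inr (b : β) : (A.sum B).π (Sum.inr b) = Sum.inr (B.π b) := rfl

theorem sum_lt_iff (x y : α ⊕ β) : (A.sum B).lt x y ↔
    sumBin A B x < sumBin A B y ∨
      sumBin A B x = sumBin A B y ∧ Sum.Lex A.lt B.lt x y := by
  let := A.ord
  let := B.ord
  change toLex (sumBin A B x, toLex x) < toLex (sumBin A B y, toLex y) ↔ _
  rw [Prod.Lex.toLex_lt_toLex]
  exact Iff.rfl

theorem sum_lt_inl_inl {x y : α} : (A.sum B).lt (Sum.inl x) (Sum.inl y) ↔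
    A.bin x < A.bin y ∨ A.bin x = A.bin y ∧ A.lt x y := by
  rw [sum_lt_iff, Sum.lex_inl_inl]; rfl

theorem sum_lt_inr_inr {x y : β} : (A.sum B).lt (Sum.inr x) (Sum.inr y) ↔
    B.bin x < B.bin y ∨ B.bin x = B.bin y ∧ B.lt x y := by
  rw [sum_lt_iff, Sum.lex_inr_inr]; rfl

theorem sum_lt_inl_inr {x : α} {y : β} : (A.sum B).lt (Sum.inl x) (Sum.inr y) ↔
    A.bin x ≤ B.bin y := by
  rw [sum_lt_iff, bin_le_iff]
  simp [sumBin]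

theorem sum_lt_inr_inl {x : α} {y : β} : (A.sum B).lt (Sum.inr y) (Sum.inl x) ↔
    B.bin y < A.bin x := by
  rw [sum_lt_iff]
  simp [sumBin]

variable {A B}

theorem Regular.sum_lt_inl_inl (hA : A.Regular) {x y : α} :
    (A.sum B).lt (Sum.inl x) (Sum.inl y) ↔ A.lt x y := by
  rw [ABS.sum_lt_inl_inl]
  constructor
  · rintro (h | h)
    exacts [hA.lt_of_bin_lt h, h.2]
  · intro h
    rcases (hA.bin_le h).lt_or_eq with h' | h'
    exacts [Or.inl h', Or.inr ⟨h', h⟩]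

theorem Regular.sum_lt_inr_inr (hB : B.Regular) {x y : β} :
    (A.sum B).lt (Sum.inr x) (Sum.inr y) ↔ B.lt x y := by
  rw [ABS.sum_lt_inr_inr]
  constructor
  · rintro (h | h)
    exacts [hB.lt_of_bin_lt h, h.2]
  · intro h
    rcases (hB.bin_le h).lt_or_eq with h' | h'
    exacts [Or.inl h', Or.inr ⟨h', h⟩]

theorem Regular.sum (hA : A.Regular) (hB : B.Regular) : (A.sum B).Regular where
  lt_iff x y h := by
    rcases x with x | x <;> rcases y with y | y
    · simp only [sum_δ_inl, sum_π_inl, hA.sum_lt_inl_inl] at h ⊢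
      exact hA.lt_iff x y h
    · simp only [sum_δ_inl, sum_δ_inr, sum_π_inl, sum_π_inr, sum_lt_inl_inr] at h ⊢
      rw [bin_le_iff_not_lt, bin_le_iff_not_lt, bin_π_lt_iff, h]
      simp
    · simp only [sum_δ_inl, sum_δ_inr, sum_π_inl, sum_π_inr, sum_lt_inr_inl] at h ⊢
      rw [bin_π_lt_iff, h]
      simp
    · simp only [sum_δ_inr, sum_π_inr, hB.sum_lt_inr_inr] at h ⊢
      exact hB.lt_iff x y h
  lt_of x y hx hy := by
    rcases x with x | x <;> rcases y with y | y
    · simp only [sum_δ_inl, sum_π_inl, hA.sum_lt_inl_inl] at *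
      exact hA.lt_of x y hx hy
    · simp only [sum_δ_inl, sum_δ_inr, sum_π_inl, sum_π_inr, sum_lt_inl_inr] at *
      exact ((bin_π_lt_iff _ _ _ _).2 (Or.inl (by rw [hx, hy]; decide))).le
    · simp only [sum_δ_inl, sum_δ_inr, sum_π_inl, sum_π_inr, sum_lt_inr_inl] at *
      exact (bin_π_lt_iff _ _ _ _).2 (Or.inl (by rw [hx, hy]; decide))
    · simp only [sum_δ_inr, sum_π_inr, hB.sum_lt_inr_inr] at *
      exact hB.lt_of x y hx hy

end Sum

/-! ### Isomorphisms and transport of structure -/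

section Transport

variable {T T' : Type*}

/-- The arrowed binary sequence obtained by transport along a bijection. -/
def transport (e : T ≃ T') (S : ABS T') : ABS T where
  ord := letI := S.ord; LinearOrder.lift' e e.injective
  δ := S.δ ∘ e
  π := (e.trans S.π).trans e.symm

/-- A sequence is isomorphic to its transports. -/
def transportIso (e : T ≃ T') (S : ABS T') : (S.transport e).Iso S where
  toEquiv := e
  map_lt _ _ := Iff.rfl
  map_δ _ := rfl
  map_π t := by simp [transport]

theorem Iso.regular {S : ABS T} {S' : ABS T'} (e : S.Iso S') (h : S'.Regular) : S.Regular where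
  lt_iff x y hxy := by
    rw [← e.map_lt, ← e.map_lt, h.lt_iff _ _ (by rw [e.map_δ, e.map_δ, hxy]), e.map_π, e.map_π]
  lt_of x y hx hy := by
    rw [← e.map_lt, ← e.map_π, ← e.map_π]
    exact h.lt_of _ _ (by rw [e.map_δ, hx]) (by rw [e.map_δ, hy])

theorem Iso.length_eq {S : ABS T} {S' : ABS T'} (e : S.Iso S') : S.length = S'.length := by
  unfold length
  refine Set.ncard_congr (fun q _ => (e.toEquiv q.1, e.toEquiv q.2)) ?_ ?_ ?_
  · rintro ⟨x, y⟩ ⟨h1, h2, h3⟩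
    exact ⟨by rw [e.map_δ]; exact h1, by rw [e.map_δ]; exact h2, (e.map_lt _ _).2 h3⟩
  · rintro ⟨x, y⟩ ⟨x', y'⟩ _ _ h
    simpa using h
  · rintro ⟨x, y⟩ ⟨h1, h2, h3⟩
    refine ⟨(e.toEquiv.symm x, e.toEquiv.symm y), ⟨?_, ?_, ?_⟩, by simp⟩
    · rw [← e.map_δ]; simpa using h1
    · rw [← e.map_δ]; simpa using h2
    · rw [← e.map_lt]; simpa using h3

end Transport

end ABS

namespace ABS

/-! ### The length of a direct sum -/

section Cross

open Classical in
theorem ncard_eq_sum {α β : Type*} [Fintype α] [Fintype β] (P : α → β → Prop) :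
    {q : α × β | P q.1 q.2}.ncard = ∑ a, ∑ b, if P a b then 1 else 0 := by
  rw [← Fintype.sum_prod_type' (f := fun a b => if P a b then 1 else 0), ← Finset.card_filter,
    ← Set.ncard_coe_finset]
  congr 1
  ext q
  simp

/-- The number of elements with a given value of `δ`. -/
noncomputable def count {α : Type*} (A : ABS α) (v : Fin 2) : ℕ := {a | A.δ a = v}.ncard

/-- The number of pairs `(a, b)` of elements of `A` and `B` with `δ(a) = 0`, `δ(b) = 1` and
`b(a) < b(b)`. -/
noncomputable def cross {α β : Type*} (A : ABS α) (B : ABS β) : ℕ :=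
  {q : α × β | A.δ q.1 = 0 ∧ B.δ q.2 = 1 ∧ A.bin q.1 < B.bin q.2}.ncard

theorem ncard_add_of_iff {α : Type*} [Finite α] {s t u : Set α} (h : ∀ x, x ∈ s ↔ x ∈ t ∨ x ∈ u)
    (h' : ∀ x, x ∈ t → x ∉ u) : s.ncard = t.ncard + u.ncard := by
  rw [← Set.ncard_union_eq (Set.disjoint_left.2 h')]
  congr 1
  ext x
  exact h x

variable {α β : Type*} [Finite α] [Finite β] (A : ABS α) (B : ABS β)

/-- Comparing the expansions of pairs before and after one step. -/
theorem cross_add : A.cross B + A.count 1 * B.count 0 = B.cross A + A.count 0 * B.count 1 := by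
  -- The pairs with b(a) < b(b) are counted twice, directly and after applying both bijections. By
  -- `bin_π_lt_iff` the second count consists of all pairs of types (0, 1) and the ordered pairs of
  -- equal types; the latter cancel.
  have step : {q : α × β | A.bin q.1 < B.bin q.2}.ncard =
      {q : α × β | A.bin (A.π q.1) < B.bin (B.π q.2)}.ncard := by
    symm
    refine Set.ncard_congr (fun q _ => Equiv.prodCongr A.π B.π q) (fun q hq => hq)
      (fun q q' _ _ h => (Equiv.prodCongr A.π B.π).injective h) fun q hq =>
        ⟨(Equiv.prodCongr A.π B.π).symm q, ?_, Equiv.apply_symm_apply _ q⟩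
    simpa using hq
  have e1 : {q : α × β | A.bin (A.π q.1) < B.bin (B.π q.2)}.ncard =
      {q : α × β | A.δ q.1 = 0 ∧ B.δ q.2 = 1}.ncard +
        {q : α × β | A.δ q.1 = B.δ q.2 ∧ A.bin q.1 < B.bin q.2}.ncard := by
    refine ncard_add_of_iff (fun q => ?_) ?_
    · simp only [Set.mem_ofPred_eq, bin_π_lt_iff]
      refine or_congr ?_ Iff.rfl
      have := (A.δ q.1).isLt
      have := (B.δ q.2).isLt
      omega
    · rintro q ⟨h1, h2⟩ ⟨h3, -⟩
      rw [h1, h2] at h3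
      exact absurd h3 (by decide)
  have e2 : {q : α × β | A.bin q.1 < B.bin q.2}.ncard =
      {q : α × β | A.δ q.1 = B.δ q.2 ∧ A.bin q.1 < B.bin q.2}.ncard +
        {q : α × β | A.δ q.1 ≠ B.δ q.2 ∧ A.bin q.1 < B.bin q.2}.ncard := by
    refine ncard_add_of_iff (fun q => ?_) fun q h h' => h'.1 h.1
    simp only [Set.mem_ofPred_eq]
    tauto
  have e2' : {q : α × β | A.δ q.1 ≠ B.δ q.2 ∧ A.bin q.1 < B.bin q.2}.ncard = A.cross B +
        {q : α × β | A.δ q.1 = 1 ∧ B.δ q.2 = 0 ∧ A.bin q.1 < B.bin q.2}.ncard := by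
    refine ncard_add_of_iff (fun q => ?_) ?_
    · have := (A.δ q.1).isLt
      have := (B.δ q.2).isLt
      simp only [Set.mem_ofPred_eq, ← and_assoc, ← or_and_right]
      refine and_congr_left' ?_
      omega
    · rintro q ⟨h1, -⟩ ⟨h2, -⟩
      rw [h1] at h2
      exact absurd h2 (by decide)
  have e3 : A.count 0 * B.count 1 = {q : α × β | A.δ q.1 = 0 ∧ B.δ q.2 = 1}.ncard := by
    rw [count, count, ← Set.ncard_prod]
    rfl
  have e4 : A.count 1 * B.count 0 =
      {q : α × β | A.δ q.1 = 1 ∧ B.δ q.2 = 0 ∧ A.bin q.1 < B.bin q.2}.ncard +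
        {q : α × β | A.δ q.1 = 1 ∧ B.δ q.2 = 0 ∧ B.bin q.2 < A.bin q.1}.ncard := by
    rw [count, count, ← Set.ncard_prod]
    refine ncard_add_of_iff (fun q => ⟨?_, ?_⟩) ?_
    · rintro ⟨h1, h2⟩
      simp only [Set.mem_ofPred_eq] at h1 h2
      rcases _root_.lt_trichotomy (A.bin q.1) (B.bin q.2) with h | h | h
      · exact Or.inl ⟨h1, h2, h⟩
      · have := δ_eq_of_bin_eq A B h
        rw [h1, h2] at this
        exact absurd this (by decide)
      · exact Or.inr ⟨h1, h2, h⟩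
    · rintro (h | h)
      exacts [⟨h.1, h.2.1⟩, ⟨h.1, h.2.1⟩]
    · rintro q ⟨-, -, h⟩ ⟨-, -, h'⟩
      exact absurd h' (_root_.lt_asymm h)
  have e5 : B.cross A = {q : α × β | A.δ q.1 = 1 ∧ B.δ q.2 = 0 ∧ B.bin q.2 < A.bin q.1}.ncard :=
    Set.ncard_congr (fun q _ => (q.2, q.1)) (fun q h => ⟨h.2.1, h.1, h.2.2⟩)
      (fun q q' _ _ h => Prod.ext (Prod.ext_iff.1 h).2 (Prod.ext_iff.1 h).1)
      fun q h => ⟨(q.2, q.1), ⟨h.2.1, h.1, h.2.2⟩, rfl⟩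
  omega

variable {A B}

/-- The length of a direct sum. -/
theorem length_sum (hA : A.Regular) (hB : B.Regular) :
    (A.sum B).length = A.length + B.length + A.cross B + B.cross A := by
  classical
  have := Fintype.ofFinite α
  have := Fintype.ofFinite β
  -- Equal expansions force equal types, so the tie-breaking rule of the direct sum has no influence
  -- on the length.
  have h1 : ∀ a b, (A.δ a = 0 ∧ B.δ b = 1 ∧ A.bin a ≤ B.bin b) ↔
      (A.δ a = 0 ∧ B.δ b = 1 ∧ A.bin a < B.bin b) := by
    refine fun a b => and_congr_right fun h1 => and_congr_right fun h2 =>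
      ⟨fun h3 => lt_of_le_of_ne h3 fun h => ?_, le_of_lt⟩
    have := δ_eq_of_bin_eq A B h
    rw [h1, h2] at this
    exact absurd this (by decide)
  unfold length cross
  rw [ncard_eq_sum fun a b => (A.sum B).δ a = 0 ∧ (A.sum B).δ b = 1 ∧ (A.sum B).lt a b,
    ncard_eq_sum fun a b => A.δ a = 0 ∧ A.δ b = 1 ∧ A.lt a b,
    ncard_eq_sum fun a b => B.δ a = 0 ∧ B.δ b = 1 ∧ B.lt a b,
    ncard_eq_sum fun a b => A.δ a = 0 ∧ B.δ b = 1 ∧ A.bin a < B.bin b,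
    ncard_eq_sum fun a b => B.δ a = 0 ∧ A.δ b = 1 ∧ B.bin a < A.bin b]
  simp only [Fintype.sum_sum_type, Finset.sum_add_distrib, sum_δ_inl, sum_δ_inr, sum_lt_inl_inr,
    sum_lt_inr_inl, hA.sum_lt_inl_inl, hB.sum_lt_inr_inr, h1]
  have e : ∀ p q r s : ℕ, (p + q) + (r + s) = p + s + r + q := by intros; omega
  refine (e _ _ _ _).trans ?_
  congr!

end Cross

/-! ### How an exchange changes the length -/

section Exchange

variable {T : Type*} [DecidableEq T] {S S' : ABS T} {t t' : T}

open Equiv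

/-- The pairs of elements whose order is reversed on passing from the old order, with the places
of `t` and `t'` switched, to the order of `S'`. -/
def inversions (S : ABS T) (t t' : T) (S' : ABS T) : Set (T × T) :=
  {q | S.lt (swap t t' q.1) (swap t t' q.2) ∧ S'.lt q.2 q.1}

/-- The inversions `(x, y)` with `δ(x) = 0` and `δ(y) = 1`. -/
def badInversions (S : ABS T) (t t' : T) (S' : ABS T) : Set (T × T) :=
  {q | S.δ q.1 = 0 ∧ S.δ q.2 = 1 ∧ q ∈ inversions S t t' S'}

/-- The elements between `t` and `t'` that are on the wrong side in `S'`. -/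
def wrongSide (S : ABS T) (t t' : T) (S' : ABS T) : Set T :=
  {z | S.lt t z ∧ S.lt z t' ∧ ((S.δ z = 0 ∧ S'.lt t z) ∨ (S.δ z = 1 ∧ S'.lt z t'))}

/-- Undoing the swap turns `S'.π` into `S.π`, so regularity of both sequences compares images with
sources. For different types both orders of the images are prescribed and agree, so only pairs of
equal types can be reversed. -/
theorem IsExchange.mem_inversions_π (hS : S.Regular) (h : IsExchange S t t' S') (x y : T) :
    (S'.π x, S'.π y) ∈ inversions S t t' S' ↔ S.δ x = S.δ y ∧ S.lt x y ∧ S'.lt y x := by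
  have hS' := h.regular
  have e : ∀ z, swap t t' (S'.π z) = S.π z := by intro z; simp [h.π_eq]
  simp only [inversions, Set.mem_ofPred_eq, e]
  rcases S.δ_eq_zero_or_one x with hx | hx <;> rcases S.δ_eq_zero_or_one y with hy | hy
  · have h1 : S.δ x = S.δ y := by rw [hx, hy]
    have h2 : S'.δ y = S'.δ x := by rw [h.δ_eq, hx, hy]
    rw [← hS.lt_iff x y h1, ← hS'.lt_iff y x h2]
    tauto
  · rw [hx, hy]
    have := hS'.lt_of x y (by rw [h.δ_eq, hx]) (by rw [h.δ_eq, hy])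
    have := S'.lt_asymm this
    simp [this]
  · rw [hx, hy]
    have := S.lt_asymm (hS.lt_of y x hy hx)
    simp [this]
  · have h1 : S.δ x = S.δ y := by rw [hx, hy]
    have h2 : S'.δ y = S'.δ x := by rw [h.δ_eq, hx, hy]
    rw [← hS.lt_iff x y h1, ← hS'.lt_iff y x h2]
    tauto

theorem ncard_eq_of_bij {α β : Type*} {s : Set α} {u : Set β} (f : α → β) (g : β → α)
    (hf : ∀ x ∈ s, f x ∈ u ∧ g (f x) = x) (hg : ∀ y ∈ u, g y ∈ s ∧ f (g y) = y) :
    s.ncard = u.ncard :=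
  Set.ncard_congr (fun x _ => f x) (fun x hx => (hf x hx).1)
    (fun x y hx hy h => by rw [← (hf x hx).2, ← (hf y hy).2, h])
    fun y hy => ⟨g y, (hg y hy).1, (hg y hy).2⟩

/-- The length of the result of an exchange. -/
theorem IsExchange.length_add [Finite T] (hS : S.Regular) (h : IsExchange S t t' S') :
    S'.length + 1 + 2 * (wrongSide S t t' S').ncard + 2 * (badInversions S t t' S').ncard =
      S.length := by
  obtain ⟨φ, hφ, hlt⟩ := S.exists_rank
  obtain ⟨ψ, hψ, hlt'⟩ := S'.exists_rank
  have htt := h.lt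
  have h0 := h.zero
  have h1 := h.one
  have δ01 := S.δ_eq_zero_or_one
  set I := inversions S t t' S' with hI
  -- The bijection carries K onto I, and the pairs in both cancel. What remains of K corresponds to
  -- the elements between t and t' that are on the right side (E7); what remains of I corresponds to
  -- those on the wrong side (E8) and to the inversions of unequal types (E2').
  set K : Set (T × T) := {q | S.δ q.1 = S.δ q.2 ∧ S.lt q.1 q.2 ∧ S'.lt q.2 q.1} with hK
  have E1 : K.ncard = I.ncard := by
    refine ncard_eq_of_bij (fun q => (S'.π q.1, S'.π q.2))
      (fun q => (S'.π.symm q.1, S'.π.symm q.2)) (fun q hq => ?_) fun q hq => ?_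
    · exact ⟨(h.mem_inversions_π hS q.1 q.2).2 hq, by simp⟩
    · refine ⟨(h.mem_inversions_π hS _ _).1 ?_, by simp⟩
      simpa using hq
  have E2 : I.ncard = {q | S.δ q.1 = S.δ q.2 ∧ q ∈ I}.ncard + {q | S.δ q.1 ≠ S.δ q.2 ∧ q ∈ I}.ncard :=
    ncard_add_of_iff (fun q => by simp only [Set.mem_ofPred_eq]; tauto) fun q h h' => h'.1 h.1
  have E2' : {q | S.δ q.1 ≠ S.δ q.2 ∧ q ∈ I}.ncard = (badInversions S t t' S').ncard +
      {q | S.δ q.1 = 1 ∧ S.δ q.2 = 0 ∧ q ∈ I}.ncard := by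
    refine ncard_add_of_iff (fun q => ?_) ?_
    · have := δ01 q.1
      have := δ01 q.2
      simp only [Set.mem_ofPred_eq, badInversions, ← hI, ← and_assoc, ← or_and_right]
      refine and_congr_left' ?_
      omega
    · rintro q ⟨h1, -⟩ ⟨h2, -⟩
      rw [h1] at h2
      exact absurd h2 (by decide)
  have E3 : K.ncard = {q | q ∈ K ∧ q ∈ I}.ncard + {q | q ∈ K ∧ q ∉ I}.ncard :=
    ncard_add_of_iff (fun q => by simp only [Set.mem_ofPred_eq]; tauto) fun q h h' => h'.2 h.2
  have E3' : {q | S.δ q.1 = S.δ q.2 ∧ q ∈ I}.ncard = {q | q ∈ K ∧ q ∈ I}.ncard +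
      {q | S.δ q.1 = S.δ q.2 ∧ q ∈ I ∧ q ∉ K}.ncard :=
    ncard_add_of_iff (fun q => by simp only [hK, Set.mem_ofPred_eq]; tauto) fun q h h' => h'.2.2 h.1
  have E6 : {z | S.lt t z ∧ S.lt z t'}.ncard = (wrongSide S t t' S').ncard +
      {z | S.lt t z ∧ S.lt z t' ∧
        ((S.δ z = 0 ∧ S'.lt z t) ∨ (S.δ z = 1 ∧ S'.lt t' z))}.ncard := by
    refine ncard_add_of_iff (fun z => ?_) ?_
    · simp only [wrongSide, Set.mem_ofPred_eq, hlt, hlt']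
      have := δ01 z
      have := @hψ z t
      have := @hψ z t'
      grind
    · rintro z ⟨h1, h2, h3⟩ ⟨-, -, h4⟩
      simp only [hlt'] at h3 h4
      omega
  have E7 : {z | S.lt t z ∧ S.lt z t' ∧
        ((S.δ z = 0 ∧ S'.lt z t) ∨ (S.δ z = 1 ∧ S'.lt t' z))}.ncard =
      {q | q ∈ K ∧ q ∉ I}.ncard := by
    refine ncard_eq_of_bij (fun z => if S.δ z = 0 then (t, z) else (z, t'))
      (fun q => if S.δ q.1 = 0 then q.2 else q.1) ?_ ?_
    · intro z
      simp only [hK, hI, inversions, Set.mem_ofPred_eq, hlt, hlt', swap_apply_def] at *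
      have := δ01 z
      grind
    · rintro ⟨x, y⟩
      simp only [hK, hI, inversions, Set.mem_ofPred_eq, hlt, hlt', swap_apply_def] at *
      have := δ01 x
      grind
  have E8 : (wrongSide S t t' S').ncard = {q | S.δ q.1 = S.δ q.2 ∧ q ∈ I ∧ q ∉ K}.ncard := by
    refine ncard_eq_of_bij (fun z => if S.δ z = 0 then (z, t) else (t', z))
      (fun q => if S.δ q.1 = 0 then q.1 else q.2) ?_ ?_
    · intro z
      simp only [wrongSide, hK, hI, inversions, Set.mem_ofPred_eq, hlt, hlt', swap_apply_def] at *
      have := δ01 z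
      grind
    · rintro ⟨x, y⟩
      simp only [wrongSide, hK, hI, inversions, Set.mem_ofPred_eq, hlt, hlt', swap_apply_def] at *
      have := δ01 x
      grind
  -- P and L translate the count into lengths. P is the set of (0, 1)-pairs ordered by S with the
  -- places of t and t' switched; it misses one such pair of S for each z with t < z ≤ t' (E12,
  -- E13). P and L differ by the inversions of unequal types.
  set P : Set (T × T) :=
    {q | S.δ q.1 = 0 ∧ S.δ q.2 = 1 ∧ S.lt (swap t t' q.1) (swap t t' q.2)} with hP
  set L : Set (T × T) := {q | S'.δ q.1 = 0 ∧ S'.δ q.2 = 1 ∧ S'.lt q.1 q.2} with hL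
  have E9 : L.ncard = {q | q ∈ L ∧ q ∈ P}.ncard + {q | q ∈ L ∧ q ∉ P}.ncard :=
    ncard_add_of_iff (fun q => by simp only [Set.mem_ofPred_eq]; tauto) fun q h h' => h'.2 h.2
  have E10 : P.ncard = {q | q ∈ L ∧ q ∈ P}.ncard + (badInversions S t t' S').ncard := by
    refine ncard_add_of_iff (fun q => ?_) ?_
    · simp only [badInversions, inversions, hP, hL, Set.mem_ofPred_eq, hlt', h.δ_eq]
      have := @hψ q.1 q.2
      constructor
      · intro hh
        rcases _root_.lt_trichotomy (ψ q.1) (ψ q.2) with h' | h' | h'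
        · tauto
        · rw [this h', hlt] at hh; exact absurd hh.2.2 (_root_.lt_irrefl _)
        · tauto
      · tauto
    · rintro q ⟨⟨-, -, h3⟩, -⟩ ⟨-, -, -, h4⟩
      exact S'.lt_asymm h3 h4
  have E11 : {q | S.δ q.1 = 1 ∧ S.δ q.2 = 0 ∧ q ∈ I}.ncard = {q | q ∈ L ∧ q ∉ P}.ncard := by
    refine ncard_eq_of_bij Prod.swap Prod.swap ?_ ?_
    · rintro ⟨x, y⟩
      simp only [hP, hL, hI, inversions, Set.mem_ofPred_eq, hlt, hlt', h.δ_eq, Prod.swap]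
      rintro ⟨h1, h2, h3, h4⟩
      refine ⟨⟨⟨h2, h1, h4⟩, fun h5 => ?_⟩, trivial⟩
      omega
    · rintro ⟨x, y⟩
      simp only [hP, hL, hI, inversions, Set.mem_ofPred_eq, hlt, hlt', h.δ_eq, Prod.swap]
      rintro ⟨⟨h1, h2, h3⟩, h4⟩
      have hne : swap t t' x ≠ swap t t' y := by
        intro e
        rw [(swap t t').injective e, h2] at h1
        exact absurd h1 (by decide)
      have := hφ.ne hne
      refine ⟨⟨h2, h1, ?_, h3⟩, trivial⟩
      have : ¬ φ (swap t t' x) < φ (swap t t' y) := fun h5 => h4 ⟨h1, h2, h5⟩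
      omega
  have E12 : {q : T × T | S.δ q.1 = 0 ∧ S.δ q.2 = 1 ∧ S.lt q.1 q.2}.ncard =
      P.ncard + {q | (S.δ q.1 = 0 ∧ S.δ q.2 = 1 ∧ S.lt q.1 q.2) ∧ q ∉ P}.ncard := by
    refine ncard_add_of_iff (fun q => ?_) fun q h h' => h'.2 h
    simp only [hP, Set.mem_ofPred_eq, hlt, swap_apply_def] at *
    grind
  have E13 : {z | S.lt t z ∧ (z = t' ∨ S.lt z t')}.ncard =
      {q : T × T | (S.δ q.1 = 0 ∧ S.δ q.2 = 1 ∧ S.lt q.1 q.2) ∧ q ∉ P}.ncard := by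
    refine ncard_eq_of_bij (fun z => if S.δ z = 0 then (z, t') else (t, z))
      (fun q => if q.1 = t then q.2 else q.1) ?_ ?_
    · intro z
      simp only [hP, Set.mem_ofPred_eq, hlt, swap_apply_def] at *
      have := δ01 z
      grind
    · rintro ⟨x, y⟩
      simp only [hP, Set.mem_ofPred_eq, hlt, swap_apply_def] at *
      have := @hφ x t
      have := @hφ y t'
      grind
  have E14 : {z | S.lt t z ∧ (z = t' ∨ S.lt z t')}.ncard =
      {z | S.lt t z ∧ S.lt z t'}.ncard + ({t'} : Set T).ncard := by
    refine ncard_add_of_iff (fun z => ?_) ?_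
    · simp only [Set.mem_ofPred_eq, Set.mem_singleton_iff]
      constructor
      · rintro ⟨h1, rfl | h2⟩
        exacts [Or.inr rfl, Or.inl ⟨h1, h2⟩]
      · rintro (⟨h1, h2⟩ | rfl)
        exacts [⟨h1, Or.inr h2⟩, ⟨htt, Or.inl rfl⟩]
    · rintro z ⟨-, h2⟩ rfl
      exact S.lt_irrefl _ h2
  rw [Set.ncard_singleton] at E14
  have E15 : S'.length = L.ncard := rfl
  have E16 : S.length = {q : T × T | S.δ q.1 = 0 ∧ S.δ q.2 = 1 ∧ S.lt q.1 q.2}.ncard := rfl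
  omega

theorem IsExchange.length_lt [Finite T] (hS : S.Regular) (h : IsExchange S t t' S') :
    S'.length + 1 ≤ S.length := by
  have := h.length_add hS
  omega

/-- Both defects in `IsExchange.length_add` are nonnegative, so goodness is the vanishing of both.
-/
theorem IsExchange.length_add_one_iff [Finite T] (hS : S.Regular) (h : IsExchange S t t' S') :
    S'.length + 1 = S.length ↔ (∀ z, z ∉ wrongSide S t t' S') ∧
      ∀ x y, (x, y) ∈ inversions S t t' S' → S.δ x = S.δ y ∨ (S.δ x = 1 ∧ S.δ y = 0) := by
  have e := h.length_add hS
  have h1 : (wrongSide S t t' S').ncard = 0 ↔ ∀ z, z ∉ wrongSide S t t' S' := by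
    rw [Set.ncard_eq_zero, Set.eq_empty_iff_forall_notMem]
  have h2 : (badInversions S t t' S').ncard = 0 ↔
      ∀ x y, (x, y) ∈ inversions S t t' S' → S.δ x = S.δ y ∨ (S.δ x = 1 ∧ S.δ y = 0) := by
    rw [Set.ncard_eq_zero, Set.eq_empty_iff_forall_notMem, Prod.forall]
    refine forall₂_congr fun x y => ?_
    simp only [badInversions, Set.mem_ofPred_eq]
    have := S.δ_eq_zero_or_one x
    have := S.δ_eq_zero_or_one y
    grind
  rw [← h1, ← h2]
  omega

end Exchange

end ABS

namespace ABS

/-! ### The sequence of N_{m,n} -/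

section Simple

variable {m n : ℕ}

theorem simple_δ_eq_one_iff {t : Fin (m + n)} : (simple m n).δ t = 1 ↔ t.val < m := by
  simp [simple]

theorem simple_δ_eq_zero_iff {t : Fin (m + n)} : (simple m n).δ t = 0 ↔ m ≤ t.val := by
  simp [simple]

theorem simple_π_val (t : Fin (m + n)) :
    ((simple m n).π t).val = if t.val < m then t.val + n else t.val - m := by
  change (t.val + n) % (m + n) = _
  have := t.isLt
  split_ifs with h
  · exact Nat.mod_eq_of_lt (by omega)
  · rw [show t.val + n = (t.val - m) + (m + n) by omega, Nat.add_mod_right,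
      Nat.mod_eq_of_lt (by omega)]

theorem simple_π_mk_of_lt {k : ℕ} (h : k < m) :
    (simple m n).π ⟨k, by omega⟩ = ⟨k + n, by omega⟩ := by
  apply Fin.ext; rw [simple_π_val]; simp [h]

theorem simple_π_mk_add {k : ℕ} (h : k < n) :
    (simple m n).π ⟨k + m, by omega⟩ = ⟨k, by omega⟩ := by
  apply Fin.ext; rw [simple_π_val]; simp

theorem simple_lt_iff {s t : Fin (m + n)} : (simple m n).lt s t ↔ s.val < t.val := Iff.rfl

variable (m n) in
theorem simple_regular : (simple m n).Regular where
  lt_iff x y h := by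
    rw [simple_lt_iff, simple_lt_iff, simple_π_val, simple_π_val]
    rcases (simple m n).δ_eq_zero_or_one x with hx | hx
    · rw [hx, eq_comm, simple_δ_eq_zero_iff] at h
      rw [simple_δ_eq_zero_iff] at hx
      split_ifs <;> omega
    · rw [hx, eq_comm, simple_δ_eq_one_iff] at h
      rw [simple_δ_eq_one_iff] at hx
      split_ifs; omega
  lt_of x y hx hy := by
    rw [simple_δ_eq_zero_iff] at hx
    rw [simple_δ_eq_one_iff] at hy
    rw [simple_lt_iff, simple_π_val, simple_π_val]
    have := x.isLt
    split_ifs <;> omega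

theorem ncard_lt_eq {h k : ℕ} (hk : k ≤ h) : {t : Fin h | t.val < k}.ncard = k := by
  have : {t : Fin h | t.val < k} = ↑((Finset.univ : Finset (Fin k)).map (Fin.castLEEmb hk)) := by
    ext t
    simp only [Set.mem_ofPred_eq, Finset.coe_map, Finset.coe_univ, Set.image_univ, Set.mem_range]
    exact ⟨fun ht => ⟨⟨t, ht⟩, rfl⟩, fun ⟨s, hs⟩ => hs ▸ s.isLt⟩
  rw [this, Set.ncard_coe_finset]
  simp

variable (m n) in
theorem count_one_simple : (simple m n).count 1 = m := by
  simp only [count, simple_δ_eq_one_iff]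
  exact ncard_lt_eq (Nat.le_add_right m n)

theorem count_zero_add_count_one {T : Type*} [Finite T] (S : ABS T) :
    S.count 0 + S.count 1 = Nat.card T := by
  rw [← Set.ncard_univ, eq_comm]
  refine ncard_add_of_iff (fun x => ?_) fun x (h : S.δ x = 0) (h' : S.δ x = 1) => ?_
  · simpa using S.δ_eq_zero_or_one x
  · rw [h] at h'; exact absurd h' (by decide)

variable (m n) in
theorem count_zero_simple : (simple m n).count 0 = n := by
  have := (simple m n).count_zero_add_count_one
  rw [count_one_simple, Nat.card_eq_fintype_card, Fintype.card_fin] at this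
  omega

variable (m n) in
theorem length_simple : (simple m n).length = 0 := by
  rw [length, Set.ncard_eq_zero, Set.eq_empty_iff_forall_notMem]
  rintro q ⟨h1, h2, h3⟩
  rw [simple_δ_eq_zero_iff] at h1
  rw [simple_δ_eq_one_iff] at h2
  rw [simple_lt_iff] at h3
  omega

end Simple

/-! ### Order and length of the minimal sequence -/

section Minimal

variable {m₁ n₁ m₂ n₂ : ℕ}

theorem bin_simple_lt_of_lt {c : Fin (m₁ + n₁)}
    {l : Fin (m₂ + n₂)} (hc : c.val < n₁) (hl : n₂ ≤ l.val) :
    (simple m₁ n₁).bin c < (simple m₂ n₂).bin l := by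
  obtain ⟨c, hc'⟩ := c
  obtain ⟨l, hl'⟩ := l
  obtain ⟨l, rfl⟩ := Nat.exists_eq_add_of_le' hl
  rw [← simple_π_mk_add hc, ← simple_π_mk_of_lt (by omega), bin_π_lt_iff,
    simple_δ_eq_zero_iff.2 (by simp), simple_δ_eq_one_iff.2 (by simp at hl'; simp; omega)]
  exact Or.inl (by decide)

theorem bin_simple_lt_of_le {c : Fin (m₁ + n₁)}
    {l : Fin (m₂ + n₂)} (hc : n₁ ≤ c.val) (hl : l.val < n₂) :
    (simple m₂ n₂).bin l < (simple m₁ n₁).bin c := by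
  obtain ⟨c, hc'⟩ := c
  obtain ⟨l, hl'⟩ := l
  obtain ⟨c, rfl⟩ := Nat.exists_eq_add_of_le' hc
  rw [← simple_π_mk_add hl, ← simple_π_mk_of_lt (by omega), bin_π_lt_iff,
    simple_δ_eq_zero_iff.2 (by simp), simple_δ_eq_one_iff.2 (by simp at hc'; simp; omega)]
  exact Or.inl (by decide)

/-- Both expansions begin with 0. Then either c has 0 against 1, or both have 1, and two steps back
c has dropped by n₁ - m₁ while l has grown by m₂ - n₂; l cannot stay below n₂ for ever. -/
theorem bin_simple_lt_of_lt_of_lt (h₁ : m₁ < n₁) (h₂ : n₂ < m₂) {c : Fin (m₁ + n₁)}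
    {l : Fin (m₂ + n₂)} (hc : c.val < n₁) (hl : l.val < n₂) :
    (simple m₁ n₁).bin c < (simple m₂ n₂).bin l := by
  obtain ⟨c, hc'⟩ := c
  obtain ⟨l, hl'⟩ := l
  simp only at hc hl
  induction hk : m₂ + n₂ - l using Nat.strong_induction_on generalizing c l with
  | _ k ih =>
    rw [← simple_π_mk_add hc, ← simple_π_mk_add hl, bin_π_lt_iff,
      simple_δ_eq_zero_iff.2 (by simp), simple_δ_eq_zero_iff.2 (by simp)]
    refine Or.inr ⟨rfl, ?_⟩
    by_cases hc2 : c + m₁ < n₁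
    · exact bin_simple_lt_of_lt hc2 (by simp; omega)
    · have e1 : c + m₁ = (c + m₁ - n₁) + n₁ := by omega
      have e2 : l + m₂ = (l + m₂ - n₂) + n₂ := by omega
      have e3 := simple_π_mk_of_lt (m := m₁) (n := n₁) (k := c + m₁ - n₁) (by omega)
      have e4 := simple_π_mk_of_lt (m := m₂) (n := n₂) (k := l + m₂ - n₂) (by omega)
      simp only [← e1, ← e2] at e3 e4
      rw [← e3, ← e4, bin_π_lt_iff, simple_δ_eq_one_iff.2 (by simp; omega),
        simple_δ_eq_one_iff.2 (by simp; omega)]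
      refine Or.inr ⟨rfl, ?_⟩
      by_cases hl2 : l + m₂ - n₂ < n₂
      · exact ih _ (by omega) _ _ (by omega) _ _ hl2 rfl
      · exact bin_simple_lt_of_lt (by simp; omega) (by simpa using hl2)

theorem bin_simple_lt_of_le_of_le (h₁ : m₁ < n₁) (h₂ : n₂ < m₂) {c : Fin (m₁ + n₁)}
    {l : Fin (m₂ + n₂)} (hc : n₁ ≤ c.val) (hl : n₂ ≤ l.val) :
    (simple m₁ n₁).bin c < (simple m₂ n₂).bin l := by
  obtain ⟨c, hc'⟩ := c
  obtain ⟨l, hl'⟩ := l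
  obtain ⟨c, rfl⟩ := Nat.exists_eq_add_of_le' hc
  obtain ⟨l, rfl⟩ := Nat.exists_eq_add_of_le' hl
  rw [← simple_π_mk_of_lt (by omega), ← simple_π_mk_of_lt (by omega), bin_π_lt_iff,
    simple_δ_eq_one_iff.2 (by simp at hc'; simp; omega),
    simple_δ_eq_one_iff.2 (by simp at hl'; simp; omega)]
  refine Or.inr ⟨rfl, ?_⟩
  by_cases hl2 : l < n₂
  · exact bin_simple_lt_of_lt_of_lt h₁ h₂ (by simp; omega) hl2
  · exact bin_simple_lt_of_lt (by simp; omega) (by simpa using hl2)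

variable (m₁ n₁ m₂ n₂) in
theorem minimal_regular : (minimalABS m₁ n₁ m₂ n₂).Regular :=
  (simple_regular m₁ n₁).sum (simple_regular m₂ n₂)

theorem minimal_lt_inl_inl {x y : Fin (m₁ + n₁)} :
    (minimalABS m₁ n₁ m₂ n₂).lt (Sum.inl x) (Sum.inl y) ↔ x.val < y.val :=
  (simple_regular m₁ n₁).sum_lt_inl_inl

theorem minimal_lt_inr_inr {x y : Fin (m₂ + n₂)} :
    (minimalABS m₁ n₁ m₂ n₂).lt (Sum.inr x) (Sum.inr y) ↔ x.val < y.val :=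
  (simple_regular m₂ n₂).sum_lt_inr_inr

/-- With indices from 0, the order consists of four successive blocks: A below n₁, B below n₂, the
rest of A, the rest of B. -/
theorem minimal_lt_inl_inr (h₁ : m₁ < n₁) (h₂ : n₂ < m₂) {x : Fin (m₁ + n₁)}
    {y : Fin (m₂ + n₂)} :
    (minimalABS m₁ n₁ m₂ n₂).lt (Sum.inl x) (Sum.inr y) ↔ x.val < n₁ ∨ n₂ ≤ y.val := by
  rw [minimalABS, sum_lt_inl_inr]
  rcases lt_or_ge x.val n₁ with hx | hx <;> rcases lt_or_ge y.val n₂ with hy | hy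
  · simp [hx, (bin_simple_lt_of_lt_of_lt h₁ h₂ hx hy).le]
  · simp [hx, (bin_simple_lt_of_lt hx hy).le]
  · have := bin_simple_lt_of_le hx hy
    rw [bin_le_iff_not_lt]
    simp [this]
    omega
  · simp [hy, (bin_simple_lt_of_le_of_le h₁ h₂ hx hy).le]

/-- No zero of B precedes a one of A, so in `cross_add` one cross term vanishes and the other is the
determinant n₁m₂ - m₁n₂. -/
theorem length_minimal (h₁ : m₁ < n₁) (h₂ : n₂ < m₂) :
    (minimalABS m₁ n₁ m₂ n₂).length + m₁ * n₂ = n₁ * m₂ := by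
  have e := cross_add (simple m₁ n₁) (simple m₂ n₂)
  have e' : (simple m₂ n₂).cross (simple m₁ n₁) = 0 := by
    rw [cross, Set.ncard_eq_zero, Set.eq_empty_iff_forall_notMem]
    rintro q ⟨hq1, hq2, hq3⟩
    rw [simple_δ_eq_zero_iff] at hq1
    rw [simple_δ_eq_one_iff] at hq2
    exact absurd hq3 (_root_.lt_asymm (bin_simple_lt_of_lt (by omega) (by omega)))
  rw [minimalABS, length_sum (simple_regular _ _) (simple_regular _ _), length_simple,
    length_simple]
  rw [count_one_simple, count_one_simple, count_zero_simple, count_zero_simple] at e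
  omega

end Minimal

end ABS

/-! ### Slopes as inequalities between integers -/

theorem segSlope_lt_half_iff {m n : ℕ} (h : 0 < m + n) : segSlope m n < 1 / 2 ↔ n < m := by
  have : (0 : ℚ) < m + n := by exact_mod_cast h
  rw [segSlope, div_lt_iff₀ this]
  constructor
  · intro h'
    have : (n : ℚ) < m := by linarith
    exact_mod_cast this
  · intro h'
    have : (n : ℚ) < m := by exact_mod_cast h'
    linarith

theorem half_lt_segSlope_iff {m n : ℕ} (h : 0 < m + n) : 1 / 2 < segSlope m n ↔ m < n := by
  have : (0 : ℚ) < m + n := by exact_mod_cast h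
  rw [segSlope, lt_div_iff₀ this]
  constructor
  · intro h'
    have : (m : ℚ) < n := by linarith
    exact_mod_cast this
  · intro h'
    have : (m : ℚ) < n := by exact_mod_cast h'
    linarith

theorem Nat.Coprime.add_pos' {m n : ℕ} (h : Nat.Coprime m n) : 0 < m + n := by
  by_contra h0
  obtain ⟨rfl, rfl⟩ : m = 0 ∧ n = 0 := by omega
  exact absurd h (by decide)

theorem isTwoSegment_iff {m₁ n₁ m₂ n₂ : ℕ} : IsTwoSegment m₁ n₁ m₂ n₂ ↔
    Nat.Coprime m₁ n₁ ∧ Nat.Coprime m₂ n₂ ∧ n₂ < m₂ ∧ m₁ < n₁ := by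
  constructor
  · rintro ⟨h1, h2, h3, h4⟩
    exact ⟨h1, h2, (segSlope_lt_half_iff h2.add_pos').1 h3, (half_lt_segSlope_iff h1.add_pos').1 h4⟩
  · rintro ⟨h1, h2, h3, h4⟩
    exact ⟨h1, h2, (segSlope_lt_half_iff h2.add_pos').2 h3, (half_lt_segSlope_iff h1.add_pos').2 h4⟩

namespace ABS

open Equiv

/-! ### Propagation of inversions in a good exchange -/

section Good

variable {T : Type*} [DecidableEq T] {S S' : ABS T} {t t' : T}

theorem IsExchange.lt_of_mem_inversions [Finite T] (h : IsExchange S t t' S')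
    (hg : ∀ z, z ∉ wrongSide S t t' S') {x y : T} (hxy : (x, y) ∈ inversions S t t' S')
    (hδ : S.δ x = S.δ y) : S.lt x y := by
  obtain ⟨φ, hφ, hlt⟩ := S.exists_rank
  have h0 := h.zero
  have h1 := h.one
  have htt := h.lt
  have hx := hg x
  have hy := hg y
  have hlt' := hxy.2
  have := S.δ_eq_zero_or_one x
  clear hg
  simp only [wrongSide, inversions, Set.mem_ofPred_eq, hlt, swap_apply_def] at *
  split_ifs at hxy <;> grind

/-- Without wrong-side elements, an inversion of equal types is already in order in S and reversed
in S', so `mem_inversions_π` pushes it forward. -/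
theorem IsExchange.π_mem_inversions [Finite T] (hS : S.Regular) (h : IsExchange S t t' S')
    (hg : ∀ z, z ∉ wrongSide S t t' S') {x y : T} (hxy : (x, y) ∈ inversions S t t' S')
    (hδ : S.δ x = S.δ y) : (S'.π x, S'.π y) ∈ inversions S t t' S' :=
  (h.mem_inversions_π hS x y).2 ⟨hδ, h.lt_of_mem_inversions hg hxy hδ, hxy.2⟩

/-- Every zero between t and t' starts a chain of inversions, which goodness keeps in equal types
until the types become (1, 0). -/
theorem IsExchange.π_mem_inversions_of_zero (hS : S.Regular) (h : IsExchange S t t' S')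
    (hg : ∀ z, z ∉ wrongSide S t t' S') {z : T} (h1 : S.lt t z) (h2 : S.lt z t')
    (hδ : S.δ z = 0) : (S'.π t, S'.π z) ∈ inversions S t t' S' := by
  refine (h.mem_inversions_π hS t z).2 ⟨by rw [hδ, h.zero], h1, ?_⟩
  rcases S'.lt_trichotomy z t with h3 | rfl | h3
  · exact h3
  · exact absurd h1 (S.lt_irrefl _)
  · exact absurd ⟨h1, h2, Or.inl ⟨hδ, h3⟩⟩ (hg z)

theorem IsExchange.π_mem_inversions_of_one (hS : S.Regular) (h : IsExchange S t t' S')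
    (hg : ∀ z, z ∉ wrongSide S t t' S') {z : T} (h1 : S.lt t z) (h2 : S.lt z t')
    (hδ : S.δ z = 1) : (S'.π z, S'.π t') ∈ inversions S t t' S' := by
  refine (h.mem_inversions_π hS z t').2 ⟨by rw [hδ, h.one], h2, ?_⟩
  rcases S'.lt_trichotomy t' z with h3 | rfl | h3
  · exact h3
  · exact absurd h2 (S.lt_irrefl _)
  · exact absurd ⟨h1, h2, Or.inr ⟨hδ, h3⟩⟩ (hg z)

end Good

/-- The pairs `(σ^s x, σ^s y)`, `s ≥ 1`, are in order and of equal types until the types become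
`(1, 0)`, and they do not meet `c` before that. -/
def Resolves {T : Type*} (S : ABS T) (σ : Perm T) (c x y : T) (E : T → T → Prop) : Prop :=
  ∃ r, 1 ≤ r ∧ (∀ s, 1 ≤ s → s ≤ r → (σ ^ s) x ≠ c ∧ (σ ^ s) y ≠ c) ∧
    (∀ s, 1 ≤ s → s < r → S.δ ((σ ^ s) x) = S.δ ((σ ^ s) y) ∧ S.lt ((σ ^ s) x) ((σ ^ s) y)) ∧
    S.δ ((σ ^ r) x) = 1 ∧ S.δ ((σ ^ r) y) = 0 ∧ E ((σ ^ r) x) ((σ ^ r) y)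

/-! ### Transitivity of the bijection of N_{m,n} -/

section Transitive

theorem exists_pos_mul_modEq {n h : ℕ} (hh : 0 < h) (hc : Nat.Coprime n h) (d : ℕ) :
    ∃ q, 0 < q ∧ q * n ≡ d [MOD h] := by
  rcases Nat.lt_or_ge 1 h with h1 | h1
  · obtain ⟨u, -, hu⟩ := Nat.exists_mul_mod_eq_one_of_coprime hc h1
    refine ⟨u * d + h, by omega, ?_⟩
    have hu' : n * u ≡ 1 [MOD h] := by rw [Nat.ModEq, hu, Nat.mod_eq_of_lt h1]
    calc (u * d + h) * n = n * u * d + h * n := by ring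
      _ ≡ n * u * d [MOD h] := by simp [Nat.ModEq]
      _ ≡ 1 * d [MOD h] := hu'.mul_right d
      _ = d := one_mul d
  · obtain rfl : h = 1 := by omega
    exact ⟨1, one_pos, Nat.modEq_one⟩

theorem simple_π_pow_val {m n : ℕ} (t : Fin (m + n)) (s : ℕ) :
    (((simple m n).π ^ s) t).val = (t.val + s * n) % (m + n) := by
  induction s with
  | zero => simp [Nat.mod_eq_of_lt t.isLt]
  | succ s ih =>
    rw [pow_succ', Perm.mul_apply]
    change (_ + n) % (m + n) = _
    rw [ih, Nat.mod_add_mod]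
    congr 1
    ring

theorem exists_simple_π_pow_eq {m n : ℕ} (hc : Nat.Coprime m n) (x y : Fin (m + n)) :
    ∃ q, 0 < q ∧ ((simple m n).π ^ q) x = y := by
  have hh : 0 < m + n := x.pos
  obtain ⟨q, hq, hq'⟩ := exists_pos_mul_modEq hh
    (show Nat.Coprime n (m + n) by simpa using hc.symm) (y.val + (m + n - x.val))
  refine ⟨q, hq, Fin.ext ?_⟩
  rw [simple_π_pow_val]
  have := hq'.add_left x.val
  rw [show x.val + (y.val + (m + n - x.val)) = y.val + (m + n) by omega] at this
  rw [Nat.ModEq, Nat.add_mod_right, Nat.mod_eq_of_lt y.isLt] at this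
  exact this

end Transitive

/-! ### What goodness says about the orbits in the minimal sequence -/

section GoodMinimal

variable {m₁ n₁ m₂ n₂ : ℕ} {i : Fin (m₁ + n₁)} {j : Fin (m₂ + n₂)}
  {Sm : ABS (Elt m₁ n₁ m₂ n₂)}

theorem IsExchange.minimal_π_inl (h : IsExchange (minimalABS m₁ n₁ m₂ n₂) (Sum.inl i) (Sum.inr j) Sm)
    {c : Fin (m₁ + n₁)} (hc : (simple m₁ n₁).π c ≠ i) :
    Sm.π (Sum.inl c) = Sum.inl ((simple m₁ n₁).π c) := by
  rw [h.π_eq, Perm.mul_apply, minimalABS, sum_π_inl, swap_apply_of_ne_of_ne]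
  · simpa using hc
  · simp

theorem IsExchange.minimal_π_inl_eq
    (h : IsExchange (minimalABS m₁ n₁ m₂ n₂) (Sum.inl i) (Sum.inr j) Sm)
    {c : Fin (m₁ + n₁)} (hc : (simple m₁ n₁).π c = i) : Sm.π (Sum.inl c) = Sum.inr j := by
  rw [h.π_eq, Perm.mul_apply, minimalABS, sum_π_inl, hc, swap_apply_left]

theorem IsExchange.minimal_π_inr (h : IsExchange (minimalABS m₁ n₁ m₂ n₂) (Sum.inl i) (Sum.inr j) Sm)
    {c : Fin (m₂ + n₂)} (hc : (simple m₂ n₂).π c ≠ j) :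
    Sm.π (Sum.inr c) = Sum.inr ((simple m₂ n₂).π c) := by
  rw [h.π_eq, Perm.mul_apply, minimalABS, sum_π_inr, swap_apply_of_ne_of_ne]
  · simp
  · simpa using hc

theorem IsExchange.minimal_π_inr_eq
    (h : IsExchange (minimalABS m₁ n₁ m₂ n₂) (Sum.inl i) (Sum.inr j) Sm)
    {c : Fin (m₂ + n₂)} (hc : (simple m₂ n₂).π c = j) : Sm.π (Sum.inr c) = Sum.inl i := by
  rw [h.π_eq, Perm.mul_apply, minimalABS, sum_π_inr, hc, swap_apply_right]

theorem simple_δ_eq_iff {m n : ℕ} {a b : Fin (m + n)} :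
    (simple m n).δ a = (simple m n).δ b ↔ (a.val < m ↔ b.val < m) := by
  rcases (simple m n).δ_eq_zero_or_one a with ha | ha <;>
    rcases (simple m n).δ_eq_zero_or_one b with hb | hb <;> rw [ha, hb] <;>
    simp only [simple_δ_eq_zero_iff, simple_δ_eq_one_iff] at ha hb <;> simp <;> omega

variable (h₁ : m₁ < n₁) (h₂ : n₂ < m₂) (hm : 0 < m₁) (hi : m₁ ≤ i.val) (hi' : i.val < n₁)
  (hj : j.val < n₂)
  (h : IsExchange (minimalABS m₁ n₁ m₂ n₂) (Sum.inl i) (Sum.inr j) Sm)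
  (hw : ∀ z, z ∉ wrongSide (minimalABS m₁ n₁ m₂ n₂) (Sum.inl i) (Sum.inr j) Sm)
  (hb : ∀ x y, (x, y) ∈ inversions (minimalABS m₁ n₁ m₂ n₂) (Sum.inl i) (Sum.inr j) Sm →
    (minimalABS m₁ n₁ m₂ n₂).δ x = (minimalABS m₁ n₁ m₂ n₂).δ y ∨
      ((minimalABS m₁ n₁ m₂ n₂).δ x = 1 ∧ (minimalABS m₁ n₁ m₂ n₂).δ y = 0))

-- Descent on l. Here l has type 1, which forces type 1 on c; one step later c has type 0, which
-- forces type 0 on the image of l. After two steps l has become l + n₂ - m₂ < l, while c is still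
-- in A or has been sent to j; in the latter case the new l would be on the wrong side.
include h₁ h₂ hi' hj h hw hb in
theorem inl_inr_notMem_inversions (c : Fin (m₁ + n₁)) (l : Fin (m₂ + n₂)) (hl : l.val ≤ j.val) :
    (Sum.inl c, Sum.inr l) ∉
      inversions (minimalABS m₁ n₁ m₂ n₂) (Sum.inl i) (Sum.inr j) Sm := by
  obtain ⟨l, hl'⟩ := l
  induction l using Nat.strong_induction_on generalizing c with
  | _ l ih =>
  intro hI
  have hS := minimal_regular m₁ n₁ m₂ n₂
  simp only at hl
  have hδl : (simple m₂ n₂).δ ⟨l, hl'⟩ = 1 := simple_δ_eq_one_iff.2 (by simp; omega)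
  have hδc : (simple m₁ n₁).δ c = 1 := by
    rcases hb _ _ hI with hh | hh
    · exact hh.trans hδl
    · exact hh.1
  have hcm := simple_δ_eq_one_iff.1 hδc
  have hI2 := h.π_mem_inversions hS hw hI (hδc.trans hδl.symm)
  have e1 : ((simple m₁ n₁).π c).val = c.val + n₁ := by rw [simple_π_val, if_pos hcm]
  have e2 : ((simple m₂ n₂).π ⟨l, hl'⟩).val = l + n₂ := by
    rw [simple_π_val, if_pos (by simp; omega)]
  rw [h.minimal_π_inl (fun e => by rw [e] at e1; omega),
    h.minimal_π_inr (fun e => by rw [e] at e2; omega)] at hI2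
  generalize (simple m₁ n₁).π c = c₁ at *
  generalize (simple m₂ n₂).π ⟨l, hl'⟩ = l₁ at *
  have hδc₁ : (simple m₁ n₁).δ c₁ = 0 := simple_δ_eq_zero_iff.2 (by omega)
  have hδl₁ : (simple m₂ n₂).δ l₁ = 0 := by
    rcases hb _ _ hI2 with hh | hh
    · exact hh.symm.trans hδc₁
    · exact hh.2
  have hlm := simple_δ_eq_zero_iff.1 hδl₁
  have hI3 := h.π_mem_inversions hS hw hI2 (hδc₁.trans hδl₁.symm)
  have e3 : ((simple m₂ n₂).π l₁).val = l₁.val - m₂ := by rw [simple_π_val, if_neg (by omega)]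
  rw [h.minimal_π_inr (fun e => by rw [e] at e3; omega)] at hI3
  generalize (simple m₂ n₂).π l₁ = l₂ at *
  by_cases hc : (simple m₁ n₁).π c₁ = i
  · rw [h.minimal_π_inl_eq hc] at hI3
    refine hw (Sum.inr l₂) ⟨(minimal_lt_inl_inr h₁ h₂).2 (Or.inl hi'),
      minimal_lt_inr_inr.2 (by omega), Or.inr ⟨?_, hI3.2⟩⟩
    exact simple_δ_eq_one_iff.2 (by omega)
  · rw [h.minimal_π_inl hc] at hI3
    obtain ⟨l₂, hl₂⟩ := l₂
    exact ih l₂ (by simp at e3; omega) _ hl₂ (by simp at e3; simp; omega) hI3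

-- If the chain of inversions started by (i, k) never reached types (1, 0), it would last until k
-- first arrives at i. The exchange puts j there, producing an inversion from A to B that
-- `inl_inr_notMem_inversions` forbids.
include h₁ h₂ hi hi' hj h hw hb in
theorem resolves_up (hc : Nat.Coprime m₁ n₁) (k : Fin (m₁ + n₁)) (hik : i.val < k.val)
    (hk : k.val < n₁) : Resolves (simple m₁ n₁) (simple m₁ n₁).π i i k
      fun x y => Sm.lt (Sum.inl y) (Sum.inl x) := by
  classical
  have hS := minimal_regular m₁ n₁ m₂ n₂
  set σ := (simple m₁ n₁).π with hσ
  have hex : ∃ q, 0 < q ∧ (σ ^ q) k = i := exists_simple_π_pow_eq hc k i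
  set q := Nat.find hex with hq
  obtain ⟨hq0, hqk⟩ := Nat.find_spec hex
  have hmin : ∀ u, 0 < u → u < q → (σ ^ u) k ≠ i := fun u hu huq e => Nat.find_min hex huq ⟨hu, e⟩
  have hik' : i ≠ k := fun e => by rw [e] at hik; omega
  have hni : ∀ u, 0 < u → u ≤ q → (σ ^ u) i ≠ i := by
    intro u hu huq e
    rcases huq.lt_or_eq with hlt | rfl
    · refine hmin (q - u) (by omega) (by omega) ?_
      apply (σ ^ u).injective
      rw [← Perm.mul_apply, ← pow_add, show u + (q - u) = q by omega, e, hqk]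
    · exact hik' ((σ ^ q).injective (e.trans hqk.symm))
  by_contra hno
  have key : ∀ s, s ≤ q →
      (Sm.π (Sum.inl ((σ ^ s) i)), Sm.π (Sum.inl ((σ ^ s) k))) ∈
        inversions (minimalABS m₁ n₁ m₂ n₂) (Sum.inl i) (Sum.inr j) Sm ∧
      ∀ u, 1 ≤ u → u ≤ s → (σ ^ u) k ≠ i ∧
        (simple m₁ n₁).δ ((σ ^ u) i) = (simple m₁ n₁).δ ((σ ^ u) k) ∧
        (simple m₁ n₁).lt ((σ ^ u) i) ((σ ^ u) k) := by
    intro s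
    induction s with
    | zero =>
      refine fun _ => ⟨?_, fun u h1 h2 => by omega⟩
      exact h.π_mem_inversions_of_zero hS hw (minimal_lt_inl_inl.2 hik)
        ((minimal_lt_inl_inr h₁ h₂).2 (Or.inl hk))
        (simple_δ_eq_zero_iff.2 (hi.trans hik.le))
    | succ s ih =>
      intro hsq
      obtain ⟨hI, hall⟩ := ih (by omega)
      have e1 : ∀ x, σ ((σ ^ s) x) = (σ ^ (s + 1)) x := fun x => by
        rw [pow_succ', Perm.mul_apply]
      rw [h.minimal_π_inl (by rw [← hσ, e1]; exact hni _ (by omega) hsq), ← hσ, e1] at hI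
      have hk1 : (σ ^ (s + 1)) k ≠ i := by
        intro e
        rw [h.minimal_π_inl_eq (by rw [← hσ, e1]; exact e)] at hI
        exact inl_inr_notMem_inversions h₁ h₂ hi' hj h hw hb _ _ le_rfl hI
      rw [h.minimal_π_inl (by rw [← hσ, e1]; exact hk1), ← hσ, e1] at hI
      rcases hb _ _ hI with hh | hh
      · refine ⟨h.π_mem_inversions hS hw hI hh, fun u h1 h2 => ?_⟩
        rcases h2.lt_or_eq with h3 | rfl
        · exact hall u h1 (by omega)
        · exact ⟨hk1, hh, minimal_lt_inl_inl.1 (h.lt_of_mem_inversions hw hI hh)⟩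
      · refine absurd ⟨s + 1, by omega, fun u h1 h2 => ⟨hni u h1 (by omega), ?_⟩,
          fun u h1 h2 => (hall u h1 (by omega)).2, hh.1, hh.2, hI.2⟩ hno
        rcases h2.lt_or_eq with h3 | rfl
        · exact (hall u h1 (by omega)).1
        · exact hk1
  exact ((key q le_rfl).2 q hq0 le_rfl).1 hqk

-- As in `resolves_up`, but when l arrives at j it is replaced by i, and one more step is needed to
-- bring the partner in B to an index at most j.
include h₁ h₂ hm hi hi' hj h hw hb in
theorem resolves_down (hc : Nat.Coprime m₂ n₂) (l : Fin (m₂ + n₂)) (hlj : l.val < j.val) :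
    Resolves (simple m₂ n₂) (simple m₂ n₂).π j l j
      fun x y => Sm.lt (Sum.inr y) (Sum.inr x) := by
  classical
  have hS := minimal_regular m₁ n₁ m₂ n₂
  set σ := (simple m₂ n₂).π with hσ
  have hex : ∃ q, 0 < q ∧ (σ ^ q) l = j := exists_simple_π_pow_eq hc l j
  set q := Nat.find hex with hq
  obtain ⟨hq0, hqk⟩ := Nat.find_spec hex
  have hmin : ∀ u, 0 < u → u < q → (σ ^ u) l ≠ j := fun u hu huq e => Nat.find_min hex huq ⟨hu, e⟩
  have hlj' : j ≠ l := fun e => by rw [e] at hlj; omega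
  have hni : ∀ u, 0 < u → u ≤ q → (σ ^ u) j ≠ j := by
    intro u hu huq e
    rcases huq.lt_or_eq with hlt | rfl
    · refine hmin (q - u) (by omega) (by omega) ?_
      apply (σ ^ u).injective
      rw [← Perm.mul_apply, ← pow_add, show u + (q - u) = q by omega, e, hqk]
    · exact hlj' ((σ ^ q).injective (e.trans hqk.symm))
  by_contra hno
  -- The distance j - l is recorded because, when l arrives at j, it places the partner at j + (j -
  -- l), so that its image under a zero step is at most j.
  have key : ∀ s, s ≤ q →
      (Sm.π (Sum.inr ((σ ^ s) l)), Sm.π (Sum.inr ((σ ^ s) j))) ∈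
        inversions (minimalABS m₁ n₁ m₂ n₂) (Sum.inl i) (Sum.inr j) Sm ∧
      ((σ ^ (s + 1)) j).val = ((σ ^ (s + 1)) l).val + (j.val - l.val) ∧
      ∀ u, 1 ≤ u → u ≤ s → (σ ^ u) l ≠ j ∧
        (simple m₂ n₂).δ ((σ ^ u) l) = (simple m₂ n₂).δ ((σ ^ u) j) ∧
        (simple m₂ n₂).lt ((σ ^ u) l) ((σ ^ u) j) := by
    intro s
    induction s with
    | zero =>
      refine fun _ => ⟨?_, ?_, fun u h1 h2 => by omega⟩
      · exact h.π_mem_inversions_of_one hS hw ((minimal_lt_inl_inr h₁ h₂).2 (Or.inl hi'))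
          (minimal_lt_inr_inr.2 hlj)
          (simple_δ_eq_one_iff.2 (hlj.trans (hj.trans h₂)))
      · simp only [zero_add, pow_one, hσ]
        rw [simple_π_val, simple_π_val, if_pos (by omega), if_pos (by omega)]
        omega
    | succ s ih =>
      intro hsq
      obtain ⟨hI, hv, hall⟩ := ih (by omega)
      have e1 : ∀ x, σ ((σ ^ s) x) = (σ ^ (s + 1)) x := fun x => by
        rw [pow_succ', Perm.mul_apply]
      rw [h.minimal_π_inr (c := (σ ^ s) j) (by rw [← hσ, e1]; exact hni _ (by omega) hsq), ← hσ,
        e1] at hI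
      have hk1 : (σ ^ (s + 1)) l ≠ j := by
        intro e
        rw [h.minimal_π_inr_eq (by rw [← hσ, e1]; exact e)] at hI
        rw [e] at hv
        have hδi : (simple m₁ n₁).δ i = 0 := simple_δ_eq_zero_iff.2 hi
        have hδy : (simple m₂ n₂).δ ((σ ^ (s + 1)) j) = 0 := by
          rcases hb _ _ hI with hh | hh
          · exact hh.symm.trans hδi
          · exact hh.2
        have hI2 := h.π_mem_inversions hS hw hI (hδi.trans hδy.symm)
        have hy := simple_δ_eq_zero_iff.1 hδy
        have e2 := simple_π_val i
        rw [if_neg (by omega)] at e2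
        have e3 := simple_π_val ((σ ^ (s + 1)) j)
        rw [if_neg (by omega)] at e3
        rw [h.minimal_π_inl (fun e' => by rw [e'] at e2; omega),
          h.minimal_π_inr (fun e' => by rw [e'] at e3; omega)] at hI2
        exact inl_inr_notMem_inversions h₁ h₂ hi' hj h hw hb _ _ (by omega) hI2
      rw [h.minimal_π_inr (by rw [← hσ, e1]; exact hk1), ← hσ, e1] at hI
      rcases hb _ _ hI with hh | hh
      · refine ⟨h.π_mem_inversions hS hw hI hh, ?_, fun u h1 h2 => ?_⟩
        · have hh' := simple_δ_eq_iff.1 hh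
          rw [pow_succ' σ (s + 1), Perm.mul_apply, Perm.mul_apply, hσ, simple_π_val, simple_π_val,
            ← hσ]
          split_ifs <;> omega
        · rcases h2.lt_or_eq with h3 | rfl
          · exact hall u h1 (by omega)
          · exact ⟨hk1, hh, minimal_lt_inr_inr.1 (h.lt_of_mem_inversions hw hI hh)⟩
      · refine absurd ⟨s + 1, by omega, fun u h1 h2 => ⟨?_, hni u h1 (by omega)⟩,
          fun u h1 h2 => (hall u h1 (by omega)).2, hh.1, hh.2, hI.2⟩ hno
        rcases h2.lt_or_eq with h3 | rfl
        · exact (hall u h1 (by omega)).1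
        · exact hk1
  exact ((key q le_rfl).2.2 q hq0 le_rfl).1 hqk

end GoodMinimal


/-! ### A criterion for good exchanges -/

section Criterion

variable {T : Type*} [DecidableEq T] {S S' : ABS T} {t t' : T}

/-- A sufficient condition for an exchange to be good. -/
theorem IsExchange.length_add_one_of_forall [Finite T] (hS : S.Regular) (h : IsExchange S t t' S')
    (hinj : Function.Injective S'.bin)
    (h0 : ∀ z, S.lt t z → S.lt z t' → S.δ z = 0 → ∃ r, 1 ≤ r ∧
      (∀ s, 1 ≤ s → s < r → S.δ ((S'.π ^ s) t) = S.δ ((S'.π ^ s) z) ∧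
        S.lt ((S'.π ^ s) t) ((S'.π ^ s) z)) ∧
      S.δ ((S'.π ^ r) t) = 1 ∧ S.δ ((S'.π ^ r) z) = 0)
    (h1 : ∀ z, S.lt t z → S.lt z t' → S.δ z = 1 → ∃ r, 1 ≤ r ∧
      (∀ s, 1 ≤ s → s < r → S.δ ((S'.π ^ s) z) = S.δ ((S'.π ^ s) t') ∧
        S.lt ((S'.π ^ s) z) ((S'.π ^ s) t')) ∧
      S.δ ((S'.π ^ r) z) = 1 ∧ S.δ ((S'.π ^ r) t') = 0) :
    S'.length + 1 = S.length := by
  have init : ∀ x y, S.δ x = S.δ y → S.lt x y → S'.lt y x →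
      (x, y) ∉ inversions S t t' S' →
      ∃ r, 1 ≤ r ∧ (∀ s, 1 ≤ s → s < r → S.δ ((S'.π ^ s) x) = S.δ ((S'.π ^ s) y) ∧
        S.lt ((S'.π ^ s) x) ((S'.π ^ s) y)) ∧
        S.δ ((S'.π ^ r) x) = 1 ∧ S.δ ((S'.π ^ r) y) = 0 := by
    intro x y hxy hlt hlt' hI
    -- A pair reversed by the new order that is not an inversion is affected by the swap of places,
    -- so it starts at t or ends at t'.
    have hcase : (x = t ∧ S.lt y t' ∧ S.δ y = 0) ∨ (y = t' ∧ S.lt t x ∧ S.δ x = 1) := by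
      obtain ⟨φ, hφ, hφlt⟩ := S.exists_rank
      have hz := h.zero
      have ho := h.one
      have htt := h.lt
      clear h0 h1
      simp only [inversions, Set.mem_ofPred_eq, hφlt, swap_apply_def, not_and] at *
      have hI' : ¬ _ := fun e => hI e hlt'
      split_ifs at hI' <;> grind
    rcases hcase with ⟨rfl, hy, hy0⟩ | ⟨rfl, hx, hx1⟩
    · exact h0 y hlt hy hy0
    · exact h1 x hx hlt hx1
  -- An inversion is traced back along the bijection. The sources have equal types throughout, so
  -- the tracing must leave the inversions before it reaches a digit at which the expansions differ.
  have trace : ∀ N x y, (x, y) ∈ inversions S t t' S' →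
      ofLex (S'.bin x) N ≠ ofLex (S'.bin y) N → ∃ a b s, 1 ≤ s ∧ (S'.π ^ s) a = x ∧
        (S'.π ^ s) b = y ∧ (∀ u, 1 ≤ u → u < s → S.δ ((S'.π ^ u) a) = S.δ ((S'.π ^ u) b)) ∧
        S.δ a = S.δ b ∧ S.lt a b ∧ S'.lt b a ∧ (a, b) ∉ inversions S t t' S' := by
    intro N
    induction N with
    | zero =>
      intro x y hxy hne
      obtain ⟨x, rfl⟩ := S'.π.surjective x
      obtain ⟨y, rfl⟩ := S'.π.surjective y
      rw [bin_π_zero, bin_π_zero, h.δ_eq] at hne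
      exact absurd ((h.mem_inversions_π hS x y).1 hxy).1 hne
    | succ N ih =>
      intro x y hxy hne
      obtain ⟨x, rfl⟩ := S'.π.surjective x
      obtain ⟨y, rfl⟩ := S'.π.surjective y
      rw [bin_π_succ, bin_π_succ] at hne
      obtain ⟨e1, e2, e3⟩ := (h.mem_inversions_π hS x y).1 hxy
      by_cases hI : (x, y) ∈ inversions S t t' S'
      · obtain ⟨a, b, s, hs, ha, hb, hu, hr⟩ := ih x y hI hne
        refine ⟨a, b, s + 1, by omega, by rw [pow_succ', Perm.mul_apply, ha],
          by rw [pow_succ', Perm.mul_apply, hb], fun u hu1 hu2 => ?_, hr⟩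
        rcases (Nat.lt_succ_iff.1 hu2).lt_or_eq with h3 | rfl
        · exact hu u hu1 h3
        · rw [ha, hb, e1]
      · exact ⟨x, y, 1, le_rfl, by simp, by simp, fun u hu1 hu2 => by omega, e1, e2, e3, hI⟩
  have claim : ∀ x y, (x, y) ∈ inversions S t t' S' →
      (S.δ x = S.δ y ∧ S.lt x y) ∨ (S.δ x = 1 ∧ S.δ y = 0) := by
    intro x y hxy
    have hne : S'.bin x ≠ S'.bin y := fun e => S'.lt_irrefl y (by
      have := hxy.2
      rwa [hinj e] at this)
    obtain ⟨N, hN⟩ : ∃ N, ofLex (S'.bin x) N ≠ ofLex (S'.bin y) N := by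
      by_contra hcon
      push Not at hcon
      exact hne (ofLex.injective (funext hcon))
    obtain ⟨a, b, s, hs, rfl, rfl, hu, e1, e2, e3, e4⟩ := trace N x y hxy hN
    obtain ⟨r, hr, hr1, hr2, hr3⟩ := init a b e1 e2 e3 e4
    rcases _root_.lt_trichotomy s r with hsr | rfl | hsr
    · exact Or.inl (hr1 s hs hsr)
    · exact Or.inr ⟨hr2, hr3⟩
    · have := hu r hr hsr
      rw [hr2, hr3] at this
      exact absurd this (by decide)
  refine (h.length_add_one_iff hS).2 ⟨?_, fun x y hxy => (claim x y hxy).imp_left And.left⟩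
  rintro z ⟨hz1, hz2, ⟨hz3, hz4⟩ | ⟨hz3, hz4⟩⟩
  · have hzt : z ≠ t := by rintro rfl; exact S.lt_irrefl _ hz1
    have hzt' : z ≠ t' := by rintro rfl; exact S.lt_irrefl _ hz2
    have hI : (z, t) ∈ inversions S t t' S' := ⟨by
      simpa [swap_apply_of_ne_of_ne hzt hzt'] using hz2, hz4⟩
    rcases claim _ _ hI with hh | hh
    · exact S.lt_asymm hz1 hh.2
    · rw [hz3] at hh; exact absurd hh.1 (by decide)
  · have hzt : z ≠ t := by rintro rfl; exact S.lt_irrefl _ hz1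
    have hzt' : z ≠ t' := by rintro rfl; exact S.lt_irrefl _ hz2
    have hI : (t', z) ∈ inversions S t t' S' := ⟨by
      simpa [swap_apply_of_ne_of_ne hzt hzt'] using hz1, hz4⟩
    rcases claim _ _ hI with hh | hh
    · exact S.lt_asymm hz2 hh.2
    · rw [hz3] at hh; exact absurd hh.2 (by decide)

/-- The reordering of a sequence with injective expansions by these expansions. -/
@[reducible] noncomputable def orderByBin (S : ABS T) (hinj : Function.Injective S.bin) : ABS T where
  ord := LinearOrder.lift' S.bin hinj
  δ := S.δ
  π := S.π

omit [DecidableEq T] in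
theorem orderByBin_regular (S : ABS T) (hinj : Function.Injective S.bin) :
    (S.orderByBin hinj).Regular where
  lt_iff x y hxy := by
    change S.bin x < S.bin y ↔ S.bin (S.π x) < S.bin (S.π y)
    rw [bin_π_lt_iff]
    change S.δ x = S.δ y at hxy
    simp [hxy]
  lt_of x y hx hy := by
    change S.bin (S.π x) < S.bin (S.π y)
    rw [bin_π_lt_iff]
    change S.δ x = 0 at hx
    change S.δ y = 1 at hy
    rw [hx, hy]
    exact Or.inl (by decide)

end Criterion

/-! ### Construction of good exchanges in the minimal sequence -/

section Existence

variable {m₁ n₁ m₂ n₂ : ℕ}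

/-- The minimal sequence with its bijection composed with the switch of two elements, with the
order unchanged. -/
noncomputable def preExchange (i : Fin (m₁ + n₁)) (j : Fin (m₂ + n₂)) : ABS (Elt m₁ n₁ m₂ n₂) where
  ord := (minimalABS m₁ n₁ m₂ n₂).ord
  δ := (minimalABS m₁ n₁ m₂ n₂).δ
  π := swap (Sum.inl i) (Sum.inr j) * (minimalABS m₁ n₁ m₂ n₂).π

variable {i : Fin (m₁ + n₁)} {j : Fin (m₂ + n₂)}

theorem preExchange_π_inl {c : Fin (m₁ + n₁)} (hc : (simple m₁ n₁).π c ≠ i) :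
    (preExchange i j).π (Sum.inl c) = Sum.inl ((simple m₁ n₁).π c) := by
  change swap (Sum.inl i) (Sum.inr j) (Sum.inl ((simple m₁ n₁).π c)) = _
  rw [swap_apply_of_ne_of_ne]
  · simpa using hc
  · simp

theorem preExchange_π_inl_eq {c : Fin (m₁ + n₁)} (hc : (simple m₁ n₁).π c = i) :
    (preExchange i j).π (Sum.inl c) = Sum.inr j := by
  change swap (Sum.inl i) (Sum.inr j) (Sum.inl ((simple m₁ n₁).π c)) = _
  rw [hc, swap_apply_left]

theorem preExchange_π_inr {c : Fin (m₂ + n₂)} (hc : (simple m₂ n₂).π c ≠ j) :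
    (preExchange i j).π (Sum.inr c) = Sum.inr ((simple m₂ n₂).π c) := by
  change swap (Sum.inl i) (Sum.inr j) (Sum.inr ((simple m₂ n₂).π c)) = _
  rw [swap_apply_of_ne_of_ne]
  · simp
  · simpa using hc

theorem preExchange_π_inr_eq {c : Fin (m₂ + n₂)} (hc : (simple m₂ n₂).π c = j) :
    (preExchange i j).π (Sum.inr c) = Sum.inl i := by
  change swap (Sum.inl i) (Sum.inr j) (Sum.inr ((simple m₂ n₂).π c)) = _
  rw [hc, swap_apply_right]

theorem preExchange_π_pow_inl {c : Fin (m₁ + n₁)} {r : ℕ}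
    (hr : ∀ s, 1 ≤ s → s ≤ r → ((simple m₁ n₁).π ^ s) c ≠ i) {s : ℕ} (hs : s ≤ r) :
    ((preExchange i j).π ^ s) (Sum.inl c) = Sum.inl (((simple m₁ n₁).π ^ s) c) := by
  induction s with
  | zero => rfl
  | succ s ih =>
    have := hr (s + 1) (by omega) hs
    rw [pow_succ', Perm.mul_apply] at this
    rw [pow_succ', Perm.mul_apply, ih (by omega), preExchange_π_inl this, pow_succ',
      Perm.mul_apply]

theorem preExchange_π_pow_inr {c : Fin (m₂ + n₂)} {r : ℕ}
    (hr : ∀ s, 1 ≤ s → s ≤ r → ((simple m₂ n₂).π ^ s) c ≠ j) {s : ℕ} (hs : s ≤ r) :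
    ((preExchange i j).π ^ s) (Sum.inr c) = Sum.inr (((simple m₂ n₂).π ^ s) c) := by
  induction s with
  | zero => rfl
  | succ s ih =>
    have := hr (s + 1) (by omega) hs
    rw [pow_succ', Perm.mul_apply] at this
    rw [pow_succ', Perm.mul_apply, ih (by omega), preExchange_π_inr this, pow_succ',
      Perm.mul_apply]

/-- The switch joins the cycles of A and B into a single one. -/
theorem exists_preExchange_π_pow_eq (hc₁ : Nat.Coprime m₁ n₁) (hc₂ : Nat.Coprime m₂ n₂)
    (x : Elt m₁ n₁ m₂ n₂) : ∃ k, ((preExchange i j).π ^ k) x = Sum.inl i := by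
  classical
  have hr : ∀ l, ∃ k, ((preExchange i j).π ^ k) (Sum.inr l) = Sum.inl i := by
    intro l
    have hex := exists_simple_π_pow_eq hc₂ l j
    obtain ⟨h0, h1⟩ := Nat.find_spec hex
    obtain ⟨q, hq⟩ := Nat.exists_eq_add_of_le' (show 1 ≤ Nat.find hex from h0)
    have hmin : ∀ s, 1 ≤ s → s ≤ q → ((simple m₂ n₂).π ^ s) l ≠ j := fun s hs hsq e =>
      Nat.find_min hex (m := s) (by omega) ⟨hs, e⟩
    rw [hq, pow_succ', Perm.mul_apply] at h1
    refine ⟨q + 1, ?_⟩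
    rw [pow_succ', Perm.mul_apply, preExchange_π_pow_inr hmin le_rfl, preExchange_π_inr_eq h1]
  rcases x with c | l
  · have hex := exists_simple_π_pow_eq hc₁ c i
    obtain ⟨h0, h1⟩ := Nat.find_spec hex
    obtain ⟨q, hq⟩ := Nat.exists_eq_add_of_le' (show 1 ≤ Nat.find hex from h0)
    have hmin : ∀ s, 1 ≤ s → s ≤ q → ((simple m₁ n₁).π ^ s) c ≠ i := fun s hs hsq e =>
      Nat.find_min hex (m := s) (by omega) ⟨hs, e⟩
    rw [hq, pow_succ', Perm.mul_apply] at h1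
    obtain ⟨k, hk⟩ := hr j
    refine ⟨k + (q + 1), ?_⟩
    rw [pow_add, Perm.mul_apply, pow_succ', Perm.mul_apply, preExchange_π_pow_inl hmin le_rfl,
      preExchange_π_inl_eq h1, hk]
  · exact hr l

variable (h₁ : m₁ < n₁) (h₂ : n₂ < m₂) (hi : m₁ ≤ i.val) (hi' : i.val < n₁) (hj : j.val < n₂)

-- Reading backwards, equality would force digit 1 and then digit 0 on both sides. This returns c to
-- a zero of A and moves l up to l - n₂ + m₂, so the procedure cannot go on for ever.
include h₁ h₂ hi hj in
theorem preExchange_bin_inr_ne_inl (l : Fin (m₂ + n₂)) (c : Fin (m₁ + n₁)) (hl : j.val + m₂ ≤ l.val)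
    (hc : m₁ ≤ c.val) : (preExchange i j).bin (Sum.inr l) ≠ (preExchange i j).bin (Sum.inl c) := by
  obtain ⟨l, hl'⟩ := l
  simp only at hl
  induction hk : m₂ + n₂ - l using Nat.strong_induction_on generalizing c l with
  | _ k ih =>
  obtain ⟨c, hc'⟩ := c
  simp only at hc
  intro e
  obtain ⟨l, rfl⟩ := Nat.exists_eq_add_of_le' (show n₂ ≤ l by omega)
  have e1 := simple_π_mk_of_lt (m := m₂) (n := n₂) (k := l) (by omega)
  rw [← e1, ← preExchange_π_inr (i := i) (j := j) (by rw [e1, Ne, Fin.ext_iff]; simp; omega)] at e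
  have hδl : (preExchange i j).δ (Sum.inr ⟨l, by omega⟩) = 1 :=
    simple_δ_eq_one_iff.2 (by simp; omega)
  by_cases hci : (⟨c, hc'⟩ : Fin (m₁ + n₁)) = i
  · have e2 := simple_π_mk_add (m := m₂) (n := n₂) (k := j) hj
    rw [hci, ← preExchange_π_inr_eq (i := i) e2, bin_π_eq_iff, hδl] at e
    have : (preExchange i j).δ (Sum.inr ⟨j.val + m₂, by omega⟩) = 0 :=
      simple_δ_eq_zero_iff.2 (by simp)
    rw [this] at e
    exact absurd e.1 (by decide)
  by_cases hcn : c < n₁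
  · have e2 := simple_π_mk_add (m := m₁) (n := n₁) (k := c) hcn
    rw [← e2, ← preExchange_π_inl (i := i) (j := j) (by rw [e2]; exact hci), bin_π_eq_iff, hδl] at e
    have : (preExchange i j).δ (Sum.inl ⟨c + m₁, by omega⟩) = 0 :=
      simple_δ_eq_zero_iff.2 (by simp)
    rw [this] at e
    exact absurd e.1 (by decide)
  obtain ⟨c, rfl⟩ := Nat.exists_eq_add_of_le' (not_lt.1 hcn)
  have e2 := simple_π_mk_of_lt (m := m₁) (n := n₁) (k := c) (by omega)
  rw [← e2, ← preExchange_π_inl (i := i) (j := j) (by rw [e2]; exact hci), bin_π_eq_iff] at e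
  replace e := e.2
  have e3 := simple_π_mk_add (m := m₁) (n := n₁) (k := c) (by omega)
  rw [← e3, ← preExchange_π_inl (i := i) (j := j) (by
    rw [e3, Ne, Fin.ext_iff]; simp; omega)] at e
  have hδc : (preExchange i j).δ (Sum.inl ⟨c + m₁, by omega⟩) = 0 :=
      simple_δ_eq_zero_iff.2 (by simp)
  by_cases hln : l < n₂
  · have e4 := simple_π_mk_add (m := m₂) (n := n₂) (k := l) hln
    rw [← e4, ← preExchange_π_inr (i := i) (j := j) (by
      rw [e4, Ne, Fin.ext_iff]; simp; omega), bin_π_eq_iff] at e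
    exact ih _ (by omega) _ (by simp) (l + m₂) (by omega) (by omega) rfl e.2
  · obtain ⟨l, rfl⟩ := Nat.exists_eq_add_of_le' (not_lt.1 hln)
    have e4 := simple_π_mk_of_lt (m := m₂) (n := n₂) (k := l) (by omega)
    rw [← e4, ← preExchange_π_inr (i := i) (j := j) (by
      rw [e4, Ne, Fin.ext_iff]; simp; omega), bin_π_eq_iff, hδc] at e
    have : (preExchange i j).δ (Sum.inr ⟨l, by omega⟩) = 1 :=
      simple_δ_eq_one_iff.2 (by simp; omega)
    rw [this] at e
    exact absurd e.1 (by decide)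

-- With a single cycle, two equal expansions can be moved until one of them is that of i. The new
-- predecessor of i is j + m₂ in B, of type 0, and comparing predecessors leads to
-- `preExchange_bin_inr_ne_inl`.
include h₁ h₂ hi hj in
theorem preExchange_bin_injective (hc₁ : Nat.Coprime m₁ n₁) (hc₂ : Nat.Coprime m₂ n₂) :
    Function.Injective (preExchange i j).bin := by
  have key : ∀ y, (preExchange i j).bin (Sum.inl i) = (preExchange i j).bin y →
      (preExchange i j).δ y = 0 → Sum.inl i = y := by
    intro y e hy
    have e2 := simple_π_mk_add (m := m₂) (n := n₂) (k := j) hj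
    have hδ : (preExchange i j).δ (Sum.inr ⟨j.val + m₂, by omega⟩) = 0 :=
      simple_δ_eq_zero_iff.2 (by simp)
    rw [← preExchange_π_inr_eq (i := i) e2] at e
    by_contra hne
    rcases y with c | l
    · obtain ⟨c, rfl⟩ := (simple m₁ n₁).π.surjective c
      rw [← preExchange_π_inl (j := j) (fun e' => hne (by rw [e'])), bin_π_eq_iff, hδ] at e
      exact preExchange_bin_inr_ne_inl h₁ h₂ hi hj _ _ le_rfl (simple_δ_eq_zero_iff.1 e.1.symm) e.2
    · have hl : m₂ ≤ l.val := simple_δ_eq_zero_iff.1 hy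
      obtain ⟨l, hl'⟩ := l
      simp only at hl
      obtain ⟨l, rfl⟩ := Nat.exists_eq_add_of_le' (show n₂ ≤ l by omega)
      have e1 := simple_π_mk_of_lt (m := m₂) (n := n₂) (k := l) (by omega)
      rw [← e1, ← preExchange_π_inr (i := i) (j := j) (by rw [e1, Ne, Fin.ext_iff]; simp; omega),
        bin_π_eq_iff, hδ] at e
      have : (preExchange i j).δ (Sum.inr ⟨l, by omega⟩) = 1 :=
        simple_δ_eq_one_iff.2 (by simp; omega)
      rw [this] at e
      exact absurd e.1 (by decide)
  intro x y hxy
  obtain ⟨k, hk⟩ := exists_preExchange_π_pow_eq (i := i) (j := j) hc₁ hc₂ x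
  have e := bin_pow_eq_of_bin_eq _ _ hxy k
  apply ((preExchange i j).π ^ k).injective
  rw [hk] at e ⊢
  exact key _ e ((δ_eq_of_bin_eq _ _ e).symm.trans (simple_δ_eq_zero_iff.2 hi))

-- Converse to `resolves_up` and `resolves_down`: the orbits avoid i, respectively j, until they are
-- resolved, so the exchange leaves them unchanged and the criterion applies. The order of the
-- exchange is the one by expansions.
include h₁ h₂ hi hi' hj in
theorem exists_isGoodExchange (hc₁ : Nat.Coprime m₁ n₁) (hc₂ : Nat.Coprime m₂ n₂)
    (hup : ∀ k, i.val < k.val → k.val < n₁ →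
      Resolves (simple m₁ n₁) (simple m₁ n₁).π i i k fun _ _ => True)
    (hdown : ∀ l, l.val < j.val →
      Resolves (simple m₂ n₂) (simple m₂ n₂).π j l j fun _ _ => True) :
    ∃ Ψ, IsGoodExchange (minimalABS m₁ n₁ m₂ n₂) (Sum.inl i) (Sum.inr j) Ψ := by
  have hinj := preExchange_bin_injective h₁ h₂ hi hj hc₁ hc₂
  have hS := minimal_regular m₁ n₁ m₂ n₂
  have hex : IsExchange (minimalABS m₁ n₁ m₂ n₂) (Sum.inl i) (Sum.inr j)
      ((preExchange i j).orderByBin hinj) :=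
    isExchange_of_π_eq (simple_δ_eq_zero_iff.2 hi) (simple_δ_eq_one_iff.2 (by omega))
      ((minimal_lt_inl_inr h₁ h₂).2 (Or.inl hi')) rfl rfl (orderByBin_regular _ _)
  refine ⟨_, hex, hex.length_add_one_of_forall hS hinj ?_ ?_⟩
  · rintro (k | l) hz1 hz2 hz3
    · rw [minimal_lt_inl_inl] at hz1
      rw [minimal_lt_inl_inr h₁ h₂] at hz2
      obtain ⟨r, hr, hr1, hr2, hr3, hr4, -⟩ := hup k hz1 (by omega)
      refine ⟨r, hr, fun s hs hsr => ?_, ?_, ?_⟩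
      · change (minimalABS m₁ n₁ m₂ n₂).δ (((preExchange i j).π ^ s) _) = _ ∧
          (minimalABS m₁ n₁ m₂ n₂).lt (((preExchange i j).π ^ s) _) (((preExchange i j).π ^ s) _)
        rw [preExchange_π_pow_inl (fun s h h' => (hr1 s h h').1) hsr.le,
          preExchange_π_pow_inl (fun s h h' => (hr1 s h h').2) hsr.le]
        exact ⟨(hr2 s hs hsr).1, minimal_lt_inl_inl.2 (hr2 s hs hsr).2⟩
      · change (minimalABS m₁ n₁ m₂ n₂).δ (((preExchange i j).π ^ r) _) = _
        rw [preExchange_π_pow_inl (fun s h h' => (hr1 s h h').1) le_rfl]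
        exact hr3
      · change (minimalABS m₁ n₁ m₂ n₂).δ (((preExchange i j).π ^ r) _) = _
        rw [preExchange_π_pow_inl (fun s h h' => (hr1 s h h').2) le_rfl]
        exact hr4
    · rw [minimal_lt_inr_inr] at hz2
      have := simple_δ_eq_zero_iff.1 (show (simple m₂ n₂).δ l = 0 from hz3)
      omega
  · rintro (k | l) hz1 hz2 hz3
    · rw [minimal_lt_inl_inl] at hz1
      have := simple_δ_eq_one_iff.1 (show (simple m₁ n₁).δ k = 1 from hz3)
      omega
    · rw [minimal_lt_inr_inr] at hz2
      obtain ⟨r, hr, hr1, hr2, hr3, hr4, -⟩ := hdown l hz2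
      refine ⟨r, hr, fun s hs hsr => ?_, ?_, ?_⟩
      · change (minimalABS m₁ n₁ m₂ n₂).δ (((preExchange i j).π ^ s) _) = _ ∧
          (minimalABS m₁ n₁ m₂ n₂).lt (((preExchange i j).π ^ s) _) (((preExchange i j).π ^ s) _)
        rw [preExchange_π_pow_inr (fun s h h' => (hr1 s h h').1) hsr.le,
          preExchange_π_pow_inr (fun s h h' => (hr1 s h h').2) hsr.le]
        exact ⟨(hr2 s hs hsr).1, minimal_lt_inr_inr.2 (hr2 s hs hsr).2⟩
      · change (minimalABS m₁ n₁ m₂ n₂).δ (((preExchange i j).π ^ r) _) = _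
        rw [preExchange_π_pow_inr (fun s h h' => (hr1 s h h').1) le_rfl]
        exact hr3
      · change (minimalABS m₁ n₁ m₂ n₂).δ (((preExchange i j).π ^ r) _) = _
        rw [preExchange_π_pow_inr (fun s h h' => (hr1 s h h').2) le_rfl]
        exact hr4

end Existence


/-! ### Arithmetic of the separation times -/

section Arithmetic

theorem dvd_of_dvd_mul {n h : ℕ} (hc : Nat.Coprime n h) {a : ℤ} (hd : (h : ℤ) ∣ a * n) :
    (h : ℤ) ∣ a := by
  refine IsCoprime.dvd_of_dvd_mul_right ?_ hd
  exact Nat.isCoprime_iff_coprime.2 hc.symm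

theorem eq_zero_of_dvd_of_lt {h : ℕ} {a : ℤ} (hd : (h : ℤ) ∣ a) (h1 : -h < a) (h2 : a < h) :
    a = 0 :=
  Int.eq_zero_of_abs_lt_dvd hd (abs_lt.2 ⟨h1, h2⟩)

/-- The orbit of `i` under the translation by `n` modulo `m + n`, and the first times `rd d` at
which the boundary `m` separates the points starting at `i` and `i + d`. -/
structure Separation (m n N i : ℕ) (X : ℕ → ℕ) (rd : ℕ → ℕ) : Prop where
  pos : 0 < m
  lt : m < n
  coprime : Nat.Coprime n (m + n)
  dvd : ∀ s, ((m + n : ℕ) : ℤ) ∣ X s - i - s * n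
  le : m ≤ i
  lt_N : i + 1 < N
  N_le : N ≤ m + n
  X_lt : ∀ s, X s < m + n
  one_le : ∀ d, 1 ≤ d → i + d < N → 1 ≤ rd d
  add_lt : ∀ d, 1 ≤ d → i + d < N → ∀ s, s ≤ rd d → X s + d < m + n
  ne : ∀ d, 1 ≤ d → i + d < N → ∀ s, 1 ≤ s → s ≤ rd d → X s + d ≠ i
  iff : ∀ d, 1 ≤ d → i + d < N → ∀ s, s < rd d → (X s < m ↔ X s + d < m)
  sep : ∀ d, 1 ≤ d → i + d < N → X (rd d) < m ∧ m ≤ X (rd d) + d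

namespace Separation

variable {m n N i : ℕ} {X : ℕ → ℕ} {rd : ℕ → ℕ}

/-- At time `rd 1` the orbit of i is at m - 1, where m separates it from its translate by any d ≥ 1.
-/
theorem rd_le (S : Separation m n N i X rd) {d : ℕ} (hd : 1 ≤ d) (hdN : i + d < N) :
    rd d ≤ rd 1 := by
  by_contra hlt
  have h1 := S.sep 1 le_rfl S.lt_N
  have h2 := S.iff d hd hdN (rd 1) (by omega)
  omega

theorem X_rd_one (S : Separation m n N i X rd) : X (rd 1) + 1 = m := by
  have h1 := S.sep 1 le_rfl S.lt_N
  omega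

/-- L is the time of a step by +1, so i + 1 reaches i at time m + n - L; the separation from i must
come earlier. -/
theorem rd_one_lt (S : Separation m n N i X rd) {L : ℕ} (hL : L < m + n)
    (hLd : ((m + n : ℕ) : ℤ) ∣ L * n - 1) : rd 1 + L < m + n := by
  by_contra hlt
  have h1 := S.ne 1 le_rfl S.lt_N (m + n - L) (by omega) (by omega)
  have h2 := S.add_lt 1 le_rfl S.lt_N (m + n - L) (by omega)
  obtain ⟨a, ha⟩ := S.dvd (m + n - L)
  obtain ⟨b, hb⟩ := hLd
  have h3 := eq_zero_of_dvd_of_lt (h := m + n) (a := (X (m + n - L) + 1 - i : ℤ))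
    ⟨a - b + n, by
      push_cast [Nat.cast_sub hL.le] at ha hb ⊢
      linear_combination ha - hb⟩ (by have := S.lt_N; have := S.N_le; omega) (by omega)
  omega

/-- Let j n ≡ d and z = j - L. The upper bound expresses that i + d reaches i at time m + n - j,
after its separation. If z ≤ `rd 1`, then i + d would be at m at time `rd 1` - z, and separated
before `rd d`. -/
theorem exists_z (S : Separation m n N i X rd) {L : ℕ} (hL0 : 0 < L) (hL : L < m + n)
    (hLd : ((m + n : ℕ) : ℤ) ∣ L * n - 1) {d : ℕ} (hd : 2 ≤ d) (hdN : i + d < N)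
    (hr : rd d = rd 1) (hD : ∀ j < L, ¬ ((m + n : ℕ) : ℤ) ∣ j * n - d) :
    ∃ z, z + rd 1 + L < m + n ∧ rd 1 < z ∧ ((m + n : ℕ) : ℤ) ∣ z * n - (d - 1) := by
  have hdh : d < m + n := by have := S.N_le; omega
  have hrL := S.rd_one_lt hL hLd
  obtain ⟨q', hq'0, hq'⟩ := exists_pos_mul_modEq (n := n) (h := m + n) (by omega) S.coprime d
  set j := q' % (m + n) with hj
  have hjlt : j < m + n := Nat.mod_lt _ (by omega)
  have hjd : ((m + n : ℕ) : ℤ) ∣ j * n - d := by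
    have h1 : j * n ≡ d [MOD m + n] := ((Nat.mod_modEq q' (m + n)).mul_right n).trans hq'
    have := (Nat.modEq_iff_dvd.1 h1.symm)
    push_cast at this ⊢
    exact this
  have hjL : L ≤ j := by
    by_contra hlt
    exact hD j (by omega) hjd
  obtain ⟨b, hb⟩ := hLd
  obtain ⟨c, hc⟩ := hjd
  have hjL' : L ≠ j := by
    intro e
    rw [← e] at hc
    have := eq_zero_of_dvd_of_lt (h := m + n) (a := ((d : ℤ) - 1)) ⟨b - c, by
      linear_combination hb - hc⟩ (by omega) (by omega)
    omega
  have hqr : rd 1 < m + n - j := by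
    by_contra hlt
    have h1 := S.ne d (by omega) hdN (m + n - j) (by omega) (by omega)
    have h2 := S.add_lt d (by omega) hdN (m + n - j) (by omega)
    obtain ⟨a, ha⟩ := S.dvd (m + n - j)
    have h3 := eq_zero_of_dvd_of_lt (h := m + n) (a := (X (m + n - j) + d - i : ℤ))
      ⟨a - c + n, by
        push_cast [Nat.cast_sub hjlt.le] at ha hc ⊢
        linear_combination ha - hc⟩ (by have := S.N_le; omega) (by omega)
    omega
  have hzd : ((m + n : ℕ) : ℤ) ∣ (j - L : ℕ) * n - (d - 1) := ⟨c - b, by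
    push_cast [Nat.cast_sub hjL]
    push_cast at hc hb
    linear_combination hc - hb⟩
  refine ⟨j - L, by omega, ?_, hzd⟩
  by_contra hlt
  have h1 := S.iff d (by omega) hdN (rd 1 - (j - L)) (by omega)
  have h2 := S.add_lt d (by omega) hdN (rd 1 - (j - L)) (by omega)
  have h3 := S.X_rd_one
  have h4 := S.X_lt (rd 1)
  obtain ⟨a, ha⟩ := S.dvd (rd 1 - (j - L))
  obtain ⟨a', ha'⟩ := S.dvd (rd 1)
  obtain ⟨e, he⟩ := hzd
  rw [Nat.cast_sub (not_lt.1 hlt)] at ha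
  have h5 := eq_zero_of_dvd_of_lt (h := m + n)
    (a := (X (rd 1 - (j - L)) + d - 1 - X (rd 1) : ℤ)) ⟨a - a' - e, by
      linear_combination ha - ha' - he⟩ (by omega) (by omega)
  omega

/-- For i = n one finds (`rd 1` + 2) n ≡ -1, hence `rd 1` + 2 = m + n - L, which leaves no room for
the z of `exists_z`. -/
theorem exists_dvd_of_eq (S : Separation m n N i X rd) (hin : i = n) (hN : N = m + n) {L : ℕ}
    (hL0 : 0 < L) (hL : L < m + n) (hLd : ((m + n : ℕ) : ℤ) ∣ L * n - 1) {d : ℕ} (hd : 2 ≤ d)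
    (hdN : i + d < N) (hr : rd d = rd 1) : ∃ j < L, ((m + n : ℕ) : ℤ) ∣ j * n - d := by
  by_contra hD
  push Not at hD
  obtain ⟨z, hz1, hz2, -⟩ := S.exists_z hL0 hL hLd hd hdN hr hD
  have h1 := S.one_le 1 le_rfl S.lt_N
  have hX := S.X_rd_one
  obtain ⟨a, ha⟩ := S.dvd (rd 1)
  obtain ⟨b, hb⟩ := hLd
  have hX' : (X (rd 1) : ℤ) = m - 1 := by omega
  have h2 := dvd_of_dvd_mul S.coprime (a := ((rd 1 + 2 : ℤ) - (m + n - L))) ⟨-a + 1 - n + b, by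
    subst hin
    rw [hX'] at ha
    push_cast at ha hb ⊢
    linear_combination - ha + hb⟩
  have h3 := eq_zero_of_dvd_of_lt h2 (by push_cast; omega) (by push_cast; omega)
  omega

/-- If both alternatives fail, some i + d₂ meets i - 1 at a time s ≤ `rd 1`, and there is z with `rd
1` < z and z + `rd 1` < m + n - L. The meeting expresses m + n - L through `rd 1` and s in a way
that contradicts these bounds. -/
theorem dichotomy (S : Separation m n N i X rd) (hN : N = n ∨ N = m + n) {L : ℕ} (hL0 : 0 < L)
    (hL : L < m + n) (hLd : ((m + n : ℕ) : ℤ) ∣ L * n - 1) :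
    (∀ d, 1 ≤ d → i + d < N → ∀ s, 1 ≤ s → s ≤ rd d → X s + d + 1 ≠ i) ∨
      ∀ d, 2 ≤ d → i + d < N → rd d = rd 1 → ∃ j < L, ((m + n : ℕ) : ℤ) ∣ j * n - d := by
  by_contra! hcon
  obtain ⟨⟨d₂, hd₂, hdN₂, s, hs, hsr, hXs⟩, d₁, hd₁, hdN₁, hr, hD⟩ := hcon
  obtain ⟨z, hz1, hz2, hz3⟩ := S.exists_z hL0 hL hLd hd₁ hdN₁ hr hD
  have hsr1 := S.rd_le hd₂ hdN₂
  have hX := S.X_rd_one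
  have hm := S.pos
  have hmn := S.lt
  have hNle := S.N_le
  obtain ⟨a, ha⟩ := S.dvd (rd 1)
  obtain ⟨a₂, ha₂⟩ := S.dvd s
  obtain ⟨b, hb⟩ := hLd
  have hXs' : (X s : ℤ) = i - d₂ - 1 := by omega
  have hX' : (X (rd 1) : ℤ) = m - 1 := by omega
  rw [hXs'] at ha₂
  rw [hX'] at ha
  -- If i + d₂ + 1 is still below N, it would be at i at time s, so it is separated earlier, at a
  -- moment when i + d₂ is at m - 1. Otherwise i + d₂ + 1 = N, and either value of N gives a second
  -- congruence.
  rcases (show i + (d₂ + 1) ≤ N by omega).lt_or_eq with hd₃ | hd₃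
  · have hs' : rd (d₂ + 1) < s := by
      by_contra hlt
      exact S.ne (d₂ + 1) (by omega) hd₃ s hs (by omega) (by omega)
    have h1 := S.sep (d₂ + 1) (by omega) hd₃
    have h2 := S.iff d₂ hd₂ hdN₂ (rd (d₂ + 1)) (by omega)
    obtain ⟨a₃, ha₃⟩ := S.dvd (rd (d₂ + 1))
    have hX₃ : (X (rd (d₂ + 1)) : ℤ) = m - 1 - d₂ := by omega
    rw [hX₃] at ha₃
    have h3 := dvd_of_dvd_mul S.coprime (a := ((rd 1 : ℤ) - rd (d₂ + 1) - (m + n - L - s)))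
      ⟨- a + a₃ - a₂ - n + b, by
        push_cast at *
        linear_combination - ha + ha₃ - ha₂ + hb⟩
    have h4 := eq_zero_of_dvd_of_lt h3 (by push_cast; omega) (by push_cast; omega)
    omega
  · rcases hN with rfl | rfl
    · have h3 := dvd_of_dvd_mul S.coprime (a := ((rd 1 : ℤ) + 2 - (m + N - L - s)))
        ⟨- a - a₂ + 1 - N + b, by
          have hd₃' : (i : ℤ) + (d₂ + 1) = N := by exact_mod_cast hd₃
          push_cast at *
          linear_combination - ha - ha₂ + hb - hd₃'⟩
      have h4 := eq_zero_of_dvd_of_lt h3 (by push_cast; omega) (by push_cast; omega)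
      obtain ⟨e, he⟩ := hz3
      have hz : (z : ℤ) = rd 1 + 1 := by omega
      rw [hz] at he
      have h5 := eq_zero_of_dvd_of_lt (h := m + N) (a := ((d₁ : ℤ) + i)) ⟨- e + 1 - a, by
        push_cast at *
        linear_combination - he - ha⟩ (by omega) (by push_cast; omega)
      omega
    · have h3 := dvd_of_dvd_mul S.coprime (a := ((rd 1 : ℤ) + 1 - (m + n - L - s)))
        ⟨- a - a₂ - n + b, by
          have hd₃' : (i : ℤ) + (d₂ + 1) = m + n := by exact_mod_cast hd₃
          push_cast at *
          linear_combination - ha - ha₂ + hb - hd₃'⟩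
      have h4 := eq_zero_of_dvd_of_lt h3 (by push_cast; omega) (by push_cast; omega)
      omega

end Separation

end Arithmetic


/-! ### Cutting a cycle at two neighbours -/

section Orbits

theorem swap_mul_pow_apply {T : Type*} [DecidableEq T] (σ : Perm T) {p q x : T} {s : ℕ}
    (h : ∀ u, 1 ≤ u → u ≤ s → (σ ^ u) x ≠ p ∧ (σ ^ u) x ≠ q) :
    ((swap p q * σ) ^ s) x = (σ ^ s) x := by
  induction s with
  | zero => simp
  | succ s ih =>
    have e : σ ((σ ^ s) x) = (σ ^ (s + 1)) x := by rw [pow_succ', Perm.mul_apply]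
    rw [pow_succ', Perm.mul_apply, ih fun u h1 h2 => h u h1 (by omega), Perm.mul_apply, e]
    exact swap_apply_of_ne_of_ne (h (s + 1) (by omega) le_rfl).1 (h (s + 1) (by omega) le_rfl).2

theorem pow_apply_mem_iff {T : Type*} {σ : Perm T} {D : Set T} (h : ∀ x, σ x ∈ D ↔ x ∈ D) (s : ℕ)
    (x : T) : (σ ^ s) x ∈ D ↔ x ∈ D := by
  induction s with
  | zero => simp
  | succ s ih => rw [pow_succ', Perm.mul_apply, h, ih]

theorem apply_mem_iff_of_mapsTo {T : Type*} [Finite T] {σ : Perm T} {D : Set T}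
    (h : ∀ x, x ∈ D → σ x ∈ D) (x : T) : σ x ∈ D ↔ x ∈ D := by
  refine ⟨fun hx => ?_, h x⟩
  simpa using Perm.perm_symm_mapsTo_of_mapsTo σ h hx

variable {m n : ℕ}

theorem simple_π_pow_eq_iff {x y : Fin (m + n)} {s : ℕ} :
    ((simple m n).π ^ s) x = y ↔ ((m + n : ℕ) : ℤ) ∣ x + s * n - y := by
  rw [Fin.ext_iff, simple_π_pow_val]
  have hy := y.isLt
  constructor
  · intro e
    have : x.val + s * n ≡ y [MOD m + n] := by rw [Nat.ModEq, e, Nat.mod_eq_of_lt hy]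
    exact_mod_cast Nat.modEq_iff_dvd.1 this.symm
  · intro e
    have : y.val ≡ x.val + s * n [MOD m + n] := Nat.modEq_iff_dvd.2 (by exact_mod_cast e)
    rw [← this, Nat.mod_eq_of_lt hy]

theorem simple_π_pow_val_add {x y : Fin (m + n)} {d s : ℕ} (hd : y.val = x.val + d)
    (h : ∀ u, u < s → (simple m n).δ (((simple m n).π ^ u) x) =
      (simple m n).δ (((simple m n).π ^ u) y)) :
    (((simple m n).π ^ s) y).val = (((simple m n).π ^ s) x).val + d := by
  induction s with
  | zero => simpa using hd
  | succ s ih =>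
    have ih := ih fun u hu => h u (by omega)
    have h1 := simple_δ_eq_iff.1 (h s (by omega))
    rw [pow_succ', Perm.mul_apply, Perm.mul_apply, simple_π_val, simple_π_val]
    split_ifs <;> omega

/-- A set on which the permutation `swap p q * π` can be restricted, containing exactly one of the
neighbours `p` and `q = p + 1`. -/
theorem exists_invariant_set (hm : 0 < m) (hn : 0 < n) (hc : Nat.Coprime n (m + n)) :
    ∃ L, 0 < L ∧ L < m + n ∧ ((m + n : ℕ) : ℤ) ∣ L * n - 1 ∧
      ∀ p q : Fin (m + n), q.val = p.val + 1 → ∃ D : Set (Fin (m + n)),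
        (∀ x, x ∈ D ↔ ∃ j < L, ((simple m n).π ^ j) p = x) ∧ p ∈ D ∧ q ∉ D ∧
        ∀ x, (swap p q * (simple m n).π) x ∈ D ↔ x ∈ D := by
  -- With L n ≡ 1, the orbit of p reaches q = p + 1 after exactly L steps. The swap sends it back to
  -- p instead, so the arc of the first L points is closed.
  obtain ⟨u, -, hu⟩ := exists_pos_mul_modEq (n := n) (h := m + n) (by omega) hc 1
  have hu' : u % (m + n) * n ≡ 1 [MOD m + n] := ((Nat.mod_modEq u (m + n)).mul_right n).trans hu
  have hL : u % (m + n) < m + n := Nat.mod_lt _ (by omega)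
  have hLd : ((m + n : ℕ) : ℤ) ∣ (u % (m + n) : ℕ) * n - 1 := by
    have := Nat.modEq_iff_dvd.1 hu'.symm
    rw [Nat.cast_mul, Nat.cast_one] at this
    exact this
  generalize u % (m + n) = L at *
  have hL0 : 0 < L := by
    rw [Nat.pos_iff_ne_zero]
    rintro e
    rw [e] at hLd
    have := eq_zero_of_dvd_of_lt (h := m + n) hLd (by push_cast; omega) (by push_cast; omega)
    omega
  refine ⟨L, hL0, hL, hLd, fun p q hpq => ⟨{x | ∃ j < L, ((simple m n).π ^ j) p = x},
    fun x => Iff.rfl, ⟨0, hL0, rfl⟩, ?_, apply_mem_iff_of_mapsTo ?_⟩⟩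
  · rintro ⟨j, hj, hjq⟩
    rw [simple_π_pow_eq_iff, hpq] at hjq
    obtain ⟨a, ha⟩ := hjq
    obtain ⟨b, hb⟩ := hLd
    have h1 := dvd_of_dvd_mul hc (a := (L - j : ℤ)) ⟨b - a, by
      push_cast at ha hb ⊢
      linear_combination hb - ha⟩
    have h2 := eq_zero_of_dvd_of_lt h1 (by omega) (by omega)
    omega
  · rintro _ ⟨j, hj, rfl⟩
    have e : (simple m n).π (((simple m n).π ^ j) p) = ((simple m n).π ^ (j + 1)) p := by
      rw [pow_succ', Perm.mul_apply]
    rw [Perm.mul_apply, e]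
    have hp : ((simple m n).π ^ (j + 1)) p ≠ p := by
      intro e
      rw [simple_π_pow_eq_iff] at e
      obtain ⟨a, ha⟩ := e
      have h1 := dvd_of_dvd_mul hc (a := (j + 1 : ℤ)) ⟨a, by
        push_cast at ha ⊢
        linear_combination ha⟩
      have h2 := eq_zero_of_dvd_of_lt h1 (by omega) (by omega)
      omega
    by_cases hq : ((simple m n).π ^ (j + 1)) p = q
    · rw [hq, swap_apply_right]
      exact ⟨0, hL0, rfl⟩
    · rw [swap_apply_of_ne_of_ne hp hq]
      refine ⟨j + 1, ?_, rfl⟩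
      by_contra hlt
      refine hq ?_
      rw [simple_π_pow_eq_iff, show j + 1 = L by omega, hpq]
      obtain ⟨b, hb⟩ := hLd
      exact ⟨b, by push_cast at hb ⊢; linear_combination hb⟩

end Orbits

/-! ### Choosing the switch that keeps the orbits resolved -/

section ResolvingSwitch

variable {m n N : ℕ} {i : Fin (m + n)} {E : Fin (m + n) → Fin (m + n) → Prop}

/-- Until the types differ, the orbits of i and k move in parallel, so the orbit of i and the
distance k - i carry all the information. -/
theorem exists_separation (hm : 0 < m) (hmn : m < n) (hc : Nat.Coprime n (m + n)) (hi : m ≤ i.val)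
    (hiN : i.val + 1 < N) (hN : N ≤ m + n)
    (hup : ∀ k : Fin (m + n), i.val < k.val → k.val < N →
      Resolves (simple m n) (simple m n).π i i k E) :
    ∃ rd : ℕ → ℕ,
      Separation m n N i (fun s => (((simple m n).π ^ s) i).val) rd ∧
      (∀ d, 1 ≤ d → i.val + d < N → ∀ s, 1 ≤ s → s ≤ rd d → ((simple m n).π ^ s) i ≠ i) ∧
      (∀ k : Fin (m + n), i.val < k.val → k.val < N → ∀ s, s ≤ rd (k.val - i.val) →
        (((simple m n).π ^ s) k).val = (((simple m n).π ^ s) i).val + (k.val - i.val)) ∧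
      ∀ p q : Fin (m + n), q.val = p.val + 1 → q.val = m → E p q := by
  have hex : ∀ d : ℕ, ∃ r, 1 ≤ d → ∀ hd : i.val + d < N, 1 ≤ r ∧
      (∀ s, 1 ≤ s → s ≤ r → ((simple m n).π ^ s) i ≠ i ∧
        ((simple m n).π ^ s) ⟨i.val + d, by omega⟩ ≠ i) ∧
      (∀ s, s < r → (simple m n).δ (((simple m n).π ^ s) i) =
        (simple m n).δ (((simple m n).π ^ s) ⟨i.val + d, by omega⟩)) ∧
      (simple m n).δ (((simple m n).π ^ r) i) = 1 ∧
      (simple m n).δ (((simple m n).π ^ r) ⟨i.val + d, by omega⟩) = 0 ∧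
      E (((simple m n).π ^ r) i) (((simple m n).π ^ r) ⟨i.val + d, by omega⟩) := by
    intro d
    by_cases hd : 1 ≤ d ∧ i.val + d < N
    · obtain ⟨r, h1, h2, h3, h4⟩ := hup ⟨i.val + d, by omega⟩ (by simp; omega) hd.2
      refine ⟨r, fun _ _ => ⟨h1, h2, fun s hs => ?_, h4⟩⟩
      rcases Nat.eq_zero_or_pos s with rfl | hs0
      · rw [simple_δ_eq_iff]
        simp
        omega
      · exact (h3 s hs0 hs).1
    · exact ⟨0, fun h h' => absurd ⟨h, h'⟩ hd⟩
  choose rd hrd using hex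
  have hval : ∀ d, 1 ≤ d → ∀ hd : i.val + d < N, ∀ s, s ≤ rd d →
      (((simple m n).π ^ s) ⟨i.val + d, by omega⟩).val = (((simple m n).π ^ s) i).val + d := by
    intro d h1 hd s hs
    exact simple_π_pow_val_add rfl fun u hu => (hrd d h1 hd).2.2.1 u (by omega)
  refine ⟨rd, ⟨hm, hmn, hc, fun s => ?_, hi, hiN, hN, fun s => Fin.isLt _, fun d h1 hd =>
    (hrd d h1 hd).1, fun d h1 hd s hs => ?_, fun d h1 hd s hs hs' e => ?_, fun d h1 hd s hs => ?_,
    fun d h1 hd => ?_⟩, fun d h1 hd s hs hs' => ((hrd d h1 hd).2.1 s hs hs').1, ?_, ?_⟩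
  · have := (simple_π_pow_eq_iff (m := m) (n := n) (x := i) (s := s)).1 rfl
    obtain ⟨a, ha⟩ := this
    exact ⟨-a, by linear_combination - ha⟩
  · rw [← hval d h1 hd s hs]
    exact Fin.isLt _
  · refine ((hrd d h1 hd).2.1 s hs hs').2 (Fin.ext ?_)
    rw [hval d h1 hd s hs', e]
  · have := simple_δ_eq_iff.1 ((hrd d h1 hd).2.2.1 s hs)
    rwa [hval d h1 hd s hs.le] at this
  · obtain ⟨-, -, -, h2, h3, -⟩ := hrd d h1 hd
    rw [simple_δ_eq_one_iff] at h2
    rw [simple_δ_eq_zero_iff, hval d h1 hd _ le_rfl] at h3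
    exact ⟨h2, h3⟩
  · intro k hik hk s hs
    have h := hval (k.val - i.val) (by omega) (by omega) s hs
    rw [← h]
    congr 3
    apply Fin.ext
    simp
    omega
  · intro p q hpq hq
    obtain ⟨-, -, -, h2, h3, h4⟩ := hrd 1 le_rfl hiN
    rw [simple_δ_eq_one_iff] at h2
    rw [simple_δ_eq_zero_iff, hval 1 le_rfl hiN _ le_rfl] at h3
    convert h4 using 1 <;> apply Fin.ext
    · omega
    · rw [hval 1 le_rfl hiN _ le_rfl]
      omega

end ResolvingSwitch


section ResolvingSwitch

variable {m n N : ℕ} {i : Fin (m + n)} {E : Fin (m + n) → Fin (m + n) → Prop}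

theorem resolves_of_pow_eq {σ τ : Perm (Fin (m + n))} {k : Fin (m + n)} {r : ℕ} (hr : 1 ≤ r)
    (hki : i.val < k.val)
    (hne : ∀ s, 1 ≤ s → s ≤ r → (τ ^ s) i ≠ i ∧ (τ ^ s) k ≠ i)
    (hk : ∀ s, s < r → (σ ^ s) i = (τ ^ s) i ∧ (σ ^ s) k = (τ ^ s) k)
    (hkr : (τ ^ r) i = (σ ^ r) i)
    (hval : ∀ s, s < r → ((σ ^ s) k).val = ((σ ^ s) i).val + (k.val - i.val))
    (hδ : ∀ s, s < r → (((σ ^ s) i).val < m ↔ ((σ ^ s) i).val + (k.val - i.val) < m))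
    (h1 : ((σ ^ r) i).val < m) (h2 : m ≤ ((τ ^ r) k).val) :
    Resolves (simple m n) τ i i k fun _ _ => True := by
  refine ⟨r, hr, hne, fun s hs hsr => ?_, ?_, ?_, trivial⟩
  · rw [← (hk s hsr).1, ← (hk s hsr).2, simple_δ_eq_iff, simple_lt_iff, hval s hsr]
    exact ⟨hδ s hsr, by omega⟩
  · rw [hkr, simple_δ_eq_one_iff]
    exact h1
  · rw [simple_δ_eq_zero_iff]
    exact h2

/-- The first alternative of `Separation.dichotomy` gives the neighbours i - 1 and i, the second
gives m - 1 and m. The cycle D is removed afterwards, so nothing is required of the k in D. The case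
N = m + n serves the second summand, after reversal. -/
theorem exists_resolving_switch (hm : 0 < m) (hmn : m < n) (hc : Nat.Coprime n (m + n))
    (hi : m ≤ i.val) (hiN : i.val < N)
    (hcase : (N = n ∧ m + 1 < n) ∨ (N = m + n ∧ n ≤ i.val ∧ 2 ≤ m))
    (hup : ∀ k : Fin (m + n), i.val < k.val → k.val < N →
      Resolves (simple m n) (simple m n).π i i k E) :
    ∃ (p q : Fin (m + n)) (D : Set (Fin (m + n))), q.val = p.val + 1 ∧
      ((q.val = m ∧ i ≠ q ∧ E p q) ∨ (q = i ∧ m ≤ p.val)) ∧ (p.val < n ↔ q.val < n) ∧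
      p ∈ D ∧ q ∉ D ∧ i ∉ D ∧ (∀ x, (swap p q * (simple m n).π) x ∈ D ↔ x ∈ D) ∧
      ∀ k, k ∉ D → i.val < k.val → k.val < N →
        Resolves (simple m n) (swap p q * (simple m n).π) i i k fun _ _ => True := by
  have hN : N ≤ m + n := by omega
  obtain ⟨L, hL0, hL, hLd, hset⟩ := exists_invariant_set hm (by omega) hc
  have hlast : i.val + 1 < N ∨ i.val + 1 = N := by omega
  rcases hlast with hlast | hlast
  swap
  -- No k is left to be resolved. The margins m + 1 < n and 2 ≤ m ensure here that i - 1 is a zero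
  -- and lies on the same side of n as i.
  · obtain ⟨D, -, h1, h2, h3⟩ := hset ⟨i.val - 1, by omega⟩ i (by simp; omega)
    refine ⟨_, i, D, ?_, Or.inr ⟨rfl, ?_⟩, ?_, h1, h2, h2, h3, fun k _ _ _ => ?_⟩
    · simp; omega
    · simp; omega
    · simp; omega
    · omega
  obtain ⟨rd, S, hii, hval, hE⟩ := exists_separation hm hmn hc hi hlast hN hup
  have hX1 := S.X_rd_one
  have hr1 := S.one_le 1 le_rfl S.lt_N
  -- At time `rd 1` the orbit of i + 1 is at m, and it has not met i by then.
  have him : i.val ≠ m := by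
    have := S.ne 1 le_rfl S.lt_N _ hr1 le_rfl
    omega
  -- If i = n, the neighbours i - 1 and i lie on different sides of n, which the conclusion
  -- excludes; the second alternative must then be forced.
  have hdich : ((∀ d, 1 ≤ d → i.val + d < N → ∀ s, 1 ≤ s → s ≤ rd d →
      (((simple m n).π ^ s) i).val + d + 1 ≠ i) ∧ i.val ≠ n) ∨
      ∀ d, 2 ≤ d → i.val + d < N → rd d = rd 1 →
        ∃ j < L, ((m + n : ℕ) : ℤ) ∣ j * n - d := by
    by_cases hin : i.val = n
    · exact Or.inr fun d => S.exists_dvd_of_eq hin (by omega) hL0 hL hLd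
    · exact (S.dichotomy (by omega) hL0 hL hLd).imp (fun h => ⟨h, hin⟩) id
  rcases hdich with ⟨hsep, hin⟩ | hsep
  · obtain ⟨D, -, h1, h2, h3⟩ := hset ⟨i.val - 1, by omega⟩ i (by simp; omega)
    refine ⟨_, i, D, ?_, Or.inr ⟨rfl, ?_⟩, ?_, h1, h2, h2, h3, fun k _ hik hk => ?_⟩
    · simp; omega
    · simp; omega
    · simp; omega
    have hd1 : 1 ≤ k.val - i.val := by omega
    have hdN : i.val + (k.val - i.val) < N := by omega
    have hle := S.rd_le hd1 hdN
    have ei : ∀ s, s ≤ rd (k.val - i.val) →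
        ((swap ⟨i.val - 1, by omega⟩ i * (simple m n).π) ^ s) i = ((simple m n).π ^ s) i := by
      intro s hs
      refine swap_mul_pow_apply _ fun u hu hus => ⟨fun e => ?_, hii _ hd1 hdN u hu (by omega)⟩
      have := S.ne 1 le_rfl S.lt_N u hu (by omega)
      simp only [Fin.ext_iff] at e
      omega
    have ek : ∀ s, s ≤ rd (k.val - i.val) →
        ((swap ⟨i.val - 1, by omega⟩ i * (simple m n).π) ^ s) k = ((simple m n).π ^ s) k := by
      intro s hs
      refine swap_mul_pow_apply _ fun u hu hus => ⟨fun e => ?_, fun e => ?_⟩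
      · have h4 := hsep _ hd1 hdN u hu (by omega)
        have h5 := hval k hik hk u (by omega)
        simp only [Fin.ext_iff] at e
        omega
      · have h4 := S.ne _ hd1 hdN u hu (by omega)
        have h5 := hval k hik hk u (by omega)
        simp only [Fin.ext_iff] at e
        omega
    have hsep' := S.sep _ hd1 hdN
    refine resolves_of_pow_eq (σ := (simple m n).π) (S.one_le _ hd1 hdN) hik
      (fun s h4 h5 => ?_) (fun s hs => ⟨(ei s hs.le).symm, (ek s hs.le).symm⟩)
      (ei _ le_rfl) (fun s hs => hval k hik hk s hs.le) (S.iff _ hd1 hdN) hsep'.1 ?_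
    · rw [ei s h5, ek s h5]
      refine ⟨hii _ hd1 hdN s h4 h5, fun e => ?_⟩
      have h6 := S.ne _ hd1 hdN s h4 h5
      have h7 := hval k hik hk s h5
      rw [e] at h7
      omega
    · rw [ek _ le_rfl, hval k hik hk _ le_rfl]
      exact hsep'.2
  · have hpq : ((⟨m, by omega⟩ : Fin (m + n)) : ℕ) = (⟨m - 1, by omega⟩ : Fin (m + n)).val + 1 := by
      simp; omega
    obtain ⟨D, hD, h1, h2, h3⟩ := hset ⟨m - 1, by omega⟩ ⟨m, by omega⟩ hpq
    have hrL := S.rd_one_lt hL hLd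
    obtain ⟨a, ha⟩ := S.dvd (rd 1)
    have hX1' : ((((simple m n).π ^ rd 1) i).val : ℤ) = m - 1 := by omega
    rw [hX1'] at ha
    obtain ⟨b, hb⟩ := hLd
    push_cast at ha hb
    have hXp : ∀ u, u < rd 1 → (((simple m n).π ^ u) i).val + 1 ≠ m := by
      intro u hu e
      obtain ⟨c, hc'⟩ := S.dvd u
      have e' : ((((simple m n).π ^ u) i).val : ℤ) = m - 1 := by omega
      rw [e'] at hc'
      push_cast at hc'
      have h4 := dvd_of_dvd_mul hc (a := (rd 1 - u : ℤ)) ⟨c - a, by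
        push_cast
        linear_combination hc' - ha⟩
      have h5 := eq_zero_of_dvd_of_lt h4 (by omega) (by omega)
      omega
    have hXq : ∀ u, u ≤ rd 1 → (((simple m n).π ^ u) i).val ≠ m := by
      intro u hu e
      obtain ⟨c, hc'⟩ := S.dvd u
      rw [e] at hc'
      push_cast at hc'
      have h4 := dvd_of_dvd_mul hc (a := (L - u + rd 1 : ℤ)) ⟨c - a + b, by
        push_cast
        linear_combination hc' - ha + hb⟩
      have h5 := eq_zero_of_dvd_of_lt h4 (by omega) (by omega)
      omega
    have hDmem : ∀ x : Fin (m + n), (∃ j < L, ((m + n : ℕ) : ℤ) ∣ (m - 1 : ℤ) + j * n - x) →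
        x ∈ D := by
      rintro x ⟨j, hj, hx⟩
      refine (hD x).2 ⟨j, hj, simple_π_pow_eq_iff.2 ?_⟩
      convert hx using 3
      simp only
      omega
    have hiD : i ∉ D := by
      rw [hD]
      rintro ⟨j, hj, e⟩
      rw [simple_π_pow_eq_iff] at e
      obtain ⟨c, hc'⟩ := e
      have e' : ((((⟨m - 1, by omega⟩ : Fin (m + n)) : ℕ) : ℤ)) = m - 1 := by
        simp only; omega
      rw [e'] at hc'
      push_cast at hc'
      have h4 := dvd_of_dvd_mul hc (a := (j + rd 1 : ℤ)) ⟨c - a, by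
        push_cast
        linear_combination hc' - ha⟩
      have h5 := eq_zero_of_dvd_of_lt h4 (by omega) (by omega)
      omega
    refine ⟨_, _, D, hpq, Or.inl ⟨rfl, fun e => him (congrArg Fin.val e), hE _ _ hpq rfl⟩, ?_, h1,
      h2, hiD, h3, fun k hkD hik hk => ?_⟩
    · simp; omega
    have hd1 : 1 ≤ k.val - i.val := by omega
    have hdN : i.val + (k.val - i.val) < N := by omega
    have hle := S.rd_le hd1 hdN
    have hsep' := S.sep _ hd1 hdN
    set R := rd (k.val - i.val) with hR
    have hvalk := hval k hik hk
    rw [← hR] at hvalk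
    have ei : ∀ s, s < rd 1 → ((swap (⟨m - 1, by omega⟩ : Fin (m + n)) ⟨m, by omega⟩ * (simple m n).π) ^ s) i =
        ((simple m n).π ^ s) i := by
      intro s hs
      refine swap_mul_pow_apply _ fun u hu hus => ⟨fun e => ?_, fun e => ?_⟩
      · refine hXp u (by omega) ?_
        rw [e]; simp only; omega
      · refine hXq u (by omega) ?_
        rw [e]
    have ek : ∀ s, (∀ u, 1 ≤ u → u ≤ s → (((simple m n).π ^ u) k).val + 1 ≠ m ∧
          (((simple m n).π ^ u) k).val ≠ m) →
        ((swap (⟨m - 1, by omega⟩ : Fin (m + n)) ⟨m, by omega⟩ * (simple m n).π) ^ s) k =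
        ((simple m n).π ^ s) k := by
      intro s hs
      refine swap_mul_pow_apply _ fun u hu hus => ⟨fun e => ?_, fun e => ?_⟩
      · refine (hs u hu hus).1 ?_
        rw [e]; simp only; omega
      · refine (hs u hu hus).2 ?_
        rw [e]
    have hki : ∀ s, 1 ≤ s → s ≤ R → ((simple m n).π ^ s) k ≠ i := by
      intro s h4 h5 e
      have h6 := S.ne _ hd1 hdN s h4 h5
      have h7 := hvalk s h5
      rw [e] at h7
      omega
    -- If the orbit of k meets the switched pair, it does so first at m - 1 and is sent to m; this
    -- turns its type to 0 while that of i is 1, so the pair is resolved at that moment. Otherwise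
    -- its orbit is unchanged.
    by_cases hhit : ∃ s, 1 ≤ s ∧ s ≤ R ∧ ((((simple m n).π ^ s) k).val + 1 = m ∨
      (((simple m n).π ^ s) k).val = m)
    · classical
      obtain ⟨hs1, hsR, hs⟩ := Nat.find_spec hhit
      have hmin : ∀ u, 1 ≤ u → u < Nat.find hhit → (((simple m n).π ^ u) k).val + 1 ≠ m ∧
          (((simple m n).π ^ u) k).val ≠ m := by
        intro u hu hus
        have := Nat.find_min hhit hus
        omega
      set s := Nat.find hhit
      clear_value s
      -- Being at m first means having been at m - 1 L steps before, either after the start, against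
      -- minimality, or not, and then k lies on the arc D.
      have hs' : (((simple m n).π ^ s) k).val + 1 = m := by
        refine hs.resolve_right fun e => ?_
        obtain ⟨c, hc'⟩ := S.dvd s
        have h4 := hvalk s hsR
        have h5 : ((((simple m n).π ^ s) i).val : ℤ) = m - (k - i) := by omega
        rw [h5] at hc'
        push_cast at hc'
        rcases Nat.lt_or_ge L s with hLs | hLs
        · obtain ⟨c', hc''⟩ := S.dvd (s - L)
          have h6 := hvalk (s - L) (by omega)
          have h7 := Fin.isLt (((simple m n).π ^ (s - L)) k)
          have h8 : ((((simple m n).π ^ (s - L)) i).val : ℤ) =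
            (((simple m n).π ^ (s - L)) k).val - (k - i) := by omega
          rw [h8] at hc''
          push_cast [Nat.cast_sub hLs.le] at hc''
          have h9 := eq_zero_of_dvd_of_lt (h := m + n)
            (a := (((((simple m n).π ^ (s - L)) k).val : ℤ) - (m - 1))) ⟨c' - c - b, by
              push_cast
              linear_combination hc'' - hc' - hb⟩ (by push_cast; omega) (by push_cast; omega)
          have := (hmin (s - L) (by omega) (by omega)).1
          omega
        · refine hkD (hDmem k ⟨L - s, by omega, c + b, ?_⟩)
          push_cast [Nat.cast_sub hLs]
          linear_combination hc' + hb
      have hsR' : s < R := by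
        refine hsR.lt_of_ne fun e => ?_
        have := hvalk s hsR
        rw [e] at this hs'
        omega
      have hks : ((swap (⟨m - 1, by omega⟩ : Fin (m + n)) ⟨m, by omega⟩ * (simple m n).π) ^ s) k =
          ⟨m, by omega⟩ := by
        obtain ⟨t, rfl⟩ : ∃ t, s = t + 1 := ⟨s - 1, by omega⟩
        rw [pow_succ', Perm.mul_apply, ek t fun u hu hut => hmin u hu (by omega), Perm.mul_apply,
          ← Perm.mul_apply _ ((simple m n).π ^ t), ← pow_succ',
          show ((simple m n).π ^ (t + 1)) k = ⟨m - 1, by omega⟩ from Fin.ext (by simp only; omega),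
          swap_apply_left]
      refine resolves_of_pow_eq (σ := (simple m n).π) hs1 hik (fun u h4 h5 => ?_)
        (fun u hu => ⟨(ei u (by omega)).symm, (ek u fun v h6 h7 => hmin v h6 (by omega)).symm⟩)
        (ei s (by omega)) (fun u hu => hvalk u (by omega))
        (fun u hu => S.iff _ hd1 hdN u (by omega)) ?_ ?_
      · rw [ei u (by omega)]
        refine ⟨hii _ hd1 hdN u h4 (by omega), ?_⟩
        rcases h5.lt_or_eq with h5 | rfl
        · rw [ek u fun v h6 h7 => hmin v h6 (by omega)]
          exact hki u h4 (by omega)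
        · rw [hks]
          exact fun e => him (congrArg Fin.val e).symm
      · have := hvalk s hsR
        omega
      · rw [hks]
    · push Not at hhit
      have ek' : ∀ s, s ≤ R →
          ((swap (⟨m - 1, by omega⟩ : Fin (m + n)) ⟨m, by omega⟩ * (simple m n).π) ^ s) k =
          ((simple m n).π ^ s) k := fun s hs => ek s fun u hu hus => hhit u hu (by omega)
      have hR1 := S.one_le _ hd1 hdN
      -- Strictness matters, since at time `rd 1` the orbit of i reaches m - 1 and is itself
      -- switched. In case of equality the second alternative puts the orbit of k into D.
      have hRr : R < rd 1 := by
        refine hle.lt_of_ne fun e => ?_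
        have h4 := hvalk R le_rfl
        have h5 := hhit R hR1 le_rfl
        rw [e] at h4
        obtain ⟨j, hj, c, hc'⟩ := hsep _ (by rw [e] at h5; omega) hdN e
        have h6 : ((simple m n).π ^ R) k ∈ D := by
          refine hDmem _ ⟨j, hj, c, ?_⟩
          rw [e]
          have : ((((simple m n).π ^ rd 1) k).val : ℤ) = m - 1 + (k - i) := by omega
          rw [this]
          push_cast [Nat.cast_sub hik.le] at hc' ⊢
          linear_combination hc'
        rw [← ek' R le_rfl, pow_apply_mem_iff h3] at h6
        exact hkD h6
      refine resolves_of_pow_eq (σ := (simple m n).π) hR1 hik (fun u h4 h5 => ?_)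
        (fun u hu => ⟨(ei u (by omega)).symm, (ek' u hu.le).symm⟩)
        (ei R hRr) (fun u hu => hvalk u hu.le) (S.iff _ hd1 hdN) hsep'.1 ?_
      · rw [ei u (by omega), ek' u h5]
        exact ⟨hii _ hd1 hdN u h4 h5, hki u h4 h5⟩
      · rw [ek' R le_rfl, hvalk R le_rfl]
        exact hsep'.2

end ResolvingSwitch


/-! ### Order reversal and the switch in the second summand -/

section Reversal

theorem Resolves.reverse {T T' : Type*} {S : ABS T} {S' : ABS T'} {σ : Perm T} {σ' : Perm T'}
    (e : T ≃ T') (hσ : ∀ x, σ' (e x) = e (σ x)) (hδ : ∀ x, S'.δ (e x) = 1 ↔ S.δ x = 0)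
    (hlt : ∀ x y, S'.lt (e x) (e y) ↔ S.lt y x) {c x y : T} {E : T → T → Prop}
    (h : Resolves S σ c x y E) :
    Resolves S' σ' (e c) (e y) (e x) fun a b => E (e.symm b) (e.symm a) := by
  have hpow : ∀ (s : ℕ) (x : T), (σ' ^ s) (e x) = e ((σ ^ s) x) := by
    intro s x
    induction s with
    | zero => simp
    | succ s ih => rw [pow_succ', Perm.mul_apply, ih, hσ, pow_succ', Perm.mul_apply]
  have hδ' : ∀ x y, S.δ x = S.δ y → S'.δ (e x) = S'.δ (e y) := by
    intro x y hxy
    have h1 := hδ x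
    have h2 := hδ y
    rw [hxy] at h1
    have h3 := S'.δ_eq_zero_or_one (e x)
    have h4 := S'.δ_eq_zero_or_one (e y)
    grind
  obtain ⟨r, hr, h1, h2, h3, h4, h5⟩ := h
  refine ⟨r, hr, fun s hs hsr => ?_, fun s hs hsr => ?_, ?_, ?_, ?_⟩
  · simp only [hpow, ne_eq, e.injective.eq_iff]
    exact (h1 s hs hsr).symm
  · rw [hpow, hpow, hlt]
    exact ⟨(hδ' _ _ (h2 s hs hsr).1).symm, (h2 s hs hsr).2⟩
  · rw [hpow, hδ]
    exact h4
  · rw [hpow]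
    refine (S'.δ_eq_zero_or_one _).resolve_right fun h6 => ?_
    rw [hδ, h3] at h6
    exact absurd h6 (by decide)
  · simpa only [hpow, e.symm_apply_apply] using h5

/-- The order reversal between the elements of `N_{m,n}` and of `N_{n,m}`. -/
def simpleRev (m n : ℕ) : Fin (m + n) ≃ Fin (n + m) where
  toFun x := ⟨m + n - 1 - x.val, by omega⟩
  invFun x := ⟨m + n - 1 - x.val, by omega⟩
  left_inv x := Fin.ext (by simp only; omega)
  right_inv x := Fin.ext (by simp only; omega)

variable {m n : ℕ}

theorem simpleRev_val (x : Fin (m + n)) : (simpleRev m n x).val = m + n - 1 - x.val := rfl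

theorem simpleRev_symm : (simpleRev m n).symm = simpleRev n m := by
  ext x
  change m + n - 1 - x.val = n + m - 1 - x.val
  omega

theorem π_simpleRev (x : Fin (m + n)) :
    (simple n m).π (simpleRev m n x) = simpleRev m n ((simple m n).π x) := by
  apply Fin.ext
  rw [simple_π_val, simpleRev_val, simpleRev_val, simple_π_val]
  split_ifs <;> omega

theorem δ_simpleRev (x : Fin (m + n)) :
    (simple n m).δ (simpleRev m n x) = 1 ↔ (simple m n).δ x = 0 := by
  rw [simple_δ_eq_one_iff, simple_δ_eq_zero_iff, simpleRev_val]
  omega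

theorem simpleRev_lt (x y : Fin (m + n)) :
    (simple n m).lt (simpleRev m n x) (simpleRev m n y) ↔ (simple m n).lt y x := by
  rw [simple_lt_iff, simple_lt_iff, simpleRev_val, simpleRev_val]
  omega

theorem swap_mul_π_simpleRev {p q : Fin (m + n)} (x : Fin (m + n)) :
    (swap (simpleRev m n q) (simpleRev m n p) * (simple n m).π) (simpleRev m n x) =
      simpleRev m n ((swap p q * (simple m n).π) x) := by
  rw [Perm.mul_apply, Perm.mul_apply, π_simpleRev, swap_comm]
  exact (simpleRev m n).injective.swap_apply _ _ _

/-- The reversal interchanges m and n and sends j < n to an element of index at least m, so this is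
the case N = m + n of `exists_resolving_switch`. -/
theorem exists_resolving_switch_down (hn : 2 ≤ n) (hmn : n < m) (hc : Nat.Coprime m n)
    {j : Fin (m + n)} (hj : j.val < n) {E : Fin (m + n) → Fin (m + n) → Prop}
    (hdown : ∀ l : Fin (m + n), l.val < j.val → Resolves (simple m n) (simple m n).π j l j E) :
    ∃ (p q : Fin (m + n)) (D : Set (Fin (m + n))), q.val = p.val + 1 ∧
      ((q.val = m ∧ j ≠ p ∧ E p q) ∨ (p = j ∧ q.val < m)) ∧ (p.val < n ↔ q.val < n) ∧
      q ∈ D ∧ p ∉ D ∧ j ∉ D ∧ (∀ x, (swap p q * (simple m n).π) x ∈ D ↔ x ∈ D) ∧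
      ∀ l, l ∉ D → l.val < j.val →
        Resolves (simple m n) (swap p q * (simple m n).π) j l j fun _ _ => True := by
  obtain ⟨q, p, D, h1, h2, h3, h4, h5, h6, h7, h8⟩ :=
    exists_resolving_switch (m := n) (n := m) (N := n + m) (i := simpleRev m n j)
      (E := fun a b => E ((simpleRev m n).symm b) ((simpleRev m n).symm a)) (by omega) hmn
      (by simpa using hc) (by rw [simpleRev_val]; omega) (by omega)
      (Or.inr ⟨rfl, by rw [simpleRev_val]; omega, hn⟩) fun k hk _ => by
        obtain ⟨l, rfl⟩ := (simpleRev m n).surjective k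
        rw [simpleRev_val, simpleRev_val] at hk
        exact (hdown l (by omega)).reverse _ π_simpleRev δ_simpleRev simpleRev_lt
  obtain ⟨p, rfl⟩ := (simpleRev m n).surjective p
  obtain ⟨q, rfl⟩ := (simpleRev m n).surjective q
  rw [simpleRev_val, simpleRev_val] at h1
  refine ⟨p, q, simpleRev m n ⁻¹' D, by omega, ?_, ?_, h4, h5, h6, fun x => ?_, fun l hl hlj => ?_⟩
  · rw [simpleRev_val, simpleRev_val, (simpleRev m n).injective.eq_iff] at h2
    simp only [symm_apply_apply, ne_eq, (simpleRev m n).injective.eq_iff] at h2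
    rcases h2 with ⟨h9, h10, h11⟩ | ⟨h9, h10⟩
    · exact Or.inl ⟨by omega, h10, h11⟩
    · exact Or.inr ⟨h9, by omega⟩
  · rw [simpleRev_val, simpleRev_val] at h3
    omega
  · rw [Set.mem_preimage, Set.mem_preimage, ← h7 (simpleRev m n x), swap_mul_π_simpleRev]
  · have h9 := h8 (simpleRev m n l) hl (by rw [simpleRev_val, simpleRev_val]; omega) (by omega)
    have h10 := h9.reverse (S' := simple m n) (simpleRev m n).symm
      (σ' := swap p q * (simple m n).π) ?_ ?_ ?_
    · simpa only [symm_apply_apply] using h10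
    · intro x
      obtain ⟨x, rfl⟩ := (simpleRev m n).surjective x
      rw [swap_mul_π_simpleRev, symm_apply_apply, symm_apply_apply]
    · rw [simpleRev_symm]
      exact δ_simpleRev
    · rw [simpleRev_symm]
      exact simpleRev_lt

end Reversal


/-! ### Recognizing simple sequences -/

section Rank

/-- A regular arrowed binary sequence in which the ones precede the zeros is that of a simple
`DM₁`. -/
theorem Regular.exists_iso_simple {T : Type*} [Finite T] {S : ABS T} (hS : S.Regular)
    (h : ∀ x y, S.δ x = 1 → S.δ y = 0 → S.lt x y) {m n : ℕ} (hm : S.count 1 = m)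
    (hn : S.count 0 = n) : Nonempty (S.Iso (simple m n)) := by
  let _ := S.ord
  let _ := Fintype.ofFinite T
  have hcard : Fintype.card T = m + n := by
    have := S.count_zero_add_count_one
    rw [Nat.card_eq_fintype_card] at this
    omega
  let φ : T ≃o Fin (m + n) := (Fintype.orderIsoFinOfCardEq T hcard).symm
  have hlt : ∀ x y, S.lt x y ↔ φ x < φ y := fun x y => φ.lt_iff_lt.symm
  have hA : (φ '' {x | S.δ x = 1}).ncard = m := by
    rw [Set.ncard_image_of_injective _ φ.injective]
    exact hm
  have hB : {t : Fin (m + n) | t.val < m}.ncard = m := ncard_lt_eq (Nat.le_add_right m n)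
  have hAB : φ '' {x | S.δ x = 1} = {t : Fin (m + n) | t.val < m} := by
    by_cases hsub : φ '' {x | S.δ x = 1} ⊆ {t : Fin (m + n) | t.val < m}
    · exact Set.eq_of_subset_of_ncard_le hsub (by omega) (Set.toFinite _)
    · refine (Set.eq_of_subset_of_ncard_le ?_ (by omega) (Set.toFinite _)).symm
      obtain ⟨_, ⟨x, hx, rfl⟩, hxm⟩ := Set.not_subset.1 hsub
      intro t ht
      obtain ⟨y, rfl⟩ := φ.surjective t
      refine ⟨y, (S.δ_eq_zero_or_one y).resolve_left fun hy => ?_, rfl⟩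
      have h1 := (hlt x y).1 (h x y hx hy)
      simp only [Set.mem_ofPred_eq] at ht hxm
      omega
  have hδ : ∀ x, (simple m n).δ (φ x) = S.δ x := by
    intro x
    have h1 : S.δ x = 1 ↔ (φ x).val < m := by
      rw [← Set.mem_ofPred_eq (p := fun t : Fin (m + n) => t.val < m), ← hAB]
      exact ⟨fun h2 => ⟨x, h2, rfl⟩, fun ⟨y, hy, e⟩ => φ.injective e ▸ hy⟩
    rcases S.δ_eq_zero_or_one x with h2 | h2
    · rw [h2, simple_δ_eq_zero_iff, ← not_lt, ← h1, h2]
      decide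
    · rw [h2, simple_δ_eq_one_iff, ← h1, h2]
  refine ⟨φ.toEquiv, fun s t => (hlt s t).symm, hδ, ?_⟩
  -- Regularity determines a bijection by the order and the types alone: the comparison of the two
  -- bijections is a strictly monotone self-map of a finite chain, hence the identity.
  have hmono : StrictMono fun t => φ (S.π (φ.symm ((simple m n).π.symm t))) := by
    intro a b hab
    obtain ⟨x, rfl⟩ := (simple m n).π.surjective a
    obtain ⟨y, rfl⟩ := (simple m n).π.surjective b
    obtain ⟨x, rfl⟩ := φ.surjective x
    obtain ⟨y, rfl⟩ := φ.surjective y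
    simp only [symm_apply_apply, OrderIso.symm_apply_apply]
    rw [← hlt]
    by_cases hxy : S.δ x = S.δ y
    · rw [← hS.lt_iff x y hxy, hlt]
      exact ((simple_regular m n).lt_iff _ _ (by rw [hδ, hδ, hxy])).2 hab
    · rcases S.δ_eq_zero_or_one x with hx | hx
      · exact hS.lt_of x y hx ((S.δ_eq_zero_or_one y).resolve_left fun hy => hxy (hx.trans hy.symm))
      · have hy := (S.δ_eq_zero_or_one y).resolve_right fun hy => hxy (hx.trans hy.symm)
        have := (simple_regular m n).lt_of (φ y) (φ x) (by rw [hδ, hy]) (by rw [hδ, hx])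
        rw [simple_lt_iff] at this
        omega
  have hid := hmono.eq_id
  intro t
  have := congrFun hid ((simple m n).π (φ t))
  simp only [symm_apply_apply, OrderIso.symm_apply_apply, id] at this
  exact this.symm

/-- The restriction of the order and of `δ` to a set which is invariant under the permutation
`σ`. -/
def restrict {T : Type*} (S : ABS T) (σ : Perm T) (C : Set T) (hC : ∀ x, σ x ∈ C ↔ x ∈ C) :
    ABS C where
  ord := letI := S.ord; inferInstance
  δ x := S.δ x
  π := σ.subtypePerm hC

variable {T : Type*} {S : ABS T} {σ : Perm T} {C : Set T} {hC : ∀ x, σ x ∈ C ↔ x ∈ C}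

theorem restrict_lt {x y : C} : (S.restrict σ C hC).lt x y ↔ S.lt x y := Iff.rfl

theorem restrict_δ {x : C} : (S.restrict σ C hC).δ x = S.δ x := rfl

theorem restrict_π {x : C} : ((S.restrict σ C hC).π x : T) = σ x := rfl

theorem count_restrict_add [Finite T] (hC' : ∀ x, σ x ∈ Cᶜ ↔ x ∈ Cᶜ) (v : Fin 2) :
    (S.restrict σ C hC).count v + (S.restrict σ Cᶜ hC').count v = S.count v := by
  have h1 : ∀ (D : Set T) (hD : ∀ x, σ x ∈ D ↔ x ∈ D), (S.restrict σ D hD).count v =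
      {x | x ∈ D ∧ S.δ x = v}.ncard := by
    intro D hD
    rw [count, ← Set.ncard_image_of_injective _ Subtype.val_injective]
    congr 1
    ext x
    simp [restrict_δ, and_comm]
  rw [h1, h1, eq_comm]
  refine ncard_add_of_iff (fun x => ?_) fun x h2 h3 => h3.1 h2.1
  by_cases hx : x ∈ C <;> simp [hx]

end Rank

/-! ### The two cycles after a switch of neighbours -/

section SwitchedOrbit

variable {m n : ℕ} {p q : Fin (m + n)} {C : Set (Fin (m + n))}
  {hC : ∀ x, (swap p q * (simple m n).π) x ∈ C ↔ x ∈ C}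

/-- Nothing lies between p and q, so on a set that misses one of them the swap does not change any
comparison. -/
theorem restrict_swap_regular (hpq : q.val = p.val + 1) (hex : p ∉ C ∨ q ∉ C) :
    ((simple m n).restrict _ C hC).Regular := by
  have hlt : ∀ x y : C, (simple m n).lt ((swap p q * (simple m n).π) x)
      ((swap p q * (simple m n).π) y) ↔ (simple m n).lt ((simple m n).π x) ((simple m n).π y) := by
    intro x y
    have hx := (hC x).2 x.2
    have hy := (hC y).2 y.2
    simp only [Perm.mul_apply] at hx hy ⊢
    generalize (simple m n).π x = a at *
    generalize (simple m n).π y = b at *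
    rw [simple_lt_iff, simple_lt_iff]
    simp only [swap_apply_def] at *
    split_ifs at hx hy ⊢ <;> simp_all <;> grind
  constructor
  · intro x y hxy
    rw [restrict_lt, restrict_lt, restrict_π, restrict_π, hlt]
    exact (simple_regular m n).lt_iff _ _ hxy
  · intro x y hx hy
    rw [restrict_lt, restrict_π, restrict_π, hlt]
    exact (simple_regular m n).lt_of _ _ hx hy

theorem exists_restrict_iso (hpq : q.val = p.val + 1) (hex : p ∉ C ∨ q ∉ C) {f g : ℕ}
    (hf : ((simple m n).restrict _ C hC).count 1 = f)
    (hg : ((simple m n).restrict _ C hC).count 0 = g) :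
    Nonempty (((simple m n).restrict _ C hC).Iso (simple f g)) := by
  refine (restrict_swap_regular hpq hex).exists_iso_simple (fun x y hx hy => ?_) hf hg
  rw [restrict_δ, simple_δ_eq_one_iff] at hx
  rw [restrict_δ, simple_δ_eq_zero_iff] at hy
  rw [restrict_lt, simple_lt_iff]
  omega

/-- The bijection moves each one up by n and each zero down by m. -/
theorem sum_switch (C : Set (Fin (m + n))) [Fintype C]
    (hC : ∀ x, (swap p q * (simple m n).π) x ∈ C ↔ x ∈ C) :
    ∑ x : C, ((((simple m n).π x : Fin (m + n)) : ℕ) - (x.1 : ℕ) : ℤ) =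
      n * ((simple m n).restrict _ C hC).count 1 - m * ((simple m n).restrict _ C hC).count 0 := by
  classical
  have h1 : ∀ v, (((simple m n).restrict _ C hC).count v : ℤ) =
      ∑ x : C, if (simple m n).δ x = v then 1 else 0 := by
    intro v
    rw [count, Set.ncard_eq_toFinset_card', Set.toFinset_ofPred, Finset.card_filter]
    push_cast
    rfl
  rw [h1, h1, Finset.mul_sum, Finset.mul_sum, ← Finset.sum_sub_distrib]
  refine Finset.sum_congr rfl fun x _ => ?_
  simp only [simple_π_val, simple_δ_eq_one_iff, simple_δ_eq_zero_iff]
  split_ifs <;> omega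

/-- Reindexing by y = `swap p q` (π x), which permutes C, turns π x into `swap p q` y. -/
theorem sum_switch_eq (C : Set (Fin (m + n))) [Fintype C]
    (hC : ∀ x, (swap p q * (simple m n).π) x ∈ C ↔ x ∈ C) :
    ∑ x : C, ((((simple m n).π x : Fin (m + n)) : ℕ) - (x.1 : ℕ) : ℤ) =
      ∑ x : C, (((swap p q x : Fin (m + n)) : ℕ) - (x.1 : ℕ) : ℤ) := by
  rw [Finset.sum_sub_distrib, Finset.sum_sub_distrib]
  congr 1
  refine Fintype.sum_equiv ((swap p q * (simple m n).π).subtypePerm hC) _ _ fun x => ?_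
  simp [Perm.subtypePerm_apply]

/-- Only p contributes to the sum of displacements of the swap, and it moves up by 1. -/
theorem count_switch_of_left (hpq : q.val = p.val + 1) (hp : p ∈ C) (hq : q ∉ C) :
    ((simple m n).restrict _ C hC).count 1 * n = ((simple m n).restrict _ C hC).count 0 * m + 1 := by
  classical
  have h1 := (sum_switch C hC).symm.trans (sum_switch_eq C hC)
  rw [Fintype.sum_eq_single ⟨p, hp⟩] at h1
  · simp only [swap_apply_left, hpq] at h1
    push_cast at h1
    zify
    linarith
  · intro x hx
    rw [swap_apply_of_ne_of_ne, sub_self]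
    · exact fun e => hx (Subtype.ext e)
    · exact fun e => hq (e ▸ x.2)

theorem count_switch_of_right (hpq : q.val = p.val + 1) (hp : p ∉ C) (hq : q ∈ C) :
    ((simple m n).restrict _ C hC).count 0 * m = ((simple m n).restrict _ C hC).count 1 * n + 1 := by
  classical
  have h1 := (sum_switch C hC).symm.trans (sum_switch_eq C hC)
  rw [Fintype.sum_eq_single ⟨q, hq⟩] at h1
  · simp only [swap_apply_right, hpq] at h1
    push_cast at h1
    zify
    linarith
  · intro x hx
    rw [swap_apply_of_ne_of_ne, sub_self]
    · exact fun e => hp (e ▸ x.2)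
    · exact fun e => hx (Subtype.ext e)

/-- This is why ρ depends only on ξ: whichever neighbours are switched, the numbers of ones and
zeros of the split-off cycle solve the same equation within the same bounds. -/
theorem bezout_unique {m n f g f' g' : ℕ} (hc : Nat.Coprime m n) (hf : f ≤ m) (hf' : f' ≤ m)
    (h : f * n = g * m + 1) (h' : f' * n = g' * m + 1) : f = f' ∧ g = g' := by
  have hm : 0 < m := by
    rw [Nat.pos_iff_ne_zero]
    rintro rfl
    rw [Nat.le_zero.1 hf] at h
    omega
  have hf0 : 0 < f := Nat.pos_of_ne_zero fun e => by rw [e] at h; omega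
  have hf0' : 0 < f' := Nat.pos_of_ne_zero fun e => by rw [e] at h'; omega
  have h1 := dvd_of_dvd_mul (n := n) (h := m) hc.symm (a := (f - f' : ℤ)) ⟨g - g', by
    zify at h h'
    linear_combination h - h'⟩
  have h2 := eq_zero_of_dvd_of_lt h1 (by omega) (by omega)
  obtain rfl : f = f' := by omega
  refine ⟨rfl, Nat.eq_of_mul_eq_mul_right hm ?_⟩
  omega

theorem exists_bezout {m n : ℕ} (hc : Nat.Coprime m n) (hm : 0 < m) (hn : 0 < n) :
    ∃ f g, f ≤ m ∧ g ≤ n ∧ f * n = g * m + 1 := by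
  obtain ⟨f, hf, hfm⟩ := exists_pos_mul_modEq (n := n) (h := m) hm hc.symm 1
  have h1 : f % m * n ≡ 1 [MOD m] := ((Nat.mod_modEq f m).mul_right n).trans hfm
  have h2 : f % m < m := Nat.mod_lt _ hm
  generalize f % m = f at *
  rcases Nat.eq_zero_or_pos f with rfl | hf
  · rw [zero_mul] at h1
    have : m = 1 := Nat.dvd_one.1 ((Nat.modEq_iff_dvd' zero_le_one).1 h1)
    -- The residue 0 occurs only for m = 1, where f = m must be taken instead.
    exact ⟨1, n - 1, by omega, by omega, by subst this; omega⟩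
  · have h3 : 1 ≤ f * n := Nat.mul_pos hf hn
    obtain ⟨g, hg⟩ := (Nat.modEq_iff_dvd' h3).1 h1.symm
    refine ⟨f, g, h2.le, ?_, by rw [mul_comm g]; omega⟩
    by_contra hgn
    have h4 : m * n < m * g := Nat.mul_lt_mul_of_pos_left (by omega) hm
    have h5 : f * n ≤ m * n := Nat.mul_le_mul_right _ h2.le
    omega

end SwitchedOrbit

end ABS

/-! ### From sequences to modules, and the second exchange -/

section DieudonneModules

variable (p : ℕ) [Fact p.Prime] (K : Type*) [Field K] [CharP K p] [PerfectRing K p]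

namespace ABS

/-- An isomorphism from an arrowed binary sequence to a direct sum induces an isomorphism of the
corresponding `DM₁`'s. -/
noncomputable def Iso.dm1 {T α β : Type*} [Finite T] [Finite α] [Finite β] {S : ABS T} {A : ABS α}
    {B : ABS β} (e : S.Iso (A.sum B)) : (S.dm1 p K).Iso ((A.dm1 p K).prod (B.dm1 p K)) where
  toEquiv := (LinearEquiv.funCongrLeft K K e.toEquiv.symm).trans
    (LinearEquiv.sumArrowLequivProdArrow α β K K)
  map_F x := by
    have hs : ∀ t, S.π.symm (e.toEquiv.symm t) = e.toEquiv.symm ((A.sum B).π.symm t) := by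
      intro t
      rw [Equiv.symm_apply_eq, ← e.toEquiv.symm_apply_apply (S.π _), ← e.map_π,
        Equiv.apply_symm_apply, Equiv.apply_symm_apply]
    have hδ : ∀ t, S.δ (e.toEquiv.symm t) = (A.sum B).δ t := by
      intro t
      rw [← e.map_δ, Equiv.apply_symm_apply]
    refine Prod.ext (funext fun a => ?_) (funext fun b => ?_)
    · have h1 := hs (Sum.inl a)
      have h2 := hδ ((A.sum B).π.symm (Sum.inl a))
      change (if _ then _ else _) = (if S.δ (S.π.symm (e.toEquiv.symm (Sum.inl a))) = 0 then
        frobenius K p (x (S.π.symm (e.toEquiv.symm (Sum.inl a)))) else 0)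
      rw [h1, h2]
      rfl
    · have h1 := hs (Sum.inr b)
      have h2 := hδ ((A.sum B).π.symm (Sum.inr b))
      change (if _ then _ else _) = (if S.δ (S.π.symm (e.toEquiv.symm (Sum.inr b))) = 0 then
        frobenius K p (x (S.π.symm (e.toEquiv.symm (Sum.inr b)))) else 0)
      rw [h1, h2]
      rfl
  map_V x := by
    have hs : ∀ t, S.π (e.toEquiv.symm t) = e.toEquiv.symm ((A.sum B).π t) := by
      intro t
      rw [← e.toEquiv.symm_apply_apply (S.π _), ← e.map_π, Equiv.apply_symm_apply]
    have hδ : ∀ t, S.δ (e.toEquiv.symm t) = (A.sum B).δ t := by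
      intro t
      rw [← e.map_δ, Equiv.apply_symm_apply]
    refine Prod.ext (funext fun a => ?_) (funext fun b => ?_)
    · have h1 := hs (Sum.inl a)
      have h2 := hδ (Sum.inl a)
      change (if _ then _ else _) = (if S.δ (e.toEquiv.symm (Sum.inl a)) = 1 then
        (frobeniusEquiv K p).symm (x (S.π (e.toEquiv.symm (Sum.inl a)))) else 0)
      rw [h1, h2]
      rfl
    · have h1 := hs (Sum.inr b)
      have h2 := hδ (Sum.inr b)
      change (if _ then _ else _) = (if S.δ (e.toEquiv.symm (Sum.inr b)) = 1 then
        (frobeniusEquiv K p).symm (x (S.π (e.toEquiv.symm (Sum.inr b)))) else 0)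
      rw [h1, h2]
      rfl

open Equiv

theorem count_sum {α β : Type*} [Finite α] [Finite β] (A : ABS α) (B : ABS β) (v : Fin 2) :
    (A.sum B).count v = A.count v + B.count v := by
  have h1 : A.count v = (Sum.inl '' {a | A.δ a = v} : Set (α ⊕ β)).ncard :=
    (Set.ncard_image_of_injective _ Sum.inl_injective).symm
  have h2 : B.count v = (Sum.inr '' {a | B.δ a = v} : Set (α ⊕ β)).ncard :=
    (Set.ncard_image_of_injective _ Sum.inr_injective).symm
  rw [h1, h2]
  refine ncard_add_of_iff (fun x => ?_) ?_
  · rcases x with x | x <;> simp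
  · rintro _ ⟨a, -, rfl⟩ ⟨b, -, h⟩
    exact absurd h (by simp)

/-- The sequence Ψ ⊕ S_ρ, transported along e, is regular and has the required bijection, hence is
the result of the exchange. Since any exchange lowers the length by at least 1, goodness needs only
`hlen`. -/
theorem exists_second_exchange_of_equiv {m₁ n₁ m₂ n₂ m₁' n₁' m₂' n₂' f g : ℕ} (h₁ : m₁ < n₁) (h₂ : n₂ < m₂)
    (hξ' : IsTwoSegment m₁' n₁' m₂' n₂') (hρ : Nat.Coprime f g)
    {i : Fin (m₁ + n₁)} {j : Fin (m₂ + n₂)} {Sm : ABS (Elt m₁ n₁ m₂ n₂)}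
    (hSm : (minimalABS m₁ n₁ m₂ n₂).IsGoodExchange (Sum.inl i) (Sum.inr j) Sm)
    {i' : Fin (m₁' + n₁')} {j' : Fin (m₂' + n₂')} {Ψ : ABS (Elt m₁' n₁' m₂' n₂')}
    (hΨ : (minimalABS m₁' n₁' m₂' n₂').IsGoodExchange (Sum.inl i') (Sum.inr j') Ψ)
    {s t : Elt m₁ n₁ m₂ n₂} (hs : (minimalABS m₁ n₁ m₂ n₂).δ s = 0)
    (ht : (minimalABS m₁ n₁ m₂ n₂).δ t = 1) (hst : Sm.lt s t)
    (e : Elt m₁ n₁ m₂ n₂ ≃ Elt m₁' n₁' m₂' n₂' ⊕ Fin (f + g))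
    (heδ : ∀ x, ((minimalABS m₁' n₁' m₂' n₂').sum (simple f g)).δ (e x) =
      (minimalABS m₁ n₁ m₂ n₂).δ x)
    (heπ : ∀ x, swap (Sum.inl (Sum.inl i')) (Sum.inl (Sum.inr j'))
        (((minimalABS m₁' n₁' m₂' n₂').sum (simple f g)).π (e x)) =
      e (swap s t (swap (Sum.inl i) (Sum.inr j) ((minimalABS m₁ n₁ m₂ n₂).π x))))
    (hlen : (n₁ * m₂ - m₁ * n₂ : ℤ) ≤
      n₁' * m₂' - m₁' * n₂' + |((n₁' + n₂') * f - (m₁' + m₂') * g : ℤ)| + 1) :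
    ∃ Smm, Sm.IsGoodExchange s t Smm ∧ SplitsAs p K Smm m₁' n₁' m₂' n₂' f g := by
  have hΨr := hΨ.1.regular
  have hr : (Ψ.sum (simple f g)).Regular := hΨr.sum (simple_regular f g)
  have hex : Sm.IsExchange s t ((Ψ.sum (simple f g)).transport e) := by
    refine isExchange_of_π_eq (by rw [hSm.1.δ_eq, hs]) (by rw [hSm.1.δ_eq, ht]) hst ?_ ?_
      ((transportIso e _).regular hr)
    · funext x
      rw [hSm.1.δ_eq, ← heδ]
      change (Ψ.sum (simple f g)).δ (e x) = _
      rcases e x with y | y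
      · rw [sum_δ_inl, sum_δ_inl, hΨ.1.δ_eq]
      · rw [sum_δ_inr, sum_δ_inr]
    · ext1 x
      change e.symm ((Ψ.sum (simple f g)).π (e x)) = _
      rw [symm_apply_eq, hSm.1.π_eq, Perm.mul_apply, Perm.mul_apply, ← heπ]
      rcases e x with y | y
      · rw [sum_π_inl, sum_π_inl, hΨ.1.π_eq, Perm.mul_apply, Sum.inl_injective.swap_apply]
      · rw [sum_π_inr, sum_π_inr, swap_apply_of_ne_of_ne (by simp) (by simp)]
  refine ⟨_, ⟨hex, le_antisymm (hex.length_lt hSm.1.regular) ?_⟩, hξ', hρ, Ψ, ⟨_, _, hΨ⟩,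
    ⟨transportIso e _⟩, ⟨(transportIso e _).dm1 p K⟩⟩
  obtain ⟨-, -, h₂', h₁'⟩ := isTwoSegment_iff.1 hξ'
  have hl := (transportIso e (Ψ.sum (simple f g))).length_eq
  rw [length_sum hΨr (simple_regular f g), length_simple] at hl
  have hcr := cross_add Ψ (simple f g)
  have hcount : ∀ v, Ψ.count v = (minimalABS m₁' n₁' m₂' n₂').count v := fun v => by
    rw [count, count, hΨ.1.δ_eq]
  rw [hcount, hcount, minimalABS, count_sum, count_sum, count_one_simple, count_one_simple,
    count_one_simple, count_zero_simple, count_zero_simple, count_zero_simple] at hcr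
  have hl₁ := length_minimal (m₁ := m₁) (n₁ := n₁) (m₂ := m₂) (n₂ := n₂) h₁ h₂
  have hl₂ := length_minimal (m₁ := m₁') (n₁ := n₁') (m₂ := m₂') (n₂ := n₂') h₁' h₂'
  have hg₁ := hSm.2
  have hg₂ := hΨ.2
  zify at hl hcr hl₁ hl₂ hg₁ hg₂ ⊢
  -- `cross_add` gives the difference of the two cross terms; their sum is at least its absolute
  -- value.
  have habs : |((n₁' + n₂') * f - (m₁' + m₂') * g : ℤ)| ≤
      Ψ.cross (simple f g) + (simple f g).cross Ψ := by
    rw [abs_le]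
    constructor <;> linarith
  linarith

theorem exists_second_exchange {m₁ n₁ m₂ n₂ m₁' n₁' m₂' n₂' f g : ℕ} (h₁ : m₁ < n₁) (h₂ : n₂ < m₂)
    (hξ' : IsTwoSegment m₁' n₁' m₂' n₂') (hρ : Nat.Coprime f g)
    {i : Fin (m₁ + n₁)} {j : Fin (m₂ + n₂)} {Sm : ABS (Elt m₁ n₁ m₂ n₂)}
    (hSm : (minimalABS m₁ n₁ m₂ n₂).IsGoodExchange (Sum.inl i) (Sum.inr j) Sm)
    {i' : Fin (m₁' + n₁')} {j' : Fin (m₂' + n₂')} {Ψ : ABS (Elt m₁' n₁' m₂' n₂')}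
    (hΨ : (minimalABS m₁' n₁' m₂' n₂').IsGoodExchange (Sum.inl i') (Sum.inr j') Ψ)
    {s t : Elt m₁ n₁ m₂ n₂} (hs : (minimalABS m₁ n₁ m₂ n₂).δ s = 0)
    (ht : (minimalABS m₁ n₁ m₂ n₂).δ t = 1) (hst : Sm.lt s t)
    {τ : Perm (Elt m₁ n₁ m₂ n₂)}
    (hτ : swap s t * swap (Sum.inl i) (Sum.inr j) = swap (Sum.inl i) (Sum.inr j) * τ)
    (e : Elt m₁ n₁ m₂ n₂ ≃ Elt m₁' n₁' m₂' n₂' ⊕ Fin (f + g))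
    (hei : e (Sum.inl i) = Sum.inl (Sum.inl i')) (hej : e (Sum.inr j) = Sum.inl (Sum.inr j'))
    (heδ : ∀ x, ((minimalABS m₁' n₁' m₂' n₂').sum (simple f g)).δ (e x) =
      (minimalABS m₁ n₁ m₂ n₂).δ x)
    (heπ : ∀ x, ((minimalABS m₁' n₁' m₂' n₂').sum (simple f g)).π (e x) =
      e ((τ * (minimalABS m₁ n₁ m₂ n₂).π) x))
    (hlen : (n₁ * m₂ - m₁ * n₂ : ℤ) ≤
      n₁' * m₂' - m₁' * n₂' + |((n₁' + n₂') * f - (m₁' + m₂') * g : ℤ)| + 1) :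
    ∃ Smm, Sm.IsGoodExchange s t Smm ∧ SplitsAs p K Smm m₁' n₁' m₂' n₂' f g := by
  refine exists_second_exchange_of_equiv p K h₁ h₂ hξ' hρ hSm hΨ hs ht hst e heδ (fun x => ?_) hlen
  rw [← Perm.mul_apply (swap s t), hτ, Perm.mul_apply, ← e.injective.swap_apply, hei, hej, heπ,
    Perm.mul_apply]

end ABS

end DieudonneModules

namespace ABS

open Equiv

/-! ### Splitting a summand along a switch -/

section Splitting

theorem Resolves.comap {T T' : Type*} {S : ABS T} {S' : ABS T'} {σ : Perm T} {σ' : Perm T'}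
    {η : T' → T} (hη : Function.Injective η) (hσ : ∀ x, σ (η x) = η (σ' x))
    (hδ : ∀ x, S.δ (η x) = S'.δ x) (hlt : ∀ x y, S'.lt x y ↔ S.lt (η x) (η y)) {c x y : T'}
    (h : Resolves S σ (η c) (η x) (η y) fun _ _ => True) :
    Resolves S' σ' c x y fun _ _ => True := by
  have hpow : ∀ (s : ℕ) (x : T'), (σ ^ s) (η x) = η ((σ' ^ s) x) := by
    intro s x
    induction s with
    | zero => simp
    | succ s ih => rw [pow_succ', Perm.mul_apply, ih, hσ, pow_succ', Perm.mul_apply]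
  obtain ⟨r, hr, h1, h2, h3, h4, -⟩ := h
  simp only [hpow, hδ, ← hlt, ne_eq, hη.eq_iff] at h1 h2 h3 h4
  exact ⟨r, hr, h1, h2, h3, h4, trivial⟩

theorem simple_val_π_lt_iff {m n : ℕ} (x : Fin (m + n)) :
    ((simple m n).π x).val < n ↔ (simple m n).δ x = 0 := by
  rw [simple_π_val, simple_δ_eq_zero_iff]
  have := x.isLt
  split_ifs <;> omega

variable {m n : ℕ} {p q : Fin (m + n)} {D : Set (Fin (m + n))}

/-- Each of the two invariant sets is a simple sequence. The last clause holds because lying below n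
is the type of the predecessor, and the swap does not move elements across n. -/
theorem exists_split (hpq : q.val = p.val + 1) (hpqn : p.val < n ↔ q.val < n)
    (hD : ∀ x, (swap p q * (simple m n).π) x ∈ D ↔ x ∈ D)
    (hex : p ∈ D ∧ q ∉ D ∨ q ∈ D ∧ p ∉ D) {f g : ℕ}
    (hf : ((simple m n).restrict _ D hD).count 1 = f)
    (hg : ((simple m n).restrict _ D hD).count 0 = g) :
    ∃ ε : Fin (m + n) ≃ Fin (m - f + (n - g)) ⊕ Fin (f + g),
      (∀ x, ((simple (m - f) (n - g)).sum (simple f g)).δ (ε x) = (simple m n).δ x) ∧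
      (∀ x, ((simple (m - f) (n - g)).sum (simple f g)).π (ε x) =
        ε ((swap p q * (simple m n).π) x)) ∧
      (∀ x, x ∉ D → ∃ y, ε x = Sum.inl y) ∧ (∀ y, ε.symm (Sum.inl y) ∉ D) ∧
      (∀ x y, (simple (m - f) (n - g)).lt x y ↔
        (simple m n).lt (ε.symm (Sum.inl x)) (ε.symm (Sum.inl y))) ∧
      ∀ y, y.val < n - g ↔ (ε.symm (Sum.inl y)).val < n := by
  classical
  have hD' : ∀ x, (swap p q * (simple m n).π) x ∈ Dᶜ ↔ x ∈ Dᶜ := fun x => (hD x).not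
  have h1 := count_restrict_add (S := (simple m n)) (hC := hD) hD' 1
  have h0 := count_restrict_add (S := (simple m n)) (hC := hD) hD' 0
  rw [hf, count_one_simple] at h1
  rw [hg, count_zero_simple] at h0
  obtain ⟨ψ⟩ := exists_restrict_iso (hC := hD) hpq (by tauto) hf hg
  obtain ⟨φ⟩ := exists_restrict_iso (hC := hD') hpq
    (by rw [Set.mem_compl_iff, Set.mem_compl_iff]; tauto)
    (show _ = m - f by omega) (show _ = n - g by omega)
  set ε : Fin (m + n) ≃ Fin (m - f + (n - g)) ⊕ Fin (f + g) := (Equiv.Set.sumCompl D).symm.trans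
    ((sumCongr ψ.toEquiv φ.toEquiv).trans (sumComm _ _)) with hε
  have hin : ∀ x : D, ε x = Sum.inr (ψ.toEquiv x) := fun x => by simp [hε]
  have hout : ∀ x : (Dᶜ : Set _), ε x = Sum.inl (φ.toEquiv x) := fun x => by
    have : (Equiv.Set.sumCompl D).symm x = Sum.inr x := by
      rw [symm_apply_eq]; rfl
    simp [hε, this]
  have hsymm : ∀ y, ε.symm (Sum.inl y) = (φ.toEquiv.symm y : (Dᶜ : Set _)) := fun y => by
    rw [symm_apply_eq, hout, apply_symm_apply]
  have hδ : ∀ x, ((simple (m - f) (n - g)).sum (simple f g)).δ (ε x) = (simple m n).δ x := by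
    intro x
    by_cases hx : x ∈ D
    · rw [hin ⟨x, hx⟩, sum_δ_inr, ψ.map_δ, restrict_δ]
    · rw [hout ⟨x, hx⟩, sum_δ_inl, φ.map_δ, restrict_δ]
  have hπ : ∀ x, ((simple (m - f) (n - g)).sum (simple f g)).π (ε x) =
        ε ((swap p q * (simple m n).π) x) := by
    intro x
    by_cases hx : x ∈ D
    · rw [hin ⟨x, hx⟩, sum_π_inr, ψ.map_π, ← hin, restrict_π]
    · rw [hout ⟨x, hx⟩, sum_π_inl, φ.map_π, ← hout, restrict_π]
  refine ⟨ε, hδ, hπ, fun x hx => ⟨_, hout ⟨x, hx⟩⟩, fun y => ?_, fun x y => ?_, fun y => ?_⟩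
  · rw [hsymm]
    exact (φ.toEquiv.symm y).2
  · rw [hsymm, hsymm, ← restrict_lt (hC := hD'), ← φ.map_lt, apply_symm_apply, apply_symm_apply]
  · obtain ⟨y, rfl⟩ := (simple (m - f) (n - g)).π.surjective y
    obtain ⟨x, hx⟩ := ε.surjective (Sum.inl y)
    have h2 := hπ x
    rw [hx, sum_π_inl] at h2
    rw [simple_val_π_lt_iff, h2, symm_apply_apply, ← sum_δ_inl (B := simple f g), ← hx, hδ,
      ← simple_val_π_lt_iff, Perm.mul_apply, swap_apply_def]
    split_ifs with h3 h4
    · rw [h3, hpqn]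
    · rw [h4, hpqn]
    · rfl

end Splitting

section Bezout

variable {m n f g : ℕ}

theorem coprime_of_bezout (h : f * n = g * m + 1) : Nat.Coprime f g := by
  rw [← Nat.isCoprime_iff_coprime]
  exact ⟨n, -m, by zify at h; linear_combination h⟩

theorem coprime_sub_of_bezout (hf : f ≤ m) (hg : g ≤ n) (h : f * n = g * m + 1) :
    Nat.Coprime (m - f) (n - g) := by
  rw [← Nat.isCoprime_iff_coprime]
  refine ⟨-g, f, ?_⟩
  push_cast [Nat.cast_sub hf, Nat.cast_sub hg]
  zify at h
  linear_combination h

/-- With m = f + a and n = g + b the equation reads f b = g a + 1. If b ≤ a, this forces g < f, and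
then n < m. -/
theorem sub_lt_sub_of_bezout (hmn : m < n) (hf : f ≤ m) (hg : g ≤ n) (h : f * n = g * m + 1) :
    m - f < n - g := by
  by_contra hlt
  obtain ⟨a, rfl⟩ := Nat.exists_eq_add_of_le hf
  obtain ⟨b, rfl⟩ := Nat.exists_eq_add_of_le hg
  have h1 : f * b ≤ f * a := Nat.mul_le_mul_left _ (by omega)
  have h2 : f * b = g * a + 1 := by linarith
  have h3 : g < f := by
    by_contra h3
    have := Nat.mul_le_mul_right a (not_lt.1 h3)
    omega
  omega

end Bezout

/-! ### Exchanges (a) and (b) -/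

section FirstSummand

/-- The rearrangement `(α ⊔ β) ⊔ γ ≃ (α ⊔ γ) ⊔ β`. -/
def sumRightComm (α β γ : Type*) : (α ⊕ β) ⊕ γ ≃ (α ⊕ γ) ⊕ β :=
  (sumAssoc α β γ).trans ((sumCongr (Equiv.refl α) (sumComm β γ)).trans (sumAssoc α γ β).symm)

/-- Otherwise the pair would be an inversion of types (0, 1), which a good exchange does not have.
It serves to show that the second exchange is possible in S⁻. -/
theorem lt_of_swap_lt {T : Type*} [DecidableEq T] [Finite T] {S S' : ABS T} {t t' : T}
    (hS : S.Regular) (h : S.IsGoodExchange t t' S') {x y : T} (hx : S.δ x = 0) (hy : S.δ y = 1)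
    (hlt : S.lt (swap t t' x) (swap t t' y)) : S'.lt x y := by
  rcases S'.lt_trichotomy x y with h1 | rfl | h1
  · exact h1
  · rw [hx] at hy; exact absurd hy (by decide)
  · have := ((h.1.length_add_one_iff hS).1 h.2).2 x y ⟨hlt, h1⟩
    rw [hx, hy] at this
    exact absurd this (by decide)

variable (p : ℕ) [Fact p.Prime] (K : Type*) [Field K] [CharP K p] [PerfectRing K p]
  {m₁ n₁ m₂ n₂ : ℕ} {i : Fin (m₁ + n₁)} {j : Fin (m₂ + n₂)} {Sm : ABS (Elt m₁ n₁ m₂ n₂)}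

theorem second_exchange_fst (hξ : IsTwoSegment m₁ n₁ m₂ n₂) (hm : 0 < m₁)
    (hmn : m₁ + 1 < n₁) {f g : ℕ} (hf : f ≤ m₁) (hg : g ≤ n₁) (hfg : f * n₁ = g * m₁ + 1)
    (hi : m₁ ≤ i.val) (hi' : i.val < n₁) (hj : j.val < n₂)
    (hSm : (minimalABS m₁ n₁ m₂ n₂).IsGoodExchange (Sum.inl i) (Sum.inr j) Sm) :
    SecondExchange p K Sm (Sum.inl (m₁ + 1)) (Sum.inl m₁) (m₁ - f) (n₁ - g) m₂ n₂ f g ∨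
      SecondExchange p K Sm (Sum.inl i.val) (Sum.inr (j.val + 1)) (m₁ - f) (n₁ - g) m₂ n₂ f g := by
  obtain ⟨hc₁, hc₂, h₂, h₁⟩ := isTwoSegment_iff.1 hξ
  have hS := minimal_regular m₁ n₁ m₂ n₂
  obtain ⟨hw, hb⟩ := (hSm.1.length_add_one_iff hS).1 hSm.2
  obtain ⟨a, b, D, hab, hcase, habn, haD, hbD, hiD, hinv, hres⟩ :=
    exists_resolving_switch hm h₁ (by simpa using hc₁.symm) hi hi' (Or.inl ⟨rfl, hmn⟩)
      (resolves_up h₁ h₂ hi hi' hj hSm.1 hw hb hc₁)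
  have hcount := count_restrict_add (S := simple m₁ n₁) (hC := hinv) (fun x => (hinv x).not) 1
  rw [count_one_simple] at hcount
  obtain ⟨hf', hg'⟩ := bezout_unique hc₁ (by omega) hf (count_switch_of_left (hC := hinv) hab haD hbD)
    hfg
  obtain ⟨ε, hεδ, hεπ, hεin, hεout, hεlt, hεn⟩ := exists_split hab habn hinv (Or.inl ⟨haD, hbD⟩)
    hf' hg'
  obtain ⟨i', hi''⟩ := hεin i hiD
  have hii' : ε.symm (Sum.inl i') = i := by rw [← hi'', symm_apply_apply]
  have hδη : ∀ x, (simple m₁ n₁).δ (ε.symm (Sum.inl x)) = (simple (m₁ - f) (n₁ - g)).δ x := by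
    intro x
    rw [← hεδ, apply_symm_apply, sum_δ_inl]
  have hmn' := sub_lt_sub_of_bezout h₁ hf hg hfg
  have hξ' : IsTwoSegment (m₁ - f) (n₁ - g) m₂ n₂ :=
    isTwoSegment_iff.2 ⟨coprime_sub_of_bezout hf hg hfg, hc₂, h₂, hmn'⟩
  obtain ⟨Ψ, hΨ⟩ := exists_isGoodExchange (i := i') (j := j) hmn' h₂
    (by rw [← simple_δ_eq_zero_iff, ← hδη, hii', simple_δ_eq_zero_iff]; exact hi)
    (by rw [hεn, hii']; exact hi') hj (coprime_sub_of_bezout hf hg hfg) hc₂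
    (fun k hik hk => by
      refine Resolves.comap (η := fun x => ε.symm (Sum.inl x)) (S := simple m₁ n₁)
        (σ := swap a b * (simple m₁ n₁).π) (ε.symm.injective.comp Sum.inl_injective)
        (fun x => ?_) hδη hεlt ?_
      · apply ε.injective
        rw [← hεπ, apply_symm_apply, apply_symm_apply, sum_π_inl]
      · simp only [hii']
        refine hres _ (hεout k) ?_ ((hεn k).1 hk)
        have := (hεlt i' k).1 hik
        rw [hii'] at this
        exact this)
    (fun l hl => by
      obtain ⟨r, g1, g2, g3, g4, g5, -⟩ := resolves_down h₁ h₂ hm hi hi' hj hSm.1 hw hb hc₂ l hl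
      exact ⟨r, g1, g2, g3, g4, g5, trivial⟩)
  -- The identity of transpositions says that the second exchange amounts to switching the
  -- neighbours a and b before the first exchange is made.
  have key : ∀ s t : Elt m₁ n₁ m₂ n₂, (minimalABS m₁ n₁ m₂ n₂).δ s = 0 →
      (minimalABS m₁ n₁ m₂ n₂).δ t = 1 → Sm.lt s t →
      swap s t * swap (Sum.inl i) (Sum.inr j) =
        swap (Sum.inl i) (Sum.inr j) * swap (Sum.inl a) (Sum.inl b) →
      ∃ Smm, Sm.IsGoodExchange s t Smm ∧
        SplitsAs p K Smm (m₁ - f) (n₁ - g) m₂ n₂ f g := by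
    intro s t hs ht hst hτ
    refine exists_second_exchange p K h₁ h₂ hξ' (coprime_of_bezout hfg) hSm hΨ hs ht hst hτ
      ((sumCongr ε (Equiv.refl _)).trans (sumRightComm _ _ _)) ?_ ?_ ?_ ?_ ?_
    · change sumRightComm _ _ _ (Sum.inl (ε i)) = _
      rw [hi'']
      rfl
    · rfl
    · rintro (x | x)
      · change _ = (simple m₁ n₁).δ x
        rw [← hεδ]
        change ABS.δ _ (sumRightComm _ _ _ (Sum.inl (ε x))) = _
        rcases ε x with y | y <;> rfl
      · rfl
    · rintro (x | x)
      · rw [Perm.mul_apply, minimalABS, minimalABS, sum_π_inl, Sum.inl_injective.swap_apply]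
        change ABS.π _ (sumRightComm _ _ _ (Sum.inl (ε x))) = sumRightComm _ _ _ (Sum.inl (ε _))
        rw [← Perm.mul_apply, ← hεπ]
        rcases ε x with y | y <;> rfl
      · rw [Perm.mul_apply, minimalABS, minimalABS, sum_π_inr,
          swap_apply_of_ne_of_ne (by simp) (by simp)]
        rfl
    -- Passing from ξ to ξ' lowers the determinant by g m₂ - f n₂; by f n₁ - g m₁ = 1 the cross
    -- terms with ρ make up for all but 1.
    · push_cast [Nat.cast_sub hf, Nat.cast_sub hg]
      have := neg_le_abs (((n₁ - g + n₂) * f - (m₁ - f + m₂) * g : ℤ))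
      zify at hfg
      linarith
  rcases hcase with ⟨hbm, hib, hE⟩ | ⟨rfl, ham⟩
  · left
    obtain ⟨Smm, h3⟩ := key (Sum.inl b) (Sum.inl a) (simple_δ_eq_zero_iff.2 hbm.ge)
      (simple_δ_eq_one_iff.2 (by omega)) hE (by
        have hia : i ≠ a := fun e => by rw [e] at hi; omega
        rw [swap_comm (Sum.inl b)]
        ext x
        simp only [Perm.mul_apply, swap_apply_def]
        grind)
    exact ⟨_, _, Smm, by simp [eltName, hbm], by simp [eltName, ← hab, hbm], h3⟩
  · right
    have hne : a ≠ b := fun e => by rw [e] at hab; omega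
    obtain ⟨Smm, h3⟩ := key (Sum.inl a) (Sum.inr j) (simple_δ_eq_zero_iff.2 ham)
      (simple_δ_eq_one_iff.2 (by omega)) (lt_of_swap_lt hS hSm (simple_δ_eq_zero_iff.2 ham)
        (simple_δ_eq_one_iff.2 (by omega)) (by
          rw [swap_apply_of_ne_of_ne (by simpa using hne) (by simp), swap_apply_right,
            minimal_lt_inl_inl]
          omega)) (by
        ext x
        simp only [Perm.mul_apply, swap_apply_def]
        grind)
    exact ⟨_, _, Smm, by simp [eltName, hab], by simp [eltName], h3⟩

end FirstSummand


/-! ### Exchanges (c) and (d) -/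

section SecondSummand

variable (p : ℕ) [Fact p.Prime] (K : Type*) [Field K] [CharP K p] [PerfectRing K p]
  {m₁ n₁ m₂ n₂ : ℕ} {i : Fin (m₁ + n₁)} {j : Fin (m₂ + n₂)} {Sm : ABS (Elt m₁ n₁ m₂ n₂)}

theorem second_exchange_snd (hξ : IsTwoSegment m₁ n₁ m₂ n₂) (hm : 0 < m₁)
    (hn : 2 ≤ n₂) {f g : ℕ} (hf : f ≤ m₂) (hg : g ≤ n₂) (hfg : g * m₂ = f * n₂ + 1)
    (hi : m₁ ≤ i.val) (hi' : i.val < n₁) (hj : j.val < n₂)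
    (hSm : (minimalABS m₁ n₁ m₂ n₂).IsGoodExchange (Sum.inl i) (Sum.inr j) Sm) :
    SecondExchange p K Sm (Sum.inr (m₂ + 1)) (Sum.inr m₂) m₁ n₁ (m₂ - f) (n₂ - g) f g ∨
      SecondExchange p K Sm (Sum.inl (i.val + 1)) (Sum.inr (j.val + 2))
        m₁ n₁ (m₂ - f) (n₂ - g) f g := by
  obtain ⟨hc₁, hc₂, h₂, h₁⟩ := isTwoSegment_iff.1 hξ
  have hS := minimal_regular m₁ n₁ m₂ n₂
  obtain ⟨hw, hb⟩ := (hSm.1.length_add_one_iff hS).1 hSm.2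
  obtain ⟨a, b, D, hab, hcase, habn, hbD, haD, hjD, hinv, hres⟩ :=
    exists_resolving_switch_down hn h₂ hc₂ hj
      (resolves_down h₁ h₂ hm hi hi' hj hSm.1 hw hb hc₂)
  have hcount := count_restrict_add (S := simple m₂ n₂) (hC := hinv) (fun x => (hinv x).not) 0
  rw [count_zero_simple] at hcount
  obtain ⟨hg', hf'⟩ := bezout_unique hc₂.symm (by omega) hg
    (count_switch_of_right (hC := hinv) hab haD hbD) hfg
  obtain ⟨ε, hεδ, hεπ, hεin, hεout, hεlt, hεn⟩ := exists_split hab habn hinv (Or.inr ⟨hbD, haD⟩)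
    hf' hg'
  obtain ⟨j', hj'⟩ := hεin j hjD
  have hjj' : ε.symm (Sum.inl j') = j := by rw [← hj', symm_apply_apply]
  have hδη : ∀ x, (simple m₂ n₂).δ (ε.symm (Sum.inl x)) = (simple (m₂ - f) (n₂ - g)).δ x := by
    intro x
    rw [← hεδ, apply_symm_apply, sum_δ_inl]
  have hmn' := sub_lt_sub_of_bezout h₂ hg hf hfg
  have hc' := (coprime_sub_of_bezout hg hf hfg).symm
  have hξ' : IsTwoSegment m₁ n₁ (m₂ - f) (n₂ - g) :=
    isTwoSegment_iff.2 ⟨hc₁, hc', hmn', h₁⟩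
  obtain ⟨Ψ, hΨ⟩ := exists_isGoodExchange (i := i) (j := j') h₁ hmn' hi hi'
    (by rw [hεn, hjj']; exact hj) hc₁ hc'
    (fun k hik hk => by
      obtain ⟨r, g1, g2, g3, g4, g5, -⟩ := resolves_up h₁ h₂ hi hi' hj hSm.1 hw hb hc₁ k hik hk
      exact ⟨r, g1, g2, g3, g4, g5, trivial⟩)
    (fun l hl => by
      refine Resolves.comap (η := fun x => ε.symm (Sum.inl x)) (S := simple m₂ n₂)
        (σ := swap a b * (simple m₂ n₂).π) (ε.symm.injective.comp Sum.inl_injective)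
        (fun x => ?_) hδη hεlt ?_
      · apply ε.injective
        rw [← hεπ, apply_symm_apply, apply_symm_apply, sum_π_inl]
      · simp only [hjj']
        refine hres _ (hεout l) ?_
        have := (hεlt l j').1 hl
        rw [hjj'] at this
        exact this)
  have key : ∀ s t : Elt m₁ n₁ m₂ n₂, (minimalABS m₁ n₁ m₂ n₂).δ s = 0 →
      (minimalABS m₁ n₁ m₂ n₂).δ t = 1 → Sm.lt s t →
      swap s t * swap (Sum.inl i) (Sum.inr j) =
        swap (Sum.inl i) (Sum.inr j) * swap (Sum.inr a) (Sum.inr b) →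
      ∃ Smm, Sm.IsGoodExchange s t Smm ∧
        SplitsAs p K Smm m₁ n₁ (m₂ - f) (n₂ - g) f g := by
    intro s t hs ht hst hτ
    refine exists_second_exchange p K h₁ h₂ hξ' (coprime_of_bezout hfg).symm hSm hΨ hs ht hst hτ
      ((sumCongr (Equiv.refl _) ε).trans (sumAssoc _ _ _).symm) ?_ ?_ ?_ ?_ ?_
    · rfl
    · change (sumAssoc _ _ _).symm (Sum.inr (ε j)) = _
      rw [hj']
      rfl
    · rintro (x | x)
      · rfl
      · change _ = (simple m₂ n₂).δ x
        rw [← hεδ]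
        change ABS.δ _ ((sumAssoc _ _ _).symm (Sum.inr (ε x))) = _
        rcases ε x with y | y <;> rfl
    · rintro (x | x)
      · rw [Perm.mul_apply, minimalABS, minimalABS, sum_π_inl,
          swap_apply_of_ne_of_ne (by simp) (by simp)]
        rfl
      · rw [Perm.mul_apply, minimalABS, minimalABS, sum_π_inr, Sum.inr_injective.swap_apply]
        change ABS.π _ ((sumAssoc _ _ _).symm (Sum.inr (ε x))) =
          (sumAssoc _ _ _).symm (Sum.inr (ε _))
        rw [← Perm.mul_apply, ← hεπ]
        rcases ε x with y | y <;> rfl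
    · push_cast [Nat.cast_sub hf, Nat.cast_sub hg]
      have := le_abs_self (((n₁ + (n₂ - g)) * f - (m₁ + (m₂ - f)) * g : ℤ))
      zify at hfg
      linarith
  rcases hcase with ⟨hbm, hja, hE⟩ | ⟨rfl, hbm⟩
  · left
    obtain ⟨Smm, h3⟩ := key (Sum.inr b) (Sum.inr a) (simple_δ_eq_zero_iff.2 hbm.ge)
      (simple_δ_eq_one_iff.2 (by omega)) hE (by
        have hjb : j ≠ b := fun e => by rw [e] at hj; omega
        rw [swap_comm (Sum.inr b)]
        ext x
        simp only [Perm.mul_apply, swap_apply_def]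
        grind)
    exact ⟨_, _, Smm, by simp [eltName, hbm], by simp [eltName, ← hab, hbm], h3⟩
  · right
    have hne : b ≠ a := fun e => by rw [e] at hab; omega
    obtain ⟨Smm, h3⟩ := key (Sum.inl i) (Sum.inr b) (simple_δ_eq_zero_iff.2 hi)
      (simple_δ_eq_one_iff.2 hbm) (lt_of_swap_lt hS hSm (simple_δ_eq_zero_iff.2 hi)
        (simple_δ_eq_one_iff.2 hbm) (by
          rw [swap_apply_of_ne_of_ne (x := Sum.inr b) (by simp) (by simpa using hne),
            swap_apply_left, minimal_lt_inr_inr]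
          omega)) (by
        ext x
        simp only [Perm.mul_apply, swap_apply_def]
        grind)
    exact ⟨_, _, Smm, by simp [eltName], by simp [eltName, hab], h3⟩

end SecondSummand


/-! ### Exchange (e) -/

section EqualRank

/-- The decomposition of the elements in the case `ξ = (a + 1, a + 2) + (b, 1)`, `ρ = (1, 1)`. -/
def splitFun (a b : ℕ) : Elt (a + 1) (a + 2) b 1 → Elt a (a + 1) b 1 ⊕ Fin (1 + 1) :=
  Sum.elim
    (fun x => if h : x.val < a then Sum.inl (Sum.inl ⟨x.val, by omega⟩)
      else if x.val = a then Sum.inl (Sum.inr ⟨0, by omega⟩)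
      else if h : x.val = 2 * a + 2 then Sum.inr ⟨1, by omega⟩
      else Sum.inl (Sum.inl ⟨x.val - 1, by omega⟩))
    (fun y => if y.val = 0 then Sum.inr ⟨0, by omega⟩ else Sum.inl (Sum.inr y))

variable {a b : ℕ}

theorem splitFun_inl_of_lt {v : ℕ} (h : v < a) :
    splitFun a b (Sum.inl ⟨v, by omega⟩) = Sum.inl (Sum.inl ⟨v, by omega⟩) := by
  rw [splitFun, Sum.elim_inl, dif_pos h]

theorem splitFun_inl_eq :
    splitFun a b (Sum.inl ⟨a, by omega⟩) = Sum.inl (Sum.inr ⟨0, by omega⟩) := by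
  rw [splitFun, Sum.elim_inl, dif_neg (Nat.lt_irrefl a), if_pos rfl]

theorem splitFun_inl_last :
    splitFun a b (Sum.inl ⟨2 * a + 2, by omega⟩) = Sum.inr ⟨1, by omega⟩ := by
  rw [splitFun, Sum.elim_inl, dif_neg (by simp only; omega), if_neg (by simp only; omega),
    dif_pos rfl]

theorem splitFun_inl_add_one {v : ℕ} (h : a ≤ v) (h' : v < 2 * a + 1) :
    splitFun a b (Sum.inl ⟨v + 1, by omega⟩) = Sum.inl (Sum.inl ⟨v, by omega⟩) := by
  rw [splitFun, Sum.elim_inl, dif_neg (by simp only; omega), if_neg (by simp only; omega),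
    dif_neg (by simp only; omega)]
  rfl

theorem splitFun_inr_zero :
    splitFun a b (Sum.inr ⟨0, by omega⟩) = Sum.inr ⟨0, by omega⟩ := by
  rw [splitFun, Sum.elim_inr, if_pos rfl]

theorem splitFun_inr_add_one {v : ℕ} (h : v < b) :
    splitFun a b (Sum.inr ⟨v + 1, by omega⟩) = Sum.inl (Sum.inr ⟨v + 1, by omega⟩) := by
  rw [splitFun, Sum.elim_inr, if_neg (Nat.succ_ne_zero v)]

theorem elt_cases (x : Elt (a + 1) (a + 2) b 1) :
    (∃ v, ∃ _ : v < a, x = Sum.inl ⟨v, by omega⟩) ∨ x = Sum.inl ⟨a, by omega⟩ ∨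
      x = Sum.inl ⟨2 * a + 2, by omega⟩ ∨
      (∃ v, ∃ _ : a ≤ v, ∃ _ : v < 2 * a + 1, x = Sum.inl ⟨v + 1, by omega⟩) ∨
      x = Sum.inr ⟨0, by omega⟩ ∨ ∃ v, ∃ _ : v < b, x = Sum.inr ⟨v + 1, by omega⟩ := by
  rcases x with ⟨v, hv⟩ | ⟨v, hv⟩
  · rcases _root_.lt_trichotomy v a with h | rfl | h
    · exact Or.inl ⟨v, h, rfl⟩
    · exact Or.inr (Or.inl rfl)
    · by_cases h' : v = 2 * a + 2
      · subst h'
        exact Or.inr (Or.inr (Or.inl rfl))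
      · obtain ⟨v, rfl⟩ : ∃ u, v = u + 1 := ⟨v - 1, by omega⟩
        exact Or.inr (Or.inr (Or.inr (Or.inl ⟨v, by omega, by omega, rfl⟩)))
  · rcases v with - | v
    · exact Or.inr (Or.inr (Or.inr (Or.inr (Or.inl rfl))))
    · exact Or.inr (Or.inr (Or.inr (Or.inr (Or.inr ⟨v, by omega, rfl⟩))))

theorem splitFun_surjective : Function.Surjective (splitFun a b) := by
  rintro ((⟨v, hv⟩ | ⟨v, hv⟩) | ⟨v, hv⟩)
  · by_cases h : v < a
    · exact ⟨_, splitFun_inl_of_lt h⟩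
    · exact ⟨_, splitFun_inl_add_one (not_lt.1 h) (by omega)⟩
  · rcases v with - | v
    · exact ⟨_, splitFun_inl_eq⟩
    · exact ⟨_, splitFun_inr_add_one (by omega)⟩
  · rcases v with - | - | v
    · exact ⟨_, splitFun_inr_zero⟩
    · exact ⟨_, splitFun_inl_last⟩
    · omega

theorem splitFun_bijective : Function.Bijective (splitFun a b) := by
  refine (Fintype.bijective_iff_surjective_and_card _).2 ⟨splitFun_surjective, ?_⟩
  simp only [Fintype.card_sum, Fintype.card_fin]
  omega

theorem δ_splitFun (hb : 0 < b) (x : Elt (a + 1) (a + 2) b 1) :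
    ((minimalABS a (a + 1) b 1).sum (simple 1 1)).δ (splitFun a b x) =
      (minimalABS (a + 1) (a + 2) b 1).δ x := by
  rcases elt_cases x with ⟨v, hv, rfl⟩ | rfl | rfl | ⟨v, hv, hv', rfl⟩ | rfl | ⟨v, hv, rfl⟩
  · rw [splitFun_inl_of_lt hv, sum_δ_inl, minimalABS, minimalABS, sum_δ_inl, sum_δ_inl,
      simple_δ_eq_one_iff.2 hv, simple_δ_eq_one_iff.2 (by simp only; omega)]
  · rw [splitFun_inl_eq, sum_δ_inl, minimalABS, minimalABS, sum_δ_inr, sum_δ_inl,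
      simple_δ_eq_one_iff.2 hb, simple_δ_eq_one_iff.2 (Nat.lt_succ_self a)]
  · rw [splitFun_inl_last, sum_δ_inr, minimalABS, sum_δ_inl,
      simple_δ_eq_zero_iff.2 le_rfl, simple_δ_eq_zero_iff.2 (by simp only; omega)]
  · rw [splitFun_inl_add_one hv hv', sum_δ_inl, minimalABS, minimalABS, sum_δ_inl, sum_δ_inl,
      simple_δ_eq_zero_iff.2 hv, simple_δ_eq_zero_iff.2 (by simp only; omega)]
  · rw [splitFun_inr_zero, sum_δ_inr, minimalABS, sum_δ_inr,
      simple_δ_eq_one_iff.2 Nat.one_pos, simple_δ_eq_one_iff.2 hb]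
  · rw [splitFun_inr_add_one hv, sum_δ_inl, minimalABS, minimalABS, sum_δ_inr, sum_δ_inr]

theorem simple_π_mk_of_eq_add {m n v w : ℕ} (hv : v < m) (hw : w = v + n) :
    (simple m n).π ⟨v, by omega⟩ = ⟨w, by omega⟩ := by
  subst hw
  exact simple_π_mk_of_lt hv

theorem simple_π_mk_of_add_eq {m n v w : ℕ} (hw : w < n) (hv : v = w + m) :
    (simple m n).π ⟨v, by omega⟩ = ⟨w, by omega⟩ := by
  subst hv
  exact simple_π_mk_add hw

/-- The two exchanges make a 2-cycle of the last element of A and the first of B, which is N_{1,1}.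
The last one of A, of index a, takes over the place of the first element of B. -/
theorem π_splitFun (hb : 1 < b) (x : Elt (a + 1) (a + 2) b 1) :
    swap (Sum.inl (Sum.inl ⟨a, by omega⟩)) (Sum.inl (Sum.inr ⟨0, by omega⟩))
      (((minimalABS a (a + 1) b 1).sum (simple 1 1)).π (splitFun a b x)) =
    splitFun a b (swap (Sum.inl ⟨2 * a + 2, by omega⟩) (Sum.inr ⟨1, by omega⟩)
      (swap (Sum.inl ⟨a + 1, by omega⟩) (Sum.inr ⟨0, by omega⟩)
        ((minimalABS (a + 1) (a + 2) b 1).π x))) := by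
  have sw₁ : ∀ {x : Elt (a + 1) (a + 2) b 1}, x ≠ Sum.inl ⟨a + 1, by omega⟩ →
      x ≠ Sum.inr ⟨0, by omega⟩ →
      swap (Sum.inl ⟨a + 1, by omega⟩) (Sum.inr ⟨0, by omega⟩) x = x := swap_apply_of_ne_of_ne
  have sw₂ : ∀ {x : Elt (a + 1) (a + 2) b 1}, x ≠ Sum.inl ⟨2 * a + 2, by omega⟩ →
      x ≠ Sum.inr ⟨1, by omega⟩ →
      swap (Sum.inl ⟨2 * a + 2, by omega⟩) (Sum.inr ⟨1, by omega⟩) x = x := swap_apply_of_ne_of_ne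
  have sw₃ : ∀ {x : Elt a (a + 1) b 1 ⊕ Fin (1 + 1)}, x ≠ Sum.inl (Sum.inl ⟨a, by omega⟩) →
      x ≠ Sum.inl (Sum.inr ⟨0, by omega⟩) →
      swap (Sum.inl (Sum.inl ⟨a, by omega⟩)) (Sum.inl (Sum.inr ⟨0, by omega⟩)) x = x :=
    swap_apply_of_ne_of_ne
  rcases elt_cases x with ⟨v, hv, rfl⟩ | rfl | rfl | ⟨v, hv, hv', rfl⟩ | rfl | ⟨v, hv, rfl⟩
  · rw [splitFun_inl_of_lt hv, sum_π_inl, minimalABS, minimalABS, sum_π_inl, sum_π_inl,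
      simple_π_mk_of_lt hv, simple_π_mk_of_eq_add (w := v + (a + 1) + 1) (by omega) (by omega),
      sw₁ (by simp; omega) (by simp), sw₂ (by simp; omega) (by simp),
      sw₃ (by simp; omega) (by simp), splitFun_inl_add_one (by omega) (by omega)]
  · rw [splitFun_inl_eq, sum_π_inl, minimalABS, minimalABS, sum_π_inl, sum_π_inr,
      simple_π_mk_of_eq_add (w := 2 * a + 2) (v := a) (by omega) (by omega),
      simple_π_mk_of_eq_add (w := 0 + 1) (v := 0) (by omega) (by omega),
      sw₁ (by simp; omega) (by simp), swap_apply_left, sw₃ (by simp) (by simp)]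
    exact (splitFun_inr_add_one (by omega)).symm
  · rw [splitFun_inl_last, sum_π_inr, minimalABS, sum_π_inl,
      simple_π_mk_of_add_eq (w := 0) (by omega) rfl,
      simple_π_mk_of_add_eq (w := a + 1) (by omega) (by omega),
      swap_apply_left, sw₂ (by simp) (by simp), sw₃ (by simp) (by simp), splitFun_inr_zero]
  · rw [splitFun_inl_add_one hv hv', sum_π_inl, minimalABS, minimalABS, sum_π_inl, sum_π_inl,
      simple_π_mk_of_add_eq (v := v) (w := v - a) (by omega) (by omega),
      simple_π_mk_of_add_eq (v := v + 1) (w := v - a) (by omega) (by omega),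
      sw₁ (by simp; omega) (by simp), sw₂ (by simp; omega) (by simp)]
    rcases (show v - a ≤ a by omega).lt_or_eq with h | h
    · rw [sw₃ (by simp; omega) (by simp), splitFun_inl_of_lt h]
    · simp only [h]
      rw [swap_apply_left, splitFun_inl_eq]
  · rw [splitFun_inr_zero, sum_π_inr, minimalABS, sum_π_inr,
      simple_π_mk_of_eq_add (v := 0) (w := 1) (by omega) rfl,
      simple_π_mk_of_eq_add (v := 0) (w := 1) (by omega) rfl,
      sw₁ (by simp) (by simp), swap_apply_right, sw₃ (by simp) (by simp), splitFun_inl_last]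
  · rw [splitFun_inr_add_one hv, sum_π_inl, minimalABS, minimalABS, sum_π_inr, sum_π_inr]
    rcases (show v + 1 ≤ b by omega).lt_or_eq with h | h
    · rw [simple_π_mk_of_eq_add (w := v + 1 + 1) h rfl, sw₁ (by simp) (by simp),
        sw₂ (by simp) (by simp), sw₃ (by simp) (by simp), splitFun_inr_add_one h]
    · rw [simple_π_mk_of_add_eq (w := 0) (by omega) (by omega), swap_apply_right, swap_apply_right,
        sw₂ (by simp; omega) (by simp), splitFun_inl_add_one le_rfl (by omega)]

variable (p : ℕ) [Fact p.Prime] (K : Type*) [Field K] [CharP K p] [PerfectRing K p]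

theorem second_exchange_one_one (hξ : IsTwoSegment (a + 1) (a + 2) b 1)
    {i : Fin (a + 1 + (a + 2))} {j : Fin (b + 1)} {Sm : ABS (Elt (a + 1) (a + 2) b 1)}
    (hi : i.val = a + 1) (hj : j.val = 0)
    (hSm : (minimalABS (a + 1) (a + 2) b 1).IsGoodExchange (Sum.inl i) (Sum.inr j) Sm) :
    SecondExchange p K Sm (Sum.inl (a + 1 + (a + 2))) (Sum.inr (1 + 1)) a (a + 1) b 1 1 1 := by
  obtain ⟨hc₁, hc₂, h₂, h₁⟩ := isTwoSegment_iff.1 hξ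
  have hi' : i = ⟨a + 1, by omega⟩ := Fin.ext hi
  have hj' : j = ⟨0, by omega⟩ := Fin.ext hj
  rw [hi', hj'] at hSm
  have hS := minimal_regular (a + 1) (a + 2) b 1
  have hc₁' : Nat.Coprime a (a + 1) := by simp
  have hξ' : IsTwoSegment a (a + 1) b 1 := isTwoSegment_iff.2 ⟨hc₁', hc₂, h₂, Nat.lt_succ_self a⟩
  -- There are no elements between those exchanged, so goodness is automatic.
  obtain ⟨Ψ, hΨ⟩ := exists_isGoodExchange (m₁ := a) (n₁ := a + 1) (m₂ := b) (n₂ := 1)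
    (i := ⟨a, by omega⟩) (j := ⟨0, by omega⟩) (Nat.lt_succ_self a) h₂ le_rfl (Nat.lt_succ_self a)
    Nat.one_pos hc₁' hc₂ (fun k hk hk' => by simp only at hk; omega)
    (fun l hl => by simp only at hl; omega)
  have hs : (minimalABS (a + 1) (a + 2) b 1).δ (Sum.inl ⟨2 * a + 2, by omega⟩) = 0 :=
    simple_δ_eq_zero_iff.2 (by simp only; omega)
  have ht : (minimalABS (a + 1) (a + 2) b 1).δ (Sum.inr ⟨1, by omega⟩) = 1 :=
    simple_δ_eq_one_iff.2 h₂
  obtain ⟨Smm, h3⟩ := exists_second_exchange_of_equiv p K h₁ h₂ hξ' (Nat.coprime_one_left 1) hSm hΨ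
    hs ht (lt_of_swap_lt hS hSm hs ht (by
      rw [swap_apply_of_ne_of_ne (by simp; omega) (by simp),
        swap_apply_of_ne_of_ne (by simp) (by simp), minimal_lt_inl_inr h₁ h₂]
      exact Or.inr le_rfl)) (Equiv.ofBijective _ splitFun_bijective) (δ_splitFun (by omega))
    (π_splitFun h₂) (by
      have := neg_le_abs ((((a + 1 : ℕ) + (1 : ℕ)) * (1 : ℕ) - (a + b) * (1 : ℕ) : ℤ))
      push_cast at this ⊢
      linarith)
  exact ⟨_, _, Smm, by simp only [eltName, Sum.map_inl]; congr 1; omega, by simp [eltName], h3⟩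

end EqualRank

end ABS

theorem proposition5p2 (p : ℕ) [Fact p.Prime] (K : Type*) [Field K] [CharP K p] [PerfectRing K p]
    (m₁ n₁ m₂ n₂ : ℕ) (hξ : IsTwoSegment m₁ n₁ m₂ n₂)
    (h₂ : 0 < segSlope m₂ n₂) (h₁ : segSlope m₁ n₁ < 1) :
    (m₁ + 1 < n₁ →
      ∃ f g : ℕ, f ≤ m₁ ∧ g ≤ n₁ ∧ f * n₁ = g * m₁ + 1 ∧
        ∀ (i j : ℕ) (s t : Elt m₁ n₁ m₂ n₂) (Sm : ABS (Elt m₁ n₁ m₂ n₂)),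
          m₁ < i → i ≤ n₁ → 1 ≤ j → j ≤ n₂ → eltName s = Sum.inl i → eltName t = Sum.inr j →
          (minimalABS m₁ n₁ m₂ n₂).IsGoodExchange s t Sm →
          SecondExchange p K Sm (Sum.inl (m₁ + 1)) (Sum.inl m₁)
              (m₁ - f) (n₁ - g) m₂ n₂ f g ∨
            SecondExchange p K Sm (Sum.inl (i - 1)) (Sum.inr j)
              (m₁ - f) (n₁ - g) m₂ n₂ f g) ∧
    (n₁ = m₁ + 1 →
      ∃ f g : ℕ,
        ∀ (i j : ℕ) (s t : Elt m₁ n₁ m₂ n₂) (Sm : ABS (Elt m₁ n₁ m₂ n₂)),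
          m₁ < i → i ≤ n₁ → 1 ≤ j → j ≤ n₂ → eltName s = Sum.inl i → eltName t = Sum.inr j →
          (minimalABS m₁ n₁ m₂ n₂).IsGoodExchange s t Sm →
          (f ≤ m₂ ∧ g ≤ n₂ ∧ g * m₂ = f * n₂ + 1 ∧
            (SecondExchange p K Sm (Sum.inr (m₂ + 1)) (Sum.inr m₂)
                m₁ n₁ (m₂ - f) (n₂ - g) f g ∨
              SecondExchange p K Sm (Sum.inl i) (Sum.inr (j + 1))
                m₁ n₁ (m₂ - f) (n₂ - g) f g)) ∨
          (f = 1 ∧ g = 1 ∧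
            SecondExchange p K Sm (Sum.inl (m₁ + n₁)) (Sum.inr (n₂ + 1))
              (m₁ - 1) (n₁ - 1) m₂ n₂ f g)) := by
  obtain ⟨hc₁, hc₂, hmn₂, hmn₁⟩ := isTwoSegment_iff.1 hξ
  have hm₁ : 0 < m₁ := by
    rw [Nat.pos_iff_ne_zero]
    rintro rfl
    have hn₁ : (n₁ : ℚ) ≠ 0 := by exact_mod_cast hmn₁.ne'
    simp [segSlope, hn₁] at h₁
  have hn₂ : 0 < n₂ := by
    rw [Nat.pos_iff_ne_zero]
    rintro rfl
    simp [segSlope] at h₂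
  have hname : ∀ (i j : ℕ) (s t : Elt m₁ n₁ m₂ n₂), eltName s = Sum.inl i → eltName t = Sum.inr j →
      ∃ (x : Fin (m₁ + n₁)) (y : Fin (m₂ + n₂)),
        s = Sum.inl x ∧ t = Sum.inr y ∧ i = x.val + 1 ∧ j = y.val + 1 := by
    rintro i j (x | x) (y | y) hs ht
    · simp [eltName] at ht
    · simp only [eltName, Sum.map_inl, Sum.map_inr, Sum.inl.injEq, Sum.inr.injEq] at hs ht
      exact ⟨x, y, rfl, rfl, hs.symm, ht.symm⟩
    · simp [eltName] at hs
    · simp [eltName] at hs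
  constructor
  · intro hlt
    obtain ⟨f, g, hf, hg, hfg⟩ := ABS.exists_bezout hc₁ hm₁ (by omega)
    refine ⟨f, g, hf, hg, hfg, fun i j s t Sm hi hi' hj hj' hs ht hSm => ?_⟩
    obtain ⟨x, y, rfl, rfl, rfl, rfl⟩ := hname i j s t hs ht
    exact ABS.second_exchange_fst p K hξ hm₁ hlt hf hg hfg (by omega) (by omega) (by omega) hSm
  · rintro rfl
    -- Cutting B requires n₂ ≥ 2. For n₂ = 1 the bounds leave only i = m₁ + 1 and j = 1, and (e)
    -- applies.
    by_cases h : n₂ = 1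
    · subst h
      obtain ⟨a, rfl⟩ : ∃ a, m₁ = a + 1 := ⟨m₁ - 1, by omega⟩
      refine ⟨1, 1, fun i j s t Sm hi hi' hj hj' hs ht hSm => Or.inr ⟨rfl, rfl, ?_⟩⟩
      obtain ⟨x, y, rfl, rfl, rfl, rfl⟩ := hname i j s t hs ht
      exact ABS.second_exchange_one_one p K hξ (by omega) (by omega) hSm
    · obtain ⟨g, f, hg, hf, hfg⟩ := ABS.exists_bezout hc₂.symm hn₂ (by omega)
      refine ⟨f, g, fun i j s t Sm hi hi' hj hj' hs ht hSm => Or.inl ⟨hf, hg, hfg, ?_⟩⟩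
      obtain ⟨x, y, rfl, rfl, rfl, rfl⟩ := hname i j s t hs ht
      exact ABS.second_exchange_snd p K hξ hm₁ (by omega) hf hg hfg (by omega) (by omega)
        (by omega) hSm
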